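/- **Proposition 1.1 (higher-rank theta transformation formula).** Let $g\ge 1$ and let $D=\mathrm{diag}(d_1,\dots,d_g)$ with positive integers $d_1\mid d_2\mid\dots\mid d_g$. Write $\mathfrak h_g$ for the Siegel upper half space and $e(x)=\exp(x)$. *Forms and lattices.* For $Z\in\mathfrak h_g$ every $v\in\mathbb C^g$ is uniquely $v=Zv^1+v^2$ with $v^1,v^2\in\mathbb R^g$. Let $\Lambda_Z=Z\mathbb Z^g+D\mathbb Z^g$, $H(v,w)={}^tv(\operatorname{Im}Z)^{-1}\bar w$ (so $H=H_Z$ is a polarization of type $D$ on $X_Z=\mathbb C^g/\Lambda_Z$), $B(v,w)={}^tv(\operatorname{Im}Z)^{-1}w$, $E=\operatorname{Im}H$, and $\Lambda(H_Z)=\{v\in\mathbb C^g: E(v,\Lambda_Z)\subset\mathbb Z\}$. *Theta functions.* For $c\in\mathbb C^g$ let $$\theta^c_0(v)=e\!\left(-\pi H(v,c)-\tfrac{\pi}{2}H(c,c)+\tfrac{\pi}{2}B(v+c,v+c)\right)\sum_{\lambda\in Z\mathbb Z^g}e\!\left(\pi(H-B)(v+c,\lambda)-\tfrac{\pi}{2}(H-B)(\lambda,\lambda)\right),$$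 and for $w=Zw^1+w^2\in\Lambda(H_Z)$ let $\theta^c_w(v)=a_c(w,v)^{-1}\theta^c_0(v+w)$, where $a_c(w,v)=\chi_c(w)\,e\!\left(\pi H(v,w)+\tfrac{\pi}{2}H(w,w)\right)$ and $\chi_c(w)=e\!\left(\pi i\,E(Zw^1,w^2)+2\pi i\,E(c,w)\right)$. Let $\mathbb Z_D=\bigoplus_i\mathbb Z/d_i$. The tuple $B^Z=\langle\theta^c_{ZD^{-1}m}\,;\,m\in\mathbb Z_D\rangle$ is the canonical basis of the canonical theta functions for the line bundle $L(H_Z,\chi_c)$ of characteristic $c$. *The group.* Let $\Gamma_D$ be the set of integral $2g\times 2g$ matrices $R$ with $R\begin{pmatrix}0&D\\-D&0\end{pmatrix}{}^tR=\begin{pmatrix}0&D\\-D&0\end{pmatrix}$, and let $G_D\subset \mathrm{Sp}_{2g}(\mathbb Q)$ be the group of the matrices $M=\begin{pmatrix}I&0\\0&D\end{pmatrix}^{-1}R\begin{pmatrix}I&0\\0&D\end{pmatrix}$ with $R\in\Gamma_D$. For $M=\begin{pmatrix}\alpha&\beta\\\gamma&\delta\end{pmatrix}\in G_D$ put $Z'=M(Z)=(\alpha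 Z+\beta)(\gamma Z+\delta)^{-1}$, and let $\psi:X_{Z'}\to X_Z$ be the isomorphism induced by $v'\mapsto{}^t(\gamma Z+\delta)v'$. For $c=Zc^1+c^2$ put $M[c]=Z'M[c]^1+M[c]^2$ with $$M[c]^1=\delta c^1-\gamma c^2+\tfrac12(D\gamma\,{}^t\delta)_0,\qquad M[c]^2=-\beta c^1+\alpha c^2+\tfrac12(\alpha\,{}^t\beta)_0,$$ where $(\ )_0$ is the vector of diagonal entries. Let $B^{Z'}=\langle\theta^{M[c]}_{Z'D^{-1}n}\,;\,n\in\mathbb Z_D\rangle$, formed at $Z'$ with the characteristic $M[c]$. *Statement.* Let $M\in G_D$ and let $c^1,c^2\in\mathbb R^g$ be such that $Zc^1+c^2\in\frac12\Lambda(H_Z)$ for some (equivalently, every) $Z\in\mathfrak h_g$. The function $Z\mapsto\det(\gamma Z+\delta)$ has a continuous square root on $\mathfrak h_g$. For every such square root $\det(\gamma Z+\delta)^{1/2}$ there is a complex matrix $C_M$, indexed by $\mathbb Z_D\times\mathbb Z_D$ and independent of $Z$ (it depends on $M$, $c^1$, $c^2$ and on the choice of the square root), such that for every $Z\in\mathfrak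 h_g$, with $c=Zc^1+c^2$, there is exactly one matrix $C$ with $\psi^*B^Z=C\,B^{Z'}$, namely $$C=\det(\gamma Z+\delta)^{-1/2}\,C_M .$$ Moreover $(\det C_M)^8=1$, except when $3\mid d_g$ and $\gcd(3,d_{g-1})=1$ (for $g=1$: when $3\mid d_1$), in which case $(\det C_M)^{24}=1$. -/

import Mathlib

open Matrix

namespace HigherTheta

noncomputable section

/-- A polarization type `D = (d_1, …, d_g)`: positive integers with `d_1 ∣ d_2 ∣ … ∣ d_g`. -/
def IsPolarizationType {g : ℕ} (d : Fin g → ℕ) : Prop :=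
  (∀ i, 0 < d i) ∧ ∀ i j, i ≤ j → d i ∣ d j

/-- The exceptional types: `3 ∣ d_g` and `gcd (3, d_{g-1}) = 1`, the second condition being
empty when `g = 1` (that is, `d_0 = 1`). -/
def IsExceptional {g : ℕ} (d : Fin g → ℕ) : Prop :=
  (∀ i : Fin g, (i : ℕ) + 1 = g → 3 ∣ d i) ∧ (∀ i : Fin g, (i : ℕ) + 2 = g → Nat.gcd 3 (d i) = 1)

/-- The Siegel upper half space of degree `g`. -/
def siegel (g : ℕ) : Set (Matrix (Fin g) (Fin g) ℂ) :=
  {Z | Zᵀ = Z ∧ (Z.map Complex.im).PosDef}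

/-! ### The group `G_D` and its action -/

/-- `Γ_D`: integral `R` with `R (0, D; -D, 0) Rᵀ = (0, D; -D, 0)`. -/
def GammaD {g : ℕ} (d : Fin g → ℕ) : Set (Matrix (Fin g ⊕ Fin g) (Fin g ⊕ Fin g) ℤ) :=
  {R | R * fromBlocks 0 (diagonal fun i => (d i : ℤ)) (-diagonal fun i => (d i : ℤ)) 0 * Rᵀ =
    fromBlocks 0 (diagonal fun i => (d i : ℤ)) (-diagonal fun i => (d i : ℤ)) 0}

/-- `G_D`: the rational symplectic matrices `(I, 0; 0, D)⁻¹ R (I, 0; 0, D)` with `R ∈ Γ_D`. -/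
def GD {g : ℕ} (d : Fin g → ℕ) : Set (Matrix (Fin g ⊕ Fin g) (Fin g ⊕ Fin g) ℚ) :=
  {M | M ∈ symplecticGroup (Fin g) ℚ ∧ ∃ R ∈ GammaD d,
    M = (fromBlocks 1 0 0 (diagonal fun i => (d i : ℚ)))⁻¹ * R.map (Int.cast : ℤ → ℚ) *
      fromBlocks 1 0 0 (diagonal fun i => (d i : ℚ))}

/-- `γ Z + δ` for `M = (α, β; γ, δ)`. -/
def denom {g : ℕ} (M : Matrix (Fin g ⊕ Fin g) (Fin g ⊕ Fin g) ℚ) (Z : Matrix (Fin g) (Fin g) ℂ) :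
    Matrix (Fin g) (Fin g) ℂ :=
  M.toBlocks₂₁.map (Rat.cast : ℚ → ℂ) * Z + M.toBlocks₂₂.map (Rat.cast : ℚ → ℂ)

/-- `M(Z) = (α Z + β) (γ Z + δ)⁻¹`. -/
def act {g : ℕ} (M : Matrix (Fin g ⊕ Fin g) (Fin g ⊕ Fin g) ℚ) (Z : Matrix (Fin g) (Fin g) ℂ) :
    Matrix (Fin g) (Fin g) ℂ :=
  (M.toBlocks₁₁.map (Rat.cast : ℚ → ℂ) * Z + M.toBlocks₁₂.map (Rat.cast : ℚ → ℂ)) * (denom M Z)⁻¹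

/-- The analytic representation of the isomorphism `ψ(M) : X_{M(Z)} → X_Z`, which is
`v' ↦ A v'` with `A = ᵗ(γ Z + δ)`. -/
def psiA {g : ℕ} (M : Matrix (Fin g ⊕ Fin g) (Fin g ⊕ Fin g) ℚ) (Z : Matrix (Fin g) (Fin g) ℂ)
    (v : Fin g → ℂ) : Fin g → ℂ :=
  (denom M Z)ᵀ *ᵥ v

/-- `s` is a branch on the Siegel space of the square root of `Z ↦ det (γ Z + δ)`. -/
def IsSqrtDetBranch {g : ℕ} (M : Matrix (Fin g ⊕ Fin g) (Fin g ⊕ Fin g) ℚ)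
    (s : Matrix (Fin g) (Fin g) ℂ → ℂ) : Prop :=
  ContinuousOn s (siegel g) ∧ ∀ Z ∈ siegel g, s Z ^ 2 = (denom M Z).det

/-! ### The polarization, its forms and characteristics -/

/-- The Hermitian form `H_Z`, with matrix `(Im Z)⁻¹`; linear in the first variable. -/
def formH {g : ℕ} (Z : Matrix (Fin g) (Fin g) ℂ) (v w : Fin g → ℂ) : ℂ :=
  v ⬝ᵥ (((Z.map Complex.im)⁻¹).map Complex.ofReal *ᵥ star w)

/-- The symmetric form `B_Z`: the `ℂ`-bilinear extension of the restriction of `H_Z` to `ℝ^g`. -/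
def formB {g : ℕ} (Z : Matrix (Fin g) (Fin g) ℂ) (v w : Fin g → ℂ) : ℂ :=
  v ⬝ᵥ (((Z.map Complex.im)⁻¹).map Complex.ofReal *ᵥ w)

/-- The alternating form `E = Im H_Z`. -/
def formE {g : ℕ} (Z : Matrix (Fin g) (Fin g) ℂ) (v w : Fin g → ℂ) : ℝ :=
  (formH Z v w).im

/-- The component `v^1 ∈ ℝ^g` in the decomposition `v = Z v^1 + v^2`. -/
def coord₁ {g : ℕ} (Z : Matrix (Fin g) (Fin g) ℂ) (v : Fin g → ℂ) : Fin g → ℝ :=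
  (Z.map Complex.im)⁻¹ *ᵥ fun i => (v i).im

/-- The component `v^2 ∈ ℝ^g` in the decomposition `v = Z v^1 + v^2`. -/
def coord₂ {g : ℕ} (Z : Matrix (Fin g) (Fin g) ℂ) (v : Fin g → ℂ) : Fin g → ℝ :=
  (fun i => (v i).re) - Z.map Complex.re *ᵥ coord₁ Z v

/-- The vector `Z x + y` of `ℂ^g` for `x, y ∈ ℝ^g`. -/
def toVec {g : ℕ} (Z : Matrix (Fin g) (Fin g) ℂ) (x y : Fin g → ℝ) : Fin g → ℂ :=
  Z *ᵥ (fun i => (x i : ℂ)) + fun i => (y i : ℂ)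

/-- The lattice `Λ_Z = Z ℤ^g + D ℤ^g`. -/
def lattice {g : ℕ} (d : Fin g → ℕ) (Z : Matrix (Fin g) (Fin g) ℂ) : Set (Fin g → ℂ) :=
  {v | ∃ n k : Fin g → ℤ, v = toVec Z (fun i => (n i : ℝ)) (fun i => (d i : ℝ) * (k i : ℝ))}

/-- `Λ(H_Z)`: the vectors `v` with `E(v, Λ_Z) ⊆ ℤ`. -/
def latticeH {g : ℕ} (d : Fin g → ℕ) (Z : Matrix (Fin g) (Fin g) ℂ) : Set (Fin g → ℂ) :=
  {v | ∀ l ∈ lattice d Z, ∃ k : ℤ, formE Z v l = (k : ℝ)}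

/-- The semicharacter of the line bundle of characteristic `c`, in its standard extension to
`ℂ^g`: `χ(v) = χ₀(v) exp (2 π i E(c, v))` with `χ₀(v) = exp (π i E(v_1, v_2))`, where
`v_1 = Z v^1` and `v_2 = v^2`. -/
def semichar {g : ℕ} (Z : Matrix (Fin g) (Fin g) ℂ) (c v : Fin g → ℂ) : ℂ :=
  Complex.exp (Real.pi * Complex.I * formE Z (toVec Z (coord₁ Z v) 0) (toVec Z 0 (coord₂ Z v))) *
    Complex.exp (2 * Real.pi * Complex.I * formE Z c v)

/-- The canonical factor of automorphy `a_{(H, χ)}(w, v)` for `H = H_Z` and characteristic `c`. -/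
def canonicalFactor {g : ℕ} (Z : Matrix (Fin g) (Fin g) ℂ) (c w v : Fin g → ℂ) : ℂ :=
  semichar Z c w * Complex.exp (Real.pi * formH Z v w + Real.pi / 2 * formH Z w w)

/-! ### Canonical theta functions -/

/-- The canonical theta function `θ^c_0`; the sum runs over `λ_1 = Z n` in `Λ_1 = Z ℤ^g`. -/
def theta₀ {g : ℕ} (Z : Matrix (Fin g) (Fin g) ℂ) (c v : Fin g → ℂ) : ℂ :=
  Complex.exp (-Real.pi * formH Z v c - Real.pi / 2 * formH Z c c +
      Real.pi / 2 * formB Z (v + c) (v + c)) *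
    ∑' n : Fin g → ℤ, Complex.exp
      (Real.pi * (formH Z (v + c) (Z *ᵥ fun i => (n i : ℂ)) -
          formB Z (v + c) (Z *ᵥ fun i => (n i : ℂ))) -
        Real.pi / 2 * (formH Z (Z *ᵥ fun i => (n i : ℂ)) (Z *ᵥ fun i => (n i : ℂ)) -
          formB Z (Z *ᵥ fun i => (n i : ℂ)) (Z *ᵥ fun i => (n i : ℂ))))

/-- `θ^c_w(v) = a_{(H, χ)}(w, v)⁻¹ θ^c_0(v + w)`. -/
def theta {g : ℕ} (Z : Matrix (Fin g) (Fin g) ℂ) (c w v : Fin g → ℂ) : ℂ :=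
  (canonicalFactor Z c w v)⁻¹ * theta₀ Z c (v + w)

/-- The tuple `B^Z = ⟨θ^c_{Z D⁻¹ m} ; m ∈ ℤ_D⟩`. The group `ℤ_D = ⨁ ℤ/d_i` is represented by
the residues `0 ≤ m_i < d_i`; `θ^c_w` depends only on the class of `w` modulo `Λ_Z`. -/
def thetaTuple {g : ℕ} (d : Fin g → ℕ) (Z : Matrix (Fin g) (Fin g) ℂ) (c : Fin g → ℂ)
    (m : ∀ i, Fin (d i)) : (Fin g → ℂ) → ℂ :=
  theta Z c (Z *ᵥ fun i => ((m i : ℕ) : ℂ) / (d i : ℂ))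

/-- `M[c]^1 = δ c^1 - γ c^2 + ½ (D γ ᵗδ)_0`. -/
def char₁ {g : ℕ} (d : Fin g → ℕ) (M : Matrix (Fin g ⊕ Fin g) (Fin g ⊕ Fin g) ℚ)
    (c₁ c₂ : Fin g → ℝ) : Fin g → ℝ :=
  M.toBlocks₂₂.map (Rat.cast : ℚ → ℝ) *ᵥ c₁ - M.toBlocks₂₁.map (Rat.cast : ℚ → ℝ) *ᵥ c₂ +
    fun i => 1 / 2 *
      (((diagonal fun i => (d i : ℚ)) * M.toBlocks₂₁ * M.toBlocks₂₂ᵀ) i i : ℝ)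

/-- `M[c]^2 = -β c^1 + α c^2 + ½ (α ᵗβ)_0`. -/
def char₂ {g : ℕ} (M : Matrix (Fin g ⊕ Fin g) (Fin g ⊕ Fin g) ℚ)
    (c₁ c₂ : Fin g → ℝ) : Fin g → ℝ :=
  -(M.toBlocks₁₂.map (Rat.cast : ℚ → ℝ) *ᵥ c₁) + M.toBlocks₁₁.map (Rat.cast : ℚ → ℝ) *ᵥ c₂ +
    fun i => 1 / 2 * ((M.toBlocks₁₁ * M.toBlocks₁₂ᵀ) i i : ℝ)

/-- `ψ^* B^Z = C B^{Z'}` where `Z' = M(Z)`, the tuple `B^Z` being formed with the characteristic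
`c = Z c^1 + c^2` and `B^{Z'}` with `M[c] = Z' M[c]^1 + M[c]^2`. -/
def IsTransition {g : ℕ} (d : Fin g → ℕ) (M : Matrix (Fin g ⊕ Fin g) (Fin g ⊕ Fin g) ℚ)
    (c₁ c₂ : Fin g → ℝ) (Z : Matrix (Fin g) (Fin g) ℂ)
    (C : Matrix (∀ i, Fin (d i)) (∀ i, Fin (d i)) ℂ) : Prop :=
  ∀ (m : ∀ i, Fin (d i)) (v : Fin g → ℂ),
    thetaTuple d Z (toVec Z c₁ c₂) m (psiA M Z v) =
      ∑ n, C m n *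
        thetaTuple d (act M Z) (toVec (act M Z) (char₁ d M c₁ c₂) (char₂ M c₁ c₂)) n v

end

end HigherTheta

open HigherTheta

open Matrix

namespace HigherTheta
noncomputable section

/-! Each canonical theta function is a Gaussian factor, the same for the whole tuple, times a
classical theta series whose first characteristic is shifted by `D⁻¹ m` (`thetaTuple_eq`). The
formula is proved for generators of `Γ_D` and propagated by composition.

Transition matrices multiply along products in the group (`Transition.comp`), and the branches of
the square root multiply by the cocycle relation `denom_mul`. It suffices to work at characteristic
`0`: adding a characteristic is a translation of the argument, up to a factor that `ψ` respects and
a scalar (`Transition.shift`). During composition the target characteristic is only tracked through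
its semicharacter (`Compatible`). This determines it modulo `Λ(H_Z)`, and a change by a vector of
`Λ(H_Z)` acts by a monomial matrix (`exists_lattice_shift_matrix`). By `compatible_char`, `M[c]` is
one admissible target.

A symplectic reduction of the rows shows that `Γ_D` is generated by unipotent matrices and partial
inversions (`exists_mem_genGroup`). A unipotent acts on the tuple by a diagonal matrix, since an
integral quadratic form is linear modulo 2 (`hasTransformation_transU`). A partial inversion is
Poisson summation in one variable followed by sorting the dual variable into residues modulo `d_i`,
and gives a finite Fourier matrix (`hasTransformation_invU`).

All scalars, monomial matrices and Fourier matrices contribute eighth roots of unity to the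
determinant. Only the diagonal matrices of the unipotents can contribute third roots, through the
denominator 6 in a sum of squares over residues; `goodExponent_eight` shows that the 3 cancels
outside the exceptional types.

Uniqueness of the matrix is linear independence of the tuple, read off from Fourier coefficients
(`thetaTuple_linearIndependent`). Two branches of the root differ by a global sign because the
Siegel space is convex. -/

/-- The cast of a real vector to a complex one. -/
abbrev cvec {g : ℕ} (x : Fin g → ℝ) : Fin g → ℂ := fun i => (x i : ℂ)

/-- The imaginary part of `Z` as a complex matrix. -/
abbrev imC {g : ℕ} (Z : Matrix (Fin g) (Fin g) ℂ) : Matrix (Fin g) (Fin g) ℂ :=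
  (Z.map Complex.im).map Complex.ofReal

/-- The inverse of the imaginary part of `Z` as a complex matrix. -/
abbrev imInv {g : ℕ} (Z : Matrix (Fin g) (Fin g) ℂ) : Matrix (Fin g) (Fin g) ℂ :=
  ((Z.map Complex.im)⁻¹).map Complex.ofReal

/-! ### The forms `H`, `B`, `E` in real coordinates. -/

section Forms

variable {g : ℕ} {Z : Matrix (Fin g) (Fin g) ℂ}

lemma im_isUnit_det (hZ : Z ∈ siegel g) : IsUnit (Z.map Complex.im).det :=
  (Matrix.isUnit_iff_isUnit_det _).1 hZ.2.isUnit

lemma im_transpose (hZ : Z ∈ siegel g) : (Z.map Complex.im)ᵀ = Z.map Complex.im := by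
  rw [← Matrix.transpose_map, hZ.1]

lemma imInv_mul (hZ : Z ∈ siegel g) : imInv Z * imC Z = 1 := by
  have := Matrix.nonsing_inv_mul _ (im_isUnit_det hZ)
  have h2 := congrArg (fun A : Matrix (Fin g) (Fin g) ℝ => A.map Complex.ofRealHom) this
  simp only [Matrix.map_mul] at h2
  rw [Matrix.map_one _ (map_zero _) (map_one _)] at h2
  exact h2

lemma mul_imInv (hZ : Z ∈ siegel g) : imC Z * imInv Z = 1 :=
  mul_eq_one_comm.1 (imInv_mul hZ)

lemma imInv_transpose (hZ : Z ∈ siegel g) : (imInv Z)ᵀ = imInv Z := by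
  rw [imInv, ← Matrix.transpose_map, Matrix.transpose_nonsing_inv, im_transpose hZ]

lemma imC_transpose (hZ : Z ∈ siegel g) : (imC Z)ᵀ = imC Z := by
  rw [imC, ← Matrix.transpose_map, im_transpose hZ]

lemma map_star_eq (Z : Matrix (Fin g) (Fin g) ℂ) :
    Z.map star = Z - (2 * Complex.I) • imC Z := by
  ext i j
  apply Complex.ext <;> simp; ring

lemma star_cvec (x : Fin g → ℝ) : star (cvec x) = cvec x := by
  ext i; simp

lemma star_mulVec_map {m n : ℕ} (A : Matrix (Fin m) (Fin n) ℂ) (v : Fin n → ℂ) :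
    star (A *ᵥ v) = A.map star *ᵥ star v := by
  ext i
  simp [Matrix.mulVec, dotProduct]

lemma toVec_eq (Z : Matrix (Fin g) (Fin g) ℂ) (x y : Fin g → ℝ) :
    toVec Z x y = Z *ᵥ cvec x + cvec y := rfl

lemma star_toVec (Z : Matrix (Fin g) (Fin g) ℂ) (x y : Fin g → ℝ) :
    star (toVec Z x y) = toVec Z x y - (2 * Complex.I) • (imC Z *ᵥ cvec x) := by
  rw [toVec_eq, star_add, star_mulVec_map, star_cvec, star_cvec, map_star_eq, sub_mulVec,
    smul_mulVec]
  abel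

/-- Conjugating `Z x + y` subtracts `2i (Im Z) x`, and `(Im Z)⁻¹` cancels the imaginary part. Hence
`H - B` is a plain dot product, which makes the exponents of the theta series explicit. -/
lemma formH_eq (hZ : Z ∈ siegel g) (v : Fin g → ℂ) (x y : Fin g → ℝ) :
    formH Z v (toVec Z x y) = formB Z v (toVec Z x y) - 2 * Complex.I * (v ⬝ᵥ cvec x) := by
  rw [formH, star_toVec, mulVec_sub, mulVec_smul, mulVec_mulVec, imInv_mul hZ, one_mulVec,
    dotProduct_sub, dotProduct_smul, formB, smul_eq_mul]

lemma formB_comm (hZ : Z ∈ siegel g) (v w : Fin g → ℂ) : formB Z v w = formB Z w v := by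
  have := imInv_transpose hZ
  unfold formB
  rw [dotProduct_comm, ← vecMul_transpose, this, ← dotProduct_mulVec]

lemma formB_add_left (v v' w : Fin g → ℂ) : formB Z (v + v') w = formB Z v w + formB Z v' w := by
  simp [formB, add_dotProduct]

lemma formB_add_right (v w w' : Fin g → ℂ) : formB Z v (w + w') = formB Z v w + formB Z v w' := by
  simp [formB, mulVec_add]

lemma coord₁_toVec (hZ : Z ∈ siegel g) (x y : Fin g → ℝ) : coord₁ Z (toVec Z x y) = x := by
  have : (fun i => (toVec Z x y i).im) = Z.map Complex.im *ᵥ x := by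
    ext i
    simp [toVec, mulVec, dotProduct]
  rw [coord₁, this, mulVec_mulVec, nonsing_inv_mul _ (im_isUnit_det hZ), one_mulVec]

lemma coord₂_toVec (hZ : Z ∈ siegel g) (x y : Fin g → ℝ) : coord₂ Z (toVec Z x y) = y := by
  rw [coord₂, coord₁_toVec hZ]
  ext i
  simp [toVec, mulVec, dotProduct]

lemma toVec_add (x y x' y' : Fin g → ℝ) :
    toVec Z (x + x') (y + y') = toVec Z x y + toVec Z x' y' := by
  have : ∀ a b : Fin g → ℝ, cvec (a + b) = cvec a + cvec b := fun a b => by ext; simp [cvec]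
  rw [toVec_eq, this, this, mulVec_add, toVec_eq, toVec_eq]; abel

lemma toVec_dotProduct_sub (hZ : Z ∈ siegel g) (x y x' y' : Fin g → ℝ) :
    toVec Z x' y' ⬝ᵥ cvec x - toVec Z x y ⬝ᵥ cvec x' = ((x ⬝ᵥ y' - y ⬝ᵥ x' : ℝ) : ℂ) := by
    rw [toVec_eq, toVec_eq, add_dotProduct, add_dotProduct]
    have : Z *ᵥ cvec x' ⬝ᵥ cvec x = Z *ᵥ cvec x ⬝ᵥ cvec x' := by
      rw [dotProduct_comm, dotProduct_mulVec, ← mulVec_transpose, hZ.1]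
    rw [this]
    simp only [dotProduct]
    push_cast
    rw [add_sub_add_left_eq_sub]
    congr 1
    refine Finset.sum_congr rfl fun i _ => mul_comm _ _

/-- `2i E(v, w) = H(v, w) - H(w, v)` by Hermitian symmetry; the symmetric form `B` drops out of the
difference. -/
lemma formE_toVec (hZ : Z ∈ siegel g) (x y x' y' : Fin g → ℝ) :
    formE Z (toVec Z x y) (toVec Z x' y') = x ⬝ᵥ y' - y ⬝ᵥ x' := by
  have key : formB Z (toVec Z x y) (toVec Z x' y') - 2 * Complex.I * (toVec Z x y ⬝ᵥ cvec x') =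
      formH Z (toVec Z x y) (toVec Z x' y') := (formH_eq hZ _ _ _).symm
  have hB : ∀ w, formB Z (imC Z *ᵥ cvec x) w = cvec x ⬝ᵥ w := fun w => by
    rw [formB, dotProduct_mulVec, ← vecMul_transpose, imC_transpose hZ, vecMul_vecMul,
      mul_imInv hZ, vecMul_one]
  have hconj : (starRingEnd ℂ) (formH Z (toVec Z x y) (toVec Z x' y')) =
      formH Z (toVec Z x' y') (toVec Z x y) := by
    rw [formH, formH, dotProduct_comm (toVec Z x' y'), dotProduct_comm]
    have h1 : imInv Z *ᵥ star (toVec Z x y) ⬝ᵥ toVec Z x' y'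
        = star (toVec Z x y) ⬝ᵥ (imInv Z *ᵥ toVec Z x' y') := by
      rw [dotProduct_mulVec, ← vecMul_transpose, imInv_transpose hZ]
    rw [h1]
    simp only [dotProduct, mulVec, map_sum, map_mul, imInv, Pi.star_apply]
    refine Finset.sum_congr rfl fun i _ => ?_
    simp [mul_comm]
  have hsub : (2 * Complex.I) * (formE Z (toVec Z x y) (toVec Z x' y') : ℂ) =
      (2 * Complex.I) * ((x ⬝ᵥ y' - y ⬝ᵥ x' : ℝ) : ℂ) := by
    have h2 : (2 * Complex.I) * (formE Z (toVec Z x y) (toVec Z x' y') : ℂ) =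
        formH Z (toVec Z x y) (toVec Z x' y') - formH Z (toVec Z x' y') (toVec Z x y) := by
      rw [← hconj, Complex.sub_conj, formE]; push_cast; ring
    rw [h2, formH_eq hZ, formH_eq hZ, formB_comm hZ]
    rw [← toVec_dotProduct_sub hZ]; ring
  have hne : (2 * Complex.I) ≠ 0 := by simp
  exact_mod_cast mul_left_cancel₀ hne hsub

end Forms

/-! ### Canonical theta functions as classical theta series. -/

/-- The classical theta function with characteristic `(a, b)`. -/
def thetaChar {g : ℕ} (Z : Matrix (Fin g) (Fin g) ℂ) (a b v : Fin g → ℂ) : ℂ :=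
  ∑' n : Fin g → ℤ, Complex.exp (Real.pi * Complex.I *
    (((fun i => (n i : ℂ)) + a) ⬝ᵥ (Z *ᵥ ((fun i => (n i : ℂ)) + a)) +
      2 * (((fun i => (n i : ℂ)) + a) ⬝ᵥ (v + b))))

section ThetaTuple

variable {g : ℕ} {Z : Matrix (Fin g) (Fin g) ℂ}

lemma dotProduct_mulVec_comm (hZ : Zᵀ = Z) (x y : Fin g → ℂ) : x ⬝ᵥ Z *ᵥ y = y ⬝ᵥ Z *ᵥ x := by
  rw [dotProduct_comm y, dotProduct_mulVec, ← mulVec_transpose, hZ]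

lemma theta₀_eq (hZ : Z ∈ siegel g) (c₁ c₂ : Fin g → ℝ) (v : Fin g → ℂ) :
    theta₀ Z (toVec Z c₁ c₂) v =
      Complex.exp (Real.pi / 2 * formB Z v v - Real.pi * Complex.I * (cvec c₁ ⬝ᵥ cvec c₂)) *
        thetaChar Z (cvec c₁) (cvec c₂) v := by
  -- By `formH_eq` the canonical series has the linear exponent `-2πi n·(v + c)`; reversing the sign
  -- of `n` gives the classical one.
  rw [theta₀, thetaChar, ← tsum_mul_left, ← tsum_mul_left, ← (Equiv.neg (Fin g → ℤ)).tsum_eq]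
  refine tsum_congr fun n => ?_
  rw [← Complex.exp_add, ← Complex.exp_add]
  congr 1
  set N : Fin g → ℂ := fun i => (n i : ℂ) with hN
  have e1 : (fun i => (((Equiv.neg (Fin g → ℤ)) n i : ℤ) : ℂ)) = -N := by
    ext i; simp [hN]
  have e2 : Z *ᵥ (-N) = toVec Z (fun i => -(n i : ℝ)) 0 := by
    rw [toVec_eq]
    have : cvec (0 : Fin g → ℝ) = 0 := by ext; simp
    rw [this, add_zero]; congr 1; ext i; simp [hN]
  have e3 : cvec (fun i => -(n i : ℝ)) = -N := by ext i; simp [hN]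
  rw [e1, e2, formH_eq hZ, formH_eq hZ, formH_eq hZ, formH_eq hZ, ← e2, e3,
    formB_add_left, formB_add_right, formB_add_right, formB_comm hZ (toVec Z c₁ c₂) v]
  generalize formB Z v v = x1
  generalize formB Z v (toVec Z c₁ c₂) = x2
  generalize formB Z (toVec Z c₁ c₂) (toVec Z c₁ c₂) = x3
  generalize formB Z (Z *ᵥ (-N)) (Z *ᵥ (-N)) = x4
  rw [toVec_eq]
  simp only [mulVec_neg, dotProduct_neg, add_dotProduct, dotProduct_add, mulVec_add,
    dotProduct_comm _ N, dotProduct_comm _ (cvec c₁), dotProduct_mulVec_comm hZ.1 (cvec c₁) N]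
  ring

/-- The factor of automorphy at `Z D⁻¹ m` cancels everything except a shift of the first
characteristic. The prefactor does not depend on `m`, so linear relations in the tuple are relations
between classical theta series. -/
lemma thetaTuple_eq (hZ : Z ∈ siegel g) (d : Fin g → ℕ) (c₁ c₂ : Fin g → ℝ) (m : ∀ i, Fin (d i))
    (v : Fin g → ℂ) :
    thetaTuple d Z (toVec Z c₁ c₂) m v =
      Complex.exp (Real.pi / 2 * formB Z v v - Real.pi * Complex.I * (cvec c₁ ⬝ᵥ cvec c₂)) *
        thetaChar Z (cvec c₁ + fun i => ((m i : ℕ) : ℂ) / (d i : ℂ)) (cvec c₂) v := by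
  set x : Fin g → ℝ := fun i => ((m i : ℕ) : ℝ) / (d i : ℝ) with hx
  have ex : (fun i => ((m i : ℕ) : ℂ) / (d i : ℂ)) = cvec x := by ext i; simp [hx]
  have ez : cvec (0 : Fin g → ℝ) = 0 := by ext; simp
  have ew : Z *ᵥ cvec x = toVec Z x 0 := by rw [toVec_eq, ez, add_zero]
  rw [thetaTuple, ex, ew, theta, theta₀_eq hZ, canonicalFactor, semichar, coord₁_toVec hZ,
    coord₂_toVec hZ, formE_toVec hZ, formE_toVec hZ, ← Complex.exp_add, ← Complex.exp_add,
    ← Complex.exp_neg, ← mul_assoc, ← Complex.exp_add, thetaChar, thetaChar, ← tsum_mul_left,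
    ← tsum_mul_left]
  refine tsum_congr fun n => ?_
  rw [← Complex.exp_add, ← Complex.exp_add]
  congr 1
  set N : Fin g → ℂ := fun i => (n i : ℂ) with hN
  have ec : ((c₂ ⬝ᵥ x : ℝ) : ℂ) = cvec c₂ ⬝ᵥ cvec x := by simp [dotProduct]
  rw [formH_eq hZ, formH_eq hZ, formB_add_left, formB_add_right, formB_add_right,
    formB_comm hZ (toVec Z x 0) v]
  generalize formB Z v v = x1
  generalize formB Z v (toVec Z x 0) = x2
  generalize formB Z (toVec Z x 0) (toVec Z x 0) = x3
  rw [toVec_eq, ez]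
  simp only [dotProduct_zero, sub_zero, zero_sub, Complex.ofReal_neg, ec, dotProduct_add,
    add_dotProduct, mulVec_add, add_zero, Complex.ofReal_zero,
    dotProduct_comm _ (cvec x),
    dotProduct_mulVec_comm hZ.1 (cvec c₁) N, dotProduct_mulVec_comm hZ.1 (cvec x) N,
    dotProduct_mulVec_comm hZ.1 (cvec x) (cvec c₁)]
  ring

end ThetaTuple

/-! ### The symplectic action on the Siegel space and on the forms. -/

section Action

variable {g : ℕ} {Z : Matrix (Fin g) (Fin g) ℂ} {M : Matrix (Fin g ⊕ Fin g) (Fin g ⊕ Fin g) ℚ}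

/-- `α Z + β` for `M = (α, β; γ, δ)`. -/
def numer (M : Matrix (Fin g ⊕ Fin g) (Fin g ⊕ Fin g) ℚ) (Z : Matrix (Fin g) (Fin g) ℂ) :
    Matrix (Fin g) (Fin g) ℂ :=
  M.toBlocks₁₁.map (Rat.cast : ℚ → ℂ) * Z + M.toBlocks₁₂.map (Rat.cast : ℚ → ℂ)

lemma symplectic_relations (K : Type*) [Field K] [CharZero K]
    (hM : M ∈ symplecticGroup (Fin g) ℚ) :
    (M.toBlocks₁₁.map (Rat.cast : ℚ → K))ᵀ * M.toBlocks₂₁.map (Rat.cast : ℚ → K) =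
        (M.toBlocks₂₁.map (Rat.cast : ℚ → K))ᵀ * M.toBlocks₁₁.map (Rat.cast : ℚ → K) ∧
    (M.toBlocks₁₂.map (Rat.cast : ℚ → K))ᵀ * M.toBlocks₂₂.map (Rat.cast : ℚ → K) =
        (M.toBlocks₂₂.map (Rat.cast : ℚ → K))ᵀ * M.toBlocks₁₂.map (Rat.cast : ℚ → K) ∧
    (M.toBlocks₁₁.map (Rat.cast : ℚ → K))ᵀ * M.toBlocks₂₂.map (Rat.cast : ℚ → K) -
        (M.toBlocks₂₁.map (Rat.cast : ℚ → K))ᵀ * M.toBlocks₁₂.map (Rat.cast : ℚ → K) = 1 := by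
  rw [← SymplecticGroup.fromBlocks_mem_iff]
  have := SymplecticGroup.map_mem hM (Rat.castHom K)
  rw [← fromBlocks_toBlocks M] at this
  rwa [fromBlocks_map] at this

/-- This is the symmetry of `act M Z` with denominators cleared, so that it is available before the
denominator is divided out. -/
lemma numer_transpose_mul_denom (hM : M ∈ symplecticGroup (Fin g) ℚ) (hZ : Z ∈ siegel g) :
    (numer M Z)ᵀ * denom M Z = (denom M Z)ᵀ * numer M Z := by
  obtain ⟨h1, h2, h3⟩ := symplectic_relations ℂ hM
  have h4 := congrArg Matrix.transpose h3
  simp only [transpose_sub, transpose_mul, transpose_transpose, transpose_one] at h4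
  rw [numer, denom]
  simp only [transpose_add, transpose_mul, hZ.1, mul_add, add_mul]
  generalize M.toBlocks₁₁.map (Rat.cast : ℚ → ℂ) = α at *
  generalize M.toBlocks₁₂.map (Rat.cast : ℚ → ℂ) = β at *
  generalize M.toBlocks₂₁.map (Rat.cast : ℚ → ℂ) = γ at *
  generalize M.toBlocks₂₂.map (Rat.cast : ℚ → ℂ) = δ at *
  have e1 : αᵀ * δ = 1 + γᵀ * β := by rw [← h3]; abel
  have e2 : δᵀ * α = 1 + βᵀ * γ := by rw [← h4]; abel
  have k1 : Z * αᵀ * (γ * Z) = Z * (αᵀ * γ) * Z := by noncomm_ring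
  have k2 : Z * γᵀ * (α * Z) = Z * (γᵀ * α) * Z := by noncomm_ring
  have k3 : Z * αᵀ * δ = Z * (αᵀ * δ) := by noncomm_ring
  have k4 : δᵀ * (α * Z) = (δᵀ * α) * Z := by noncomm_ring
  rw [k1, k2, k3, k4, h1, h2, e1, e2]
  noncomm_ring

lemma ratCast_conjTranspose {n : Type*} (A : Matrix n n ℚ) :
    (A.map (Rat.cast : ℚ → ℂ))ᴴ = (A.map (Rat.cast : ℚ → ℂ))ᵀ := by
  ext i j; simp

lemma conjTranspose_eq_of_symm (hZ : Zᵀ = Z) : Zᴴ = Z - (2 * Complex.I) • imC Z := by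
  rw [← map_star_eq, conjTranspose, hZ]

/-- This is the transformation law of `Im Z` with denominators cleared. It yields both invertibility
of the denominator and positivity of the imaginary part of `act M Z`. -/
lemma denom_conjTranspose_mul_numer (hM : M ∈ symplecticGroup (Fin g) ℚ) (hZ : Z ∈ siegel g) :
    (denom M Z)ᴴ * numer M Z - (numer M Z)ᴴ * denom M Z = (2 * Complex.I) • imC Z := by
  obtain ⟨h1, h2, h3⟩ := symplectic_relations ℂ hM
  have h4 := congrArg Matrix.transpose h3
  simp only [transpose_sub, transpose_mul, transpose_transpose, transpose_one] at h4
  have h5 : (2 * Complex.I) • imC Z = Z - Zᴴ := by rw [conjTranspose_eq_of_symm hZ.1]; abel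
  rw [numer, denom, h5]
  simp only [conjTranspose_add, conjTranspose_mul, ratCast_conjTranspose, mul_add, add_mul]
  generalize M.toBlocks₁₁.map (Rat.cast : ℚ → ℂ) = α at *
  generalize M.toBlocks₁₂.map (Rat.cast : ℚ → ℂ) = β at *
  generalize M.toBlocks₂₁.map (Rat.cast : ℚ → ℂ) = γ at *
  generalize M.toBlocks₂₂.map (Rat.cast : ℚ → ℂ) = δ at *
  have e1 : αᵀ * δ = 1 + γᵀ * β := by rw [← h3]; abel
  have e2 : δᵀ * α = 1 + βᵀ * γ := by rw [← h4]; abel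
  have k1 : Zᴴ * αᵀ * (γ * Z) = Zᴴ * (αᵀ * γ) * Z := by noncomm_ring
  have k2 : Zᴴ * γᵀ * (α * Z) = Zᴴ * (γᵀ * α) * Z := by noncomm_ring
  have k3 : Zᴴ * αᵀ * δ = Zᴴ * (αᵀ * δ) := by noncomm_ring
  have k4 : δᵀ * (α * Z) = (δᵀ * α) * Z := by noncomm_ring
  rw [k1, k2, k3, k4, h1, h2, e1, e2]
  noncomm_ring

open scoped ComplexOrder MatrixOrder Matrix.Norms.L2Operator in
-- A real factorization `BᵀB` stays a factorization over `ℂ`, which gives semidefiniteness;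
-- invertibility upgrades it to definiteness.
lemma imC_posDef (hZ : Z ∈ siegel g) : (imC Z).PosDef := by
  obtain ⟨B, hB⟩ := CStarAlgebra.nonneg_iff_eq_star_mul_self.mp hZ.2.posSemidef.nonneg
  have h : imC Z = (B.map Complex.ofReal)ᴴ * B.map Complex.ofReal := by
    rw [imC, hB]
    ext i j
    simp [Matrix.mul_apply]
  have hs : (imC Z).PosSemidef := by rw [h]; exact posSemidef_conjTranspose_mul_self _
  refine (hs.posDef_iff_isUnit).2 ?_
  exact IsUnit.of_mul_eq_one _ (mul_imInv hZ)

/-- A kernel vector `v` of the denominator would annihilate both terms on the left of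
`denom_conjTranspose_mul_numer`, forcing `vᴴ (Im Z) v = 0`. -/
lemma denom_isUnit_det (hM : M ∈ symplecticGroup (Fin g) ℚ) (hZ : Z ∈ siegel g) :
    IsUnit (denom M Z).det := by
  rw [isUnit_iff_ne_zero]
  intro h0
  obtain ⟨v, hv, hv0⟩ := Matrix.exists_mulVec_eq_zero_iff.2 h0
  have h := congrArg (fun A => star v ⬝ᵥ A *ᵥ v) (denom_conjTranspose_mul_numer hM hZ)
  simp only [sub_mulVec, ← mulVec_mulVec, hv0, mulVec_zero, sub_zero, smul_mulVec,
    dotProduct_smul] at h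
  rw [dotProduct_mulVec, ← star_mulVec, hv0, star_zero, zero_dotProduct, smul_eq_mul] at h
  open scoped ComplexOrder in
  have := (imC_posDef hZ).dotProduct_mulVec_pos hv
  have hne : (2 * Complex.I) ≠ 0 := by simp
  exact this.ne' ((mul_eq_zero.1 h.symm).resolve_left hne)

lemma act_eq (M : Matrix (Fin g ⊕ Fin g) (Fin g ⊕ Fin g) ℚ) (Z : Matrix (Fin g) (Fin g) ℂ) :
    act M Z = numer M Z * (denom M Z)⁻¹ := rfl

lemma act_mul_denom (hM : M ∈ symplecticGroup (Fin g) ℚ) (hZ : Z ∈ siegel g) :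
    act M Z * denom M Z = numer M Z := by
  rw [act_eq, Matrix.mul_assoc, nonsing_inv_mul _ (denom_isUnit_det hM hZ), mul_one]

lemma denom_isUnit (hM : M ∈ symplecticGroup (Fin g) ℚ) (hZ : Z ∈ siegel g) :
    IsUnit (denom M Z) := (Matrix.isUnit_iff_isUnit_det _).2 (denom_isUnit_det hM hZ)

lemma act_transpose (hM : M ∈ symplecticGroup (Fin g) ℚ) (hZ : Z ∈ siegel g) :
    (act M Z)ᵀ = act M Z := by
  have hu := denom_isUnit hM hZ
  have h := numer_transpose_mul_denom hM hZ
  rw [← act_mul_denom hM hZ, transpose_mul, mul_assoc] at h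
  have hut : IsUnit (denom M Z)ᵀ := by simpa [Matrix.isUnit_transpose] using hu
  exact hu.mul_right_cancel (hut.mul_left_cancel h)

lemma denom_mul_imC_act (hM : M ∈ symplecticGroup (Fin g) ℚ) (hZ : Z ∈ siegel g) :
    (denom M Z)ᴴ * imC (act M Z) * denom M Z = imC Z := by
  have h := denom_conjTranspose_mul_numer hM hZ
  have h5 : (2 * Complex.I) • imC (act M Z) = act M Z - (act M Z)ᴴ := by
    rw [conjTranspose_eq_of_symm (act_transpose hM hZ)]; abel
  have h6 : (denom M Z)ᴴ * (act M Z * denom M Z) - (act M Z * denom M Z)ᴴ * denom M Z =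
      (denom M Z)ᴴ * (act M Z - (act M Z)ᴴ) * denom M Z := by
    rw [conjTranspose_mul]; noncomm_ring
  rw [← act_mul_denom hM hZ, h6, ← h5, mul_smul_comm, smul_mul_assoc] at h
  have hne : (2 * Complex.I) ≠ 0 := by simp
  exact smul_right_injective _ hne h

lemma imC_act (hM : M ∈ symplecticGroup (Fin g) ℚ) (hZ : Z ∈ siegel g) :
    imC (act M Z) = ((denom M Z)⁻¹)ᴴ * imC Z * (denom M Z)⁻¹ := by
  have hu := denom_isUnit_det hM hZ
  have h2 : ((denom M Z)⁻¹)ᴴ * (denom M Z)ᴴ = 1 := by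
    rw [← conjTranspose_mul, mul_nonsing_inv _ hu, conjTranspose_one]
  rw [← denom_mul_imC_act hM hZ]
  simp only [mul_assoc]
  rw [mul_nonsing_inv _ hu, mul_one, ← mul_assoc, h2, one_mul]

lemma act_mem_siegel (hM : M ∈ symplecticGroup (Fin g) ℚ) (hZ : Z ∈ siegel g) :
    act M Z ∈ siegel g := by
  refine ⟨act_transpose hM hZ, ?_⟩
  have hu := denom_isUnit_det hM hZ
  open scoped ComplexOrder in
  have hp : (imC (act M Z)).PosDef := by
    rw [imC_act hM hZ]
    refine (imC_posDef hZ).conjTranspose_mul_mul_same ?_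
    exact (Matrix.mulVec_injective_iff_isUnit).2
      (by rw [Matrix.isUnit_nonsing_inv_iff]; exact denom_isUnit hM hZ)
  refine Matrix.PosDef.of_dotProduct_mulVec_pos ?_ ?_
  · rw [IsHermitian, conjTranspose, ← transpose_map, act_transpose hM hZ]
    ext; simp
  · intro x hx
    have hx' : cvec x ≠ 0 := fun h => hx (by ext i; simpa using congrFun h i)
    open scoped ComplexOrder in
    have := hp.dotProduct_mulVec_pos hx'
    have e : star (cvec x) ⬝ᵥ imC (act M Z) *ᵥ cvec x =
        ((star x ⬝ᵥ (act M Z).map Complex.im *ᵥ x : ℝ) : ℂ) := by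
      simp [dotProduct, mulVec]
    rw [e] at this
    exact_mod_cast this

lemma imInv_act (hM : M ∈ symplecticGroup (Fin g) ℚ) (hZ : Z ∈ siegel g) :
    imInv (act M Z) = denom M Z * imInv Z * (denom M Z)ᴴ := by
  have hu := denom_isUnit_det hM hZ
  have h1 := imInv_mul (act_mem_siegel hM hZ)
  have h3 : ((denom M Z)⁻¹)ᴴ * (denom M Z)ᴴ = 1 := by
    rw [← conjTranspose_mul, mul_nonsing_inv _ hu, conjTranspose_one]
  have h3' := mul_eq_one_comm.1 h3
  have h2 : imC (act M Z) * (denom M Z * imInv Z * (denom M Z)ᴴ) = 1 := by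
    rw [imC_act hM hZ]
    calc _ = ((denom M Z)⁻¹)ᴴ * (imC Z * (((denom M Z)⁻¹ * denom M Z) * imInv Z)) *
          (denom M Z)ᴴ := by noncomm_ring
      _ = 1 := by rw [nonsing_inv_mul _ hu, one_mul, mul_imInv hZ, mul_one, h3]
  calc imInv (act M Z) = imInv (act M Z) * (imC (act M Z) * (denom M Z * imInv Z * (denom M Z)ᴴ)) := by
        rw [h2, mul_one]
    _ = _ := by rw [← mul_assoc, h1, one_mul]

lemma formH_psiA (hM : M ∈ symplecticGroup (Fin g) ℚ) (hZ : Z ∈ siegel g) (v w : Fin g → ℂ) :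
    formH Z (psiA M Z v) (psiA M Z w) = formH (act M Z) v w := by
  change _ ⬝ᵥ (imInv Z *ᵥ _) = _ ⬝ᵥ (imInv (act M Z) *ᵥ _)
  rw [imInv_act hM hZ, psiA, psiA, star_mulVec_map, mulVec_transpose, ← dotProduct_mulVec,
    mulVec_mulVec, mulVec_mulVec]
  rfl

/-- `B` is not invariant, because the transpose of `γ Z + δ` differs from its conjugate transpose by
`2i (Im Z) γᵀ`. The resulting quadratic term cancels the Gaussian factor that Poisson summation
produces. -/
lemma formB_psiA (hM : M ∈ symplecticGroup (Fin g) ℚ) (hZ : Z ∈ siegel g) (v : Fin g → ℂ) :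
    formB Z (psiA M Z v) (psiA M Z v) = formB (act M Z) v v + 2 * Complex.I *
      (v ⬝ᵥ (denom M Z * (M.toBlocks₂₁.map (Rat.cast : ℚ → ℂ))ᵀ) *ᵥ v) := by
  change _ ⬝ᵥ (imInv Z *ᵥ _) = _ ⬝ᵥ (imInv (act M Z) *ᵥ _) + _
  have h : (denom M Z)ᵀ = (denom M Z)ᴴ + (2 * Complex.I) •
      (imC Z * (M.toBlocks₂₁.map (Rat.cast : ℚ → ℂ))ᵀ) := by
    rw [denom]
    simp only [transpose_add, transpose_mul, hZ.1, conjTranspose_add, conjTranspose_mul,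
      ratCast_conjTranspose, conjTranspose_eq_of_symm hZ.1, sub_mul, smul_mul]
    abel
  rw [imInv_act hM hZ, psiA, mulVec_transpose, ← dotProduct_mulVec, ← mulVec_transpose,
    mulVec_mulVec, mulVec_mulVec, h, mul_add, mul_smul_comm, mul_assoc (denom M Z) _ (_ * _), ← mul_assoc (imInv Z), imInv_mul hZ,
    one_mul, add_mulVec, smul_mulVec, dotProduct_add, dotProduct_smul]
  rfl

/-- In real coordinates `ψ` is the transpose of `M`, since `ᵗ(γ Z + δ)` times `act M Z` is `ᵗ(α Z +
β)`. -/
lemma psiA_toVec (hM : M ∈ symplecticGroup (Fin g) ℚ) (hZ : Z ∈ siegel g) (x y : Fin g → ℝ) :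
    psiA M Z (toVec (act M Z) x y) =
      toVec Z ((M.toBlocks₁₁.map (Rat.cast : ℚ → ℝ))ᵀ *ᵥ x +
          (M.toBlocks₂₁.map (Rat.cast : ℚ → ℝ))ᵀ *ᵥ y)
        ((M.toBlocks₁₂.map (Rat.cast : ℚ → ℝ))ᵀ *ᵥ x +
          (M.toBlocks₂₂.map (Rat.cast : ℚ → ℝ))ᵀ *ᵥ y) := by
  have hc : ∀ (A : Matrix (Fin g) (Fin g) ℚ) (B : Matrix (Fin g) (Fin g) ℚ),
      cvec ((A.map (Rat.cast : ℚ → ℝ))ᵀ *ᵥ x + (B.map (Rat.cast : ℚ → ℝ))ᵀ *ᵥ y) =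
        (A.map (Rat.cast : ℚ → ℂ))ᵀ *ᵥ cvec x + (B.map (Rat.cast : ℚ → ℂ))ᵀ *ᵥ cvec y := by
    intro A B; ext i; simp [cvec, mulVec, dotProduct]
  rw [psiA, toVec_eq, toVec_eq, hc, hc, mulVec_add, mulVec_mulVec]
  have : (denom M Z)ᵀ * act M Z = (numer M Z)ᵀ := by
    rw [← act_mul_denom hM hZ, transpose_mul, act_transpose hM hZ]
  rw [this, numer, denom]
  simp only [transpose_add, transpose_mul, hZ.1, add_mulVec, mulVec_add, mulVec_mulVec]
  abel

lemma toBlocks₁₁_mul (A B : Matrix (Fin g ⊕ Fin g) (Fin g ⊕ Fin g) ℚ) :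
    (A * B).toBlocks₁₁ = A.toBlocks₁₁ * B.toBlocks₁₁ + A.toBlocks₁₂ * B.toBlocks₂₁ := by
  ext i j; simp [toBlocks₁₁, toBlocks₁₂, toBlocks₂₁, Matrix.mul_apply, Fintype.sum_sum_type]

lemma toBlocks₁₂_mul (A B : Matrix (Fin g ⊕ Fin g) (Fin g ⊕ Fin g) ℚ) :
    (A * B).toBlocks₁₂ = A.toBlocks₁₁ * B.toBlocks₁₂ + A.toBlocks₁₂ * B.toBlocks₂₂ := by
  ext i j; simp [toBlocks₁₁, toBlocks₁₂, toBlocks₂₂, Matrix.mul_apply, Fintype.sum_sum_type]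

lemma toBlocks₂₁_mul (A B : Matrix (Fin g ⊕ Fin g) (Fin g ⊕ Fin g) ℚ) :
    (A * B).toBlocks₂₁ = A.toBlocks₂₁ * B.toBlocks₁₁ + A.toBlocks₂₂ * B.toBlocks₂₁ := by
  ext i j; simp [toBlocks₁₁, toBlocks₂₂, toBlocks₂₁, Matrix.mul_apply, Fintype.sum_sum_type]

lemma toBlocks₂₂_mul (A B : Matrix (Fin g ⊕ Fin g) (Fin g ⊕ Fin g) ℚ) :
    (A * B).toBlocks₂₂ = A.toBlocks₂₁ * B.toBlocks₁₂ + A.toBlocks₂₂ * B.toBlocks₂₂ := by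
  ext i j; simp [toBlocks₂₁, toBlocks₁₂, toBlocks₂₂, Matrix.mul_apply, Fintype.sum_sum_type]

lemma map_ratCast_add_mul (K : Type*) [Field K] [CharZero K] (A B C D : Matrix (Fin g) (Fin g) ℚ) :
    (A * B + C * D).map (Rat.cast : ℚ → K) = A.map (Rat.cast : ℚ → K) * B.map (Rat.cast : ℚ → K) +
      C.map (Rat.cast : ℚ → K) * D.map (Rat.cast : ℚ → K) := by
  ext i j; simp [Matrix.mul_apply]

variable {M' : Matrix (Fin g ⊕ Fin g) (Fin g ⊕ Fin g) ℚ}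

lemma denom_mul (hM : M ∈ symplecticGroup (Fin g) ℚ) (hZ : Z ∈ siegel g) :
    denom (M' * M) Z = denom M' (act M Z) * denom M Z := by
  conv_rhs => rw [denom, add_mul, mul_assoc, act_mul_denom hM hZ]
  rw [numer, denom, denom, toBlocks₂₁_mul, toBlocks₂₂_mul, map_ratCast_add_mul,
    map_ratCast_add_mul]
  noncomm_ring

lemma numer_mul (hM : M ∈ symplecticGroup (Fin g) ℚ) (hZ : Z ∈ siegel g) :
    numer (M' * M) Z = numer M' (act M Z) * denom M Z := by
  conv_rhs => rw [numer, add_mul, mul_assoc, act_mul_denom hM hZ]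
  rw [numer, numer, denom, toBlocks₁₁_mul, toBlocks₁₂_mul, map_ratCast_add_mul,
    map_ratCast_add_mul]
  noncomm_ring

lemma act_mul (hM : M ∈ symplecticGroup (Fin g) ℚ) (hZ : Z ∈ siegel g) :
    act (M' * M) Z = act M' (act M Z) := by
  rw [act_eq, act_eq, denom_mul hM hZ, numer_mul hM hZ, Matrix.mul_inv_rev]
  calc _ = numer M' (act M Z) * (denom M Z * (denom M Z)⁻¹) * (denom M' (act M Z))⁻¹ := by
        noncomm_ring
    _ = _ := by rw [mul_nonsing_inv _ (denom_isUnit_det hM hZ), mul_one]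

lemma psiA_mul (hM : M ∈ symplecticGroup (Fin g) ℚ) (hZ : Z ∈ siegel g) (v : Fin g → ℂ) :
    psiA (M' * M) Z v = psiA M Z (psiA M' (act M Z) v) := by
  rw [psiA, psiA, psiA, denom_mul hM hZ, transpose_mul, mulVec_mulVec]

lemma continuousOn_denom (M : Matrix (Fin g ⊕ Fin g) (Fin g ⊕ Fin g) ℚ)
    (s : Set (Matrix (Fin g) (Fin g) ℂ)) : ContinuousOn (denom M) s := by
  unfold denom; fun_prop

lemma continuousOn_act (hM : M ∈ symplecticGroup (Fin g) ℚ) : ContinuousOn (act M) (siegel g) := by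
  have h1 : ContinuousOn (numer M) (siegel g) := by unfold numer; fun_prop
  have h2 : ContinuousOn (fun Z => (denom M Z)⁻¹) (siegel g) := by
    have : ∀ Z, (denom M Z)⁻¹ = (denom M Z).det⁻¹ • (denom M Z).adjugate := fun Z => by
      rw [Matrix.inv_def, Ring.inverse_eq_inv']
    simp only [this]
    have hd := continuousOn_denom M (siegel g)
    have hd1 : ContinuousOn (fun Z => (denom M Z).det) (siegel g) := by
      have hc : Continuous fun A : Matrix (Fin g) (Fin g) ℂ => A.det := by fun_prop
      exact hc.comp_continuousOn hd
    have hd2 : ContinuousOn (fun Z => (denom M Z).adjugate) (siegel g) := by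
      have hc : Continuous fun A : Matrix (Fin g) (Fin g) ℂ => A.adjugate := by fun_prop
      exact hc.comp_continuousOn hd
    exact (hd1.inv₀ fun Z hZ => (denom_isUnit_det hM hZ).ne_zero).smul hd2
  exact h1.mul h2

/-- Symmetry and positivity of the imaginary part survive convex combinations. Connectedness is what
makes a square root branch unique up to one global sign. -/
lemma siegel_isPreconnected : IsPreconnected (siegel g) := by
  refine Convex.isPreconnected ?_
  rintro Z ⟨hZ1, hZ2⟩ W ⟨hW1, hW2⟩ a b ha hb hab
  refine ⟨by rw [transpose_add, transpose_smul, transpose_smul, hZ1, hW1], ?_⟩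
  have e : (a • Z + b • W).map Complex.im = a • Z.map Complex.im + b • W.map Complex.im := by
    ext i j; simp
  rw [e]
  rcases ha.eq_or_lt with rfl | ha
  · have : b = 1 := by linarith
    simpa [this] using hW2
  · exact (hZ2.smul ha).add_posSemidef (hW2.posSemidef.smul hb)

end Action

/-! ### Absolute convergence of the theta series. -/

section Summability

/-- Induction on the number of coordinates, splitting off the first one and multiplying two
nonnegative summable families. -/
lemma summable_prod_pi : ∀ {g : ℕ} {f : Fin g → ℤ → ℝ}, (∀ i n, 0 ≤ f i n) →
    (∀ i, Summable (f i)) → Summable fun n : Fin g → ℤ => ∏ i, f i (n i)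
  | 0, _, _, _ => (hasSum_fintype _).summable
  | g + 1, f, h0, hf => by
    have ih := summable_prod_pi (f := fun i => f i.succ) (fun i n => h0 _ n) fun i => hf _
    rw [← (Fin.consEquiv fun _ => ℤ).summable_iff]
    refine (Summable.mul_of_nonneg (hf 0) ih (fun n => h0 0 n)
      fun n => Finset.prod_nonneg fun i _ => h0 _ _).congr fun p => ?_
    simp [Fin.prod_univ_succ, Fin.consEquiv]

lemma exists_pos_le_dotProduct_mulVec {g : ℕ} {Y : Matrix (Fin g) (Fin g) ℝ} (hY : Y.PosDef) :
    ∃ ε > 0, ∀ x : Fin g → ℝ, ε * ∑ i, x i ^ 2 ≤ x ⬝ᵥ Y *ᵥ x := by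
  have hpos : ∀ x : Fin g → ℝ, x ≠ 0 → 0 < x ⬝ᵥ Y *ᵥ x := fun x hx => by
    simpa using hY.dotProduct_mulVec_pos hx
  rcases Nat.eq_zero_or_pos g with rfl | hg
  · exact ⟨1, one_pos, fun x => by simp⟩
  have : Nonempty (Fin g) := ⟨⟨0, hg⟩⟩
  have hne : (Metric.sphere (0 : Fin g → ℝ) 1).Nonempty := NormedSpace.sphere_nonempty.2 zero_le_one
  obtain ⟨x₀, hx₀, hmin⟩ := (isCompact_sphere (0 : Fin g → ℝ) 1).exists_isMinOn hne
    (f := fun x => x ⬝ᵥ Y *ᵥ x) (by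
      simp only [dotProduct, mulVec]
      fun_prop)
  have hx₀0 : x₀ ≠ 0 := by rintro rfl; simp at hx₀
  have hm := hpos x₀ hx₀0
  have hg' : (0 : ℝ) < g := by exact_mod_cast hg
  -- The minimum is taken on the unit sphere of the sup norm; dividing by `g` passes to the sum of
  -- squares, which is at most `g ‖x‖²`.
  refine ⟨(x₀ ⬝ᵥ Y *ᵥ x₀) / g, by positivity, fun x => ?_⟩
  by_cases hx : x = 0
  · simp [hx]
  have hn : 0 < ‖x‖ := norm_pos_iff.2 hx
  have hs : ‖x‖⁻¹ • x ∈ Metric.sphere (0 : Fin g → ℝ) 1 := by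
    simp [norm_smul, hn.ne']
  have h1 : x₀ ⬝ᵥ Y *ᵥ x₀ ≤ (‖x‖⁻¹ • x) ⬝ᵥ Y *ᵥ (‖x‖⁻¹ • x) := hmin hs
  rw [smul_dotProduct, mulVec_smul, dotProduct_smul, smul_eq_mul, smul_eq_mul, ← mul_assoc] at h1
  have h2 : ∑ i, x i ^ 2 ≤ g * ‖x‖ ^ 2 := by
    calc ∑ i, x i ^ 2 ≤ ∑ _i : Fin g, ‖x‖ ^ 2 := Finset.sum_le_sum fun i _ => by
          rw [← sq_abs, ← Real.norm_eq_abs]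
          exact pow_le_pow_left₀ (norm_nonneg _) (norm_le_pi_norm x i) 2
      _ = g * ‖x‖ ^ 2 := by simp
  calc (x₀ ⬝ᵥ Y *ᵥ x₀) / g * ∑ i, x i ^ 2 ≤ (x₀ ⬝ᵥ Y *ᵥ x₀) / g * (g * ‖x‖ ^ 2) := by gcongr
    _ = (x₀ ⬝ᵥ Y *ᵥ x₀) * ‖x‖ ^ 2 := by field_simp
    _ ≤ (‖x‖⁻¹ * ‖x‖⁻¹ * (x ⬝ᵥ Y *ᵥ x)) * ‖x‖ ^ 2 := by gcongr
    _ = x ⬝ᵥ Y *ᵥ x := by field_simp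

variable {g : ℕ} {Z : Matrix (Fin g) (Fin g) ℂ}

/-- The quadratic part is bounded by `ε Σ n_i²`, so the terms are dominated by a product of
one-variable Jacobi theta terms. -/
lemma summable_thetaChar (hZ : Z ∈ siegel g) (a w : Fin g → ℂ) :
    Summable fun n : Fin g → ℤ => Complex.exp (Real.pi * Complex.I *
      (((fun i => (n i : ℂ)) + a) ⬝ᵥ (Z *ᵥ ((fun i => (n i : ℂ)) + a)) +
        2 * (((fun i => (n i : ℂ)) + a) ⬝ᵥ w))) := by
  obtain ⟨ε, hε, hY⟩ := exists_pos_le_dotProduct_mulVec hZ.2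
  set u : Fin g → ℂ := Z *ᵥ a + w with hu
  set K : ℂ := Complex.exp (Real.pi * Complex.I * (a ⬝ᵥ Z *ᵥ a + 2 * (a ⬝ᵥ w))) with hK
  have hsum : Summable fun n : Fin g → ℤ => ∏ i,
      Real.exp (-Real.pi * n i ^ 2 * ε - 2 * Real.pi * n i * (u i).im) := by
    refine summable_prod_pi (f := fun i (n : ℤ) =>
      Real.exp (-Real.pi * n ^ 2 * ε - 2 * Real.pi * n * (u i).im))
      (fun _ _ => (Real.exp_pos _).le) fun i => ?_
    -- The purely imaginary parameters `i Im u_i` and `iε` are chosen so that the norm of the Jacobi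
    -- term is the required real exponential.
    refine (((summable_jacobiTheta₂_term_iff (Complex.I * (u i).im) (Complex.I * ε)).2
      (by simpa using hε)).norm).congr fun n => ?_
    rw [norm_jacobiTheta₂_term]
    simp
  refine Summable.of_norm_bounded (hsum.mul_left ‖K‖) fun n => ?_
  set N : Fin g → ℂ := fun i => (n i : ℂ) with hN
  have e : Complex.exp (Real.pi * Complex.I * ((N + a) ⬝ᵥ (Z *ᵥ (N + a)) + 2 * ((N + a) ⬝ᵥ w))) =
      K * Complex.exp (Real.pi * Complex.I * (N ⬝ᵥ Z *ᵥ N + 2 * (N ⬝ᵥ u))) := by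
    rw [hK, ← Complex.exp_add, hu]
    congr 1
    simp only [add_dotProduct, mulVec_add, dotProduct_add, dotProduct_mulVec_comm hZ.1 a N]
    ring
  rw [e, norm_mul]
  gcongr
  rw [Complex.norm_exp, ← Real.exp_sum, Real.exp_le_exp]
  have h1 : (N ⬝ᵥ Z *ᵥ N).im = (fun i => (n i : ℝ)) ⬝ᵥ Z.map Complex.im *ᵥ fun i => (n i : ℝ) := by
    simp [hN, dotProduct, mulVec]
  have h2 : (N ⬝ᵥ u).im = ∑ i, (n i : ℝ) * (u i).im := by
    simp [hN, dotProduct]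
  have h3 : (Real.pi * Complex.I * (N ⬝ᵥ Z *ᵥ N + 2 * (N ⬝ᵥ u))).re =
      -Real.pi * ((N ⬝ᵥ Z *ᵥ N).im + 2 * (N ⬝ᵥ u).im) := by
    simp
  rw [h3, h1, h2]
  have h4 := hY fun i => (n i : ℝ)
  have h5 : ∑ i, (-Real.pi * (n i : ℝ) ^ 2 * ε - 2 * Real.pi * n i * (u i).im) =
      -Real.pi * (ε * ∑ i, (n i : ℝ) ^ 2 + 2 * ∑ i, (n i : ℝ) * (u i).im) := by
    rw [Finset.mul_sum, Finset.mul_sum, ← Finset.sum_add_distrib, Finset.mul_sum]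
    exact Finset.sum_congr rfl fun i _ => by ring
  rw [h5]
  have := Real.pi_pos
  nlinarith

end Summability

/-! ### Linear independence by Fourier coefficients on a torus. -/

section Independence

open UnitAddTorus

attribute [local instance] instMeasureSpaceUnitAddCircle

lemma isProbabilityMeasure_unitAddCircle : MeasureTheory.IsProbabilityMeasure
    (MeasureTheory.volume : MeasureTheory.Measure UnitAddCircle) :=
  inferInstanceAs (MeasureTheory.IsProbabilityMeasure AddCircle.haarAddCircle)

attribute [local instance] isProbabilityMeasure_unitAddCircle

/-- The Fourier coefficient as a continuous functional on continuous functions on the torus. -/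
def fourierCoeffL {g : ℕ} (n : Fin g → ℤ) : C(UnitAddTorus (Fin g), ℂ) →L[ℂ] ℂ :=
  (innerSL ℂ (mFourierLp (d := Fin g) 2 n)).comp
    (ContinuousMap.toLp (E := ℂ) 2 MeasureTheory.volume ℂ)

lemma fourierCoeffL_mFourier {g : ℕ} (n m : Fin g → ℤ) :
    fourierCoeffL n (mFourier m) = if n = m then 1 else 0 :=
  (orthonormal_iff_ite.1 (orthonormal_mFourier (d := Fin g))) n m

variable {g : ℕ} {Z : Matrix (Fin g) (Fin g) ℂ}

lemma mFourier_coe (m : Fin g → ℤ) (t : Fin g → ℝ) :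
    mFourier m (fun i => ((t i : ℝ) : UnitAddCircle)) =
      Complex.exp (2 * Real.pi * Complex.I * ∑ i, (m i : ℂ) * t i) := by
  simp only [mFourier, ContinuousMap.coe_mk, fourier_coe_apply, ← Complex.exp_sum]
  congr 1
  rw [Finset.mul_sum]
  refine Finset.sum_congr rfl fun i _ => ?_
  push_cast; ring

/-- On `v = D t` with `t` real, the member of index `n` is a common factor times a Fourier series
with frequencies `d_i N_i + n_i`. Different residues `n` have disjoint frequencies, so the Fourier
coefficient at `n₀` isolates `C n₀` times a nonzero exponential. -/
theorem thetaTuple_linearIndependent {d : Fin g → ℕ} (hd : ∀ i, 0 < d i) (hZ : Z ∈ siegel g)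
    (c₁ c₂ : Fin g → ℝ) (C : (∀ i, Fin (d i)) → ℂ)
    (h : ∀ v, ∑ n, C n * thetaTuple d Z (toVec Z c₁ c₂) n v = 0) : C = 0 := by
  have hd' : ∀ i, (d i : ℂ) ≠ 0 := fun i => by exact_mod_cast (hd i).ne'
  set a : (∀ i, Fin (d i)) → Fin g → ℂ := fun n => cvec c₁ + fun i => ((n i : ℕ) : ℂ) / (d i : ℂ)
  set k : (∀ i, Fin (d i)) → (Fin g → ℤ) → ℂ := fun n N => Complex.exp (Real.pi * Complex.I *
      (((fun i => (N i : ℂ)) + a n) ⬝ᵥ (Z *ᵥ ((fun i => (N i : ℂ)) + a n)) +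
        2 * (((fun i => (N i : ℂ)) + a n) ⬝ᵥ cvec c₂))) with hk
  set e : (∀ i, Fin (d i)) → (Fin g → ℤ) → Fin g → ℤ :=
    fun n N i => (d i : ℤ) * N i + ((n i : ℕ) : ℤ) with he
  have hks : ∀ n, Summable fun N => k n N • mFourier (e n N) := fun n => by
    refine Summable.of_norm ((summable_thetaChar hZ (a n) (cvec c₂)).norm.congr fun N => ?_)
    rw [norm_smul, mFourier_norm, mul_one]
  set F : (∀ i, Fin (d i)) → C(UnitAddTorus (Fin g), ℂ) := fun n => ∑' N, k n N • mFourier (e n N)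
    with hF
  have hF_eval : ∀ n (t : Fin g → ℝ), F n (fun i => ((t i : ℝ) : UnitAddCircle)) =
      Complex.exp (-(2 * Real.pi * Complex.I * ∑ i, (c₁ i : ℂ) * d i * t i)) *
        thetaChar Z (a n) (cvec c₂) (fun i => (d i : ℂ) * t i) := by
    intro n t
    rw [hF, ← ContinuousMap.tsum_apply (hks n), thetaChar, ← tsum_mul_left]
    refine tsum_congr fun N => ?_
    rw [ContinuousMap.smul_apply, mFourier_coe, smul_eq_mul, hk, ← Complex.exp_add,
      ← Complex.exp_add]
    congr 1
    have : ((fun i => (N i : ℂ)) + a n) ⬝ᵥ (fun i => (d i : ℂ) * t i) =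
        ∑ i, (e n N i : ℂ) * t i + ∑ i, (c₁ i : ℂ) * d i * t i := by
      rw [dotProduct, ← Finset.sum_add_distrib]
      refine Finset.sum_congr rfl fun i _ => ?_
      simp only [he, a, Pi.add_apply, cvec]
      push_cast
      field_simp [hd' i]
      ring
    rw [dotProduct_add, this]
    ring
  have hzero : ∑ n, C n • F n = 0 := by
    ext x
    obtain ⟨t, rfl⟩ : ∃ t : Fin g → ℝ, x = fun i => ((t i : ℝ) : UnitAddCircle) :=
      ⟨fun i => (QuotientAddGroup.mk_surjective (x i)).choose,
        funext fun i => (QuotientAddGroup.mk_surjective (x i)).choose_spec.symm⟩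
    have h1 := h fun i => (d i : ℂ) * t i
    simp only [thetaTuple_eq hZ, mul_left_comm (C _), ← Finset.mul_sum] at h1
    have h2 := (mul_eq_zero.1 h1).resolve_left (Complex.exp_ne_zero _)
    simp only [ContinuousMap.coe_sum, Finset.sum_apply, ContinuousMap.coe_smul, Pi.smul_apply,
      smul_eq_mul, hF_eval, mul_left_comm (C _), ← Finset.mul_sum, ContinuousMap.zero_apply]
    rw [h2, mul_zero]
  ext n₀
  have h3 := congrArg (fourierCoeffL fun i => ((n₀ i : ℕ) : ℤ)) hzero
  have hcoef : ∀ n, fourierCoeffL (fun i => ((n₀ i : ℕ) : ℤ)) (F n) =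
      if n = n₀ then k n 0 else 0 := by
    intro n
    rw [hF, ContinuousLinearMap.map_tsum _ (hks n)]
    simp only [map_smul, fourierCoeffL_mFourier]
    -- Uniqueness of division with remainder, as both residues lie in the range from `0` to `d_i -
    -- 1`.
    have hmem : ∀ N, (fun i => ((n₀ i : ℕ) : ℤ)) = e n N → n = n₀ ∧ N = 0 := by
      intro N hN
      have key : ∀ i, N i = 0 ∧ (n i : ℕ) = (n₀ i : ℕ) := fun i => by
        have h4 := congrFun hN i
        simp only [he] at h4
        have b1 := (n i).2
        have b2 := (n₀ i).2
        have : N i = 0 := by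
          by_contra hne
          rcases lt_or_gt_of_ne hne with hlt | hgt
          · nlinarith
          · nlinarith
        refine ⟨this, ?_⟩
        rw [this] at h4; omega
      exact ⟨funext fun i => Fin.ext (key i).2, funext fun i => (key i).1⟩
    rw [tsum_eq_single 0]
    · split_ifs with h5 h6 h6
      · simp
      · exact absurd (hmem _ h5).1 h6
      · exact absurd (by subst h6; ext i; simp [he]) h5
      · simp
    · intro N hN
      rw [if_neg fun h5 => hN (hmem N h5).2, smul_zero]
  simp only [map_sum, map_smul, hcoef, map_zero, smul_eq_mul, mul_ite, mul_zero,
    Finset.sum_ite_eq', Finset.mem_univ, if_true] at h3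
  exact (mul_eq_zero.1 h3).resolve_right (Complex.exp_ne_zero _)

end Independence

/-! ### Transition matrices: characteristics, composition, uniqueness. -/

/-- `ψ^* B^Z = C B^{Z'}` where `B^Z` has characteristic `Z c₁ + c₂` and `B^{Z'}` has
characteristic `Z' e₁ + e₂`. -/
def Transition {g : ℕ} (d : Fin g → ℕ) (M : Matrix (Fin g ⊕ Fin g) (Fin g ⊕ Fin g) ℚ)
    (Z : Matrix (Fin g) (Fin g) ℂ) (c₁ c₂ e₁ e₂ : Fin g → ℝ)
    (C : Matrix (∀ i, Fin (d i)) (∀ i, Fin (d i)) ℂ) : Prop :=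
  ∀ (m : ∀ i, Fin (d i)) (v : Fin g → ℂ),
    thetaTuple d Z (toVec Z c₁ c₂) m (psiA M Z v) =
      ∑ n, C m n * thetaTuple d (act M Z) (toVec (act M Z) e₁ e₂) n v

/-- `Z c₁ + c₂ ∈ ½ Λ(H_Z)`. -/
def IsHalf {g : ℕ} (d : Fin g → ℕ) (c₁ c₂ : Fin g → ℝ) : Prop :=
  ∀ i, (∃ k : ℤ, 2 * (d i : ℝ) * c₁ i = k) ∧ ∃ l : ℤ, 2 * c₂ i = l

/-- The linear part `δ c₁ - γ c₂` of `char₁`. -/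
def lin₁ {g : ℕ} (M : Matrix (Fin g ⊕ Fin g) (Fin g ⊕ Fin g) ℚ) (c₁ c₂ : Fin g → ℝ) : Fin g → ℝ :=
  M.toBlocks₂₂.map (Rat.cast : ℚ → ℝ) *ᵥ c₁ - M.toBlocks₂₁.map (Rat.cast : ℚ → ℝ) *ᵥ c₂

/-- The linear part `-β c₁ + α c₂` of `char₂`. -/
def lin₂ {g : ℕ} (M : Matrix (Fin g ⊕ Fin g) (Fin g ⊕ Fin g) ℚ) (c₁ c₂ : Fin g → ℝ) : Fin g → ℝ :=
  -(M.toBlocks₁₂.map (Rat.cast : ℚ → ℝ) *ᵥ c₁) + M.toBlocks₁₁.map (Rat.cast : ℚ → ℝ) *ᵥ c₂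

section Shift

variable {g : ℕ} {Z : Matrix (Fin g) (Fin g) ℂ} {M : Matrix (Fin g ⊕ Fin g) (Fin g ⊕ Fin g) ℚ}
  {d : Fin g → ℕ}

lemma cvec_add (x y : Fin g → ℝ) : cvec (x + y) = cvec x + cvec y := by
  ext i; simp [cvec]

lemma cvec_dotProduct (x y : Fin g → ℝ) : cvec x ⬝ᵥ cvec y = ((x ⬝ᵥ y : ℝ) : ℂ) := by
  simp [dotProduct]

/-- A change of characteristic is a translation of the argument. The correction involves only `H`,
which `ψ` preserves, and an alternating phase between old and added characteristic. -/
lemma thetaTuple_add_char (hZ : Z ∈ siegel g) (e₁ e₂ l₁ l₂ : Fin g → ℝ) (m : ∀ i, Fin (d i))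
    (v : Fin g → ℂ) :
    thetaTuple d Z (toVec Z (e₁ + l₁) (e₂ + l₂)) m v =
      Complex.exp (-Real.pi * formH Z v (toVec Z l₁ l₂) -
          Real.pi / 2 * formH Z (toVec Z l₁ l₂) (toVec Z l₁ l₂) +
          Real.pi * Complex.I * ((l₁ ⬝ᵥ e₂ - l₂ ⬝ᵥ e₁ : ℝ) : ℂ)) *
        thetaTuple d Z (toVec Z e₁ e₂) m (v + toVec Z l₁ l₂) := by
  rw [thetaTuple_eq hZ, thetaTuple_eq hZ, thetaChar, thetaChar, ← tsum_mul_left, ← tsum_mul_left,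
    ← tsum_mul_left]
  refine tsum_congr fun n => ?_
  rw [← Complex.exp_add, ← Complex.exp_add, ← Complex.exp_add]
  congr 1
  rw [formH_eq hZ, formH_eq hZ, formB_add_left, formB_add_right, formB_add_right,
    formB_comm hZ (toVec Z l₁ l₂) v]
  generalize formB Z v v = x1
  generalize formB Z v (toVec Z l₁ l₂) = x2
  generalize formB Z (toVec Z l₁ l₂) (toVec Z l₁ l₂) = x3
  rw [toVec_eq]
  push_cast
  rw [← cvec_dotProduct, ← cvec_dotProduct, cvec_add, cvec_add]
  generalize ((fun i => ((m i : ℕ) : ℂ) / (d i : ℂ))) = u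
  generalize ((fun i => (n i : ℂ))) = N
  generalize cvec e₁ = a
  generalize cvec e₂ = b
  generalize cvec l₁ = p
  generalize cvec l₂ = q
  simp only [dotProduct_add, add_dotProduct, mulVec_add, dotProduct_comm v p,
    dotProduct_comm q a, dotProduct_comm q p, dotProduct_mulVec_comm hZ.1 p N,
    dotProduct_mulVec_comm hZ.1 p a, dotProduct_mulVec_comm hZ.1 p u, dotProduct_comm (Z *ᵥ p)]
  ring

/-- The blocks `δ, -γ, -β, α` form the inverse transpose of `M`, so this undoes the action described
in `psiA_toVec`. -/
lemma psiA_toVec_lin (hM : M ∈ symplecticGroup (Fin g) ℚ) (hZ : Z ∈ siegel g) (c₁ c₂ : Fin g → ℝ) :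
    psiA M Z (toVec (act M Z) (lin₁ M c₁ c₂) (lin₂ M c₁ c₂)) = toVec Z c₁ c₂ := by
  obtain ⟨h1, h2, h3⟩ := symplectic_relations ℝ hM
  have h4 := congrArg Matrix.transpose h3
  simp only [transpose_sub, transpose_mul, transpose_transpose, transpose_one] at h4
  rw [psiA_toVec hM hZ, lin₁, lin₂]
  generalize M.toBlocks₁₁.map (Rat.cast : ℚ → ℝ) = α at *
  generalize M.toBlocks₁₂.map (Rat.cast : ℚ → ℝ) = β at *
  generalize M.toBlocks₂₁.map (Rat.cast : ℚ → ℝ) = γ at *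
  generalize M.toBlocks₂₂.map (Rat.cast : ℚ → ℝ) = δ at *
  congr 1
  · calc _ = (αᵀ * δ - γᵀ * β) *ᵥ c₁ + (γᵀ * α - αᵀ * γ) *ᵥ c₂ := by
          simp only [mulVec_sub, mulVec_add, mulVec_neg, mulVec_mulVec, sub_mulVec]; abel
      _ = c₁ := by rw [h3, h1]; simp
  · calc _ = (βᵀ * δ - δᵀ * β) *ᵥ c₁ + (δᵀ * α - βᵀ * γ) *ᵥ c₂ := by
          simp only [mulVec_sub, mulVec_add, mulVec_neg, mulVec_mulVec, sub_mulVec]; abel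
      _ = c₂ := by rw [h4, h2]; simp

lemma psiA_add (v w : Fin g → ℂ) : psiA M Z (v + w) = psiA M Z v + psiA M Z w := mulVec_add _ _ _

/-- A transition matrix for the characteristic `0` gives one for every characteristic. -/
lemma Transition.shift (hM : M ∈ symplecticGroup (Fin g) ℚ) (hZ : Z ∈ siegel g)
    {e₁ e₂ : Fin g → ℝ} {C : Matrix (∀ i, Fin (d i)) (∀ i, Fin (d i)) ℂ}
    (h : Transition d M Z 0 0 e₁ e₂ C) (c₁ c₂ : Fin g → ℝ) :
    Transition d M Z c₁ c₂ (e₁ + lin₁ M c₁ c₂) (e₂ + lin₂ M c₁ c₂)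
      (Complex.exp (-(Real.pi * Complex.I *
        ((lin₁ M c₁ c₂ ⬝ᵥ e₂ - lin₂ M c₁ c₂ ⬝ᵥ e₁ : ℝ) : ℂ))) • C) := by
  intro m v
  have h0 := thetaTuple_add_char hZ 0 0 c₁ c₂ m (psiA M Z v)
  rw [zero_add, zero_add] at h0
  rw [h0, ← psiA_toVec_lin hM hZ, ← psiA_add, h m, Finset.mul_sum]
  refine Finset.sum_congr rfl fun n _ => ?_
  -- The `H`-factors on the two sides agree. The phase vanishes at the source, where the old
  -- characteristic is `0`, so only the target phase is left and it is the scalar in front of `C`.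
  rw [thetaTuple_add_char (act_mem_siegel hM hZ), formH_psiA hM hZ, formH_psiA hM hZ,
    dotProduct_zero, dotProduct_zero, sub_zero, Complex.ofReal_zero, mul_zero, add_zero,
    Matrix.smul_apply, smul_eq_mul, Complex.exp_add _ (Real.pi * Complex.I * _), Complex.exp_neg]
  have := Complex.exp_ne_zero (Real.pi * Complex.I *
        ((lin₁ M c₁ c₂ ⬝ᵥ e₂ - lin₂ M c₁ c₂ ⬝ᵥ e₁ : ℝ) : ℂ))
  field_simp

lemma Transition.comp {M' : Matrix (Fin g ⊕ Fin g) (Fin g ⊕ Fin g) ℚ}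
    (hM : M ∈ symplecticGroup (Fin g) ℚ) (hZ : Z ∈ siegel g)
    {c₁ c₂ e₁ e₂ f₁ f₂ : Fin g → ℝ} {C C' : Matrix (∀ i, Fin (d i)) (∀ i, Fin (d i)) ℂ}
    (h : Transition d M Z c₁ c₂ e₁ e₂ C) (h' : Transition d M' (act M Z) e₁ e₂ f₁ f₂ C') :
    Transition d (M' * M) Z c₁ c₂ f₁ f₂ (C * C') := by
  intro m v
  rw [psiA_mul hM hZ, h m, act_mul hM hZ]
  simp only [h' _ v, Matrix.mul_apply, Finset.sum_mul, Finset.mul_sum]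
  rw [Finset.sum_comm]
  exact Finset.sum_congr rfl fun i _ => Finset.sum_congr rfl fun j _ => by ring

lemma Transition.unique (hd : ∀ i, 0 < d i) (hM : M ∈ symplecticGroup (Fin g) ℚ)
    (hZ : Z ∈ siegel g) {c₁ c₂ e₁ e₂ : Fin g → ℝ}
    {C C' : Matrix (∀ i, Fin (d i)) (∀ i, Fin (d i)) ℂ}
    (h : Transition d M Z c₁ c₂ e₁ e₂ C) (h' : Transition d M Z c₁ c₂ e₁ e₂ C') : C = C' := by
  ext m n
  have := thetaTuple_linearIndependent hd (act_mem_siegel hM hZ) e₁ e₂ (C m - C' m) fun v => by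
    simp only [Pi.sub_apply, sub_mul, Finset.sum_sub_distrib]
    rw [← h m v, ← h' m v, sub_self]
  exact sub_eq_zero.1 (congrFun this n)

end Shift

/-! ### Sums over the box of residues. -/

section BoxSums

variable {g : ℕ} (d : Fin g → ℕ)

/-- A product of one-variable sums in which every factor except the `i`-th sums the constant `1`. -/
lemma sum_box_apply (i : Fin g) (f : ℕ → ℂ) :
    ∑ n : ∀ i, Fin (d i), f (n i) =
      (∏ j ∈ Finset.univ.erase i, (d j : ℂ)) * ∑ k ∈ Finset.range (d i), f k := by
  have h := Finset.prod_univ_sum (fun j : Fin g => (Finset.univ : Finset (Fin (d j))))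
    (fun j k => if j = i then f k else 1)
  rw [Fintype.piFinset_univ] at h
  have h1 : ∀ n : ∀ i, Fin (d i), ∏ j, (if j = i then f (n j) else 1) = f (n i) := fun n => by
    rw [Finset.prod_eq_single i] <;> simp +contextual
  simp only [h1] at h
  rw [← h, ← Finset.prod_erase_mul _ _ (Finset.mem_univ i)]
  congr 1
  · refine Finset.prod_congr rfl fun j hj => ?_
    simp [Finset.ne_of_mem_erase hj]
  · simp [Finset.sum_range]

lemma sum_box_apply_mul {i j : Fin g} (hij : i ≠ j) (f f' : ℕ → ℂ) :
    ∑ n : ∀ i, Fin (d i), f (n i) * f' (n j) =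
      (∏ k ∈ (Finset.univ.erase i).erase j, (d k : ℂ)) *
        ((∑ k ∈ Finset.range (d i), f k) * ∑ k ∈ Finset.range (d j), f' k) := by
  have h := Finset.prod_univ_sum (fun j : Fin g => (Finset.univ : Finset (Fin (d j))))
    (fun k l => if k = i then f l else if k = j then f' l else 1)
  rw [Fintype.piFinset_univ] at h
  have hj : j ∈ Finset.univ.erase i := by simp [hij.symm]
  have h1 : ∀ n : ∀ i, Fin (d i), ∏ k, (if k = i then f (n k) else if k = j then f' (n k) else 1) =
      f (n i) * f' (n j) := fun n => by
    rw [← Finset.mul_prod_erase _ _ (Finset.mem_univ i), ← Finset.mul_prod_erase _ _ hj,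
      Finset.prod_eq_one]
    · simp [hij.symm]
    · intro k hk
      simp only [Finset.mem_erase] at hk
      simp [hk.1, hk.2.1]
  simp only [h1] at h
  rw [← h, ← Finset.mul_prod_erase _ _ (Finset.mem_univ i), ← Finset.mul_prod_erase _ _ hj]
  have h2 : ∏ k ∈ (Finset.univ.erase i).erase j, ∑ l : Fin (d k),
      (if k = i then f l else if k = j then f' l else 1) =
        ∏ k ∈ (Finset.univ.erase i).erase j, (d k : ℂ) := by
    refine Finset.prod_congr rfl fun k hk => ?_
    simp only [Finset.mem_erase] at hk
    simp [hk.1, hk.2.1]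
  simp only [if_neg hij.symm, if_true] at *
  rw [h2, Finset.sum_range, Finset.sum_range]
  ring

end BoxSums

/-! ### Changing the characteristic by a vector of `Λ(H_Z)`. -/

section LatticeShift

variable {g : ℕ} {Z : Matrix (Fin g) (Fin g) ℂ} {d : Fin g → ℕ}

lemma thetaChar_add_int (Z : Matrix (Fin g) (Fin g) ℂ) (a b v : Fin g → ℂ) (K : Fin g → ℤ) :
    thetaChar Z (a + fun i => (K i : ℂ)) b v = thetaChar Z a b v := by
  rw [thetaChar, thetaChar]
  conv_rhs => rw [← (Equiv.addRight K).tsum_eq]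
  refine tsum_congr fun n => ?_
  have : (fun i => (n i : ℂ)) + (a + fun i => (K i : ℂ)) =
      (fun i => (((Equiv.addRight K) n i : ℤ) : ℂ)) + a := by
    ext i; simp; ring
  rw [this]

lemma exp_two_pi_mul_int (k : ℤ) : Complex.exp (2 * Real.pi * Complex.I * k) = 1 := by
  rw [Complex.exp_eq_one_iff]; exact ⟨k, by ring⟩

lemma thetaChar_add_int_right (Z : Matrix (Fin g) (Fin g) ℂ) (a b v : Fin g → ℂ)
    (Q : Fin g → ℤ) :
    thetaChar Z a (b + fun i => (Q i : ℂ)) v =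
      Complex.exp (2 * Real.pi * Complex.I * (a ⬝ᵥ fun i => (Q i : ℂ))) * thetaChar Z a b v := by
  rw [thetaChar, thetaChar, ← tsum_mul_left]
  refine tsum_congr fun n => ?_
  have h : (fun i => (n i : ℂ)) ⬝ᵥ (fun i => (Q i : ℂ)) = ((n ⬝ᵥ Q : ℤ) : ℂ) := by
    simp [dotProduct]
  rw [← Complex.exp_add, ← one_mul (Complex.exp (_ + _)), ← exp_two_pi_mul_int (n ⬝ᵥ Q), ← h,
    ← Complex.exp_add]
  congr 1
  simp only [add_dotProduct, dotProduct_add]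
  ring

/-- The translation by `P` on `ℤ_D`. -/
def boxShift (hd : ∀ i, 0 < d i) (P : Fin g → ℤ) (m : ∀ i, Fin (d i)) : ∀ i, Fin (d i) := fun i =>
  ⟨(((m i : ℕ) + P i) % d i).toNat, by
    have h : (0 : ℤ) < d i := by exact_mod_cast hd i
    have h1 := Int.emod_nonneg ((m i : ℕ) + P i) h.ne'
    have h2 := Int.emod_lt_of_pos ((m i : ℕ) + P i) h
    omega⟩

lemma boxShift_spec (hd : ∀ i, 0 < d i) (P : Fin g → ℤ) (m : ∀ i, Fin (d i)) (i : Fin g) :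
    ((m i : ℕ) : ℤ) + P i = d i * ((((m i : ℕ) : ℤ) + P i) / d i) + ((boxShift hd P m i : ℕ) : ℤ) := by
  have h : (0 : ℤ) < d i := by exact_mod_cast hd i
  have h1 := Int.emod_nonneg ((m i : ℕ) + P i) h.ne'
  have h3 : ((boxShift hd P m i : ℕ) : ℤ) = ((m i : ℕ) + P i) % d i := by
    simp only [boxShift]; omega
  rw [h3, Int.mul_ediv_add_emod]

lemma fin_eq_of_dvd {n : ℕ} {a b : Fin n} (h : (n : ℤ) ∣ (a : ℕ) - (b : ℕ)) : a = b := by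
  obtain ⟨k, hk⟩ := h
  have h1 := a.2
  have h2 := b.2
  have : k = 0 := by
    by_contra hne
    rcases lt_or_gt_of_ne hne with hlt | hgt
    · nlinarith
    · nlinarith
  subst this
  exact Fin.ext (by omega)

lemma boxShift_injective (hd : ∀ i, 0 < d i) (P : Fin g → ℤ) :
    Function.Injective (boxShift hd P) := by
  intro m m' h
  ext1 i
  have h1 := boxShift_spec hd P m i
  have h2 := boxShift_spec hd P m' i
  rw [h] at h1
  refine fin_eq_of_dvd ⟨((m i : ℕ) + P i) / d i - ((m' i : ℕ) + P i) / d i, ?_⟩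
  rw [mul_sub]; linarith

/-- The translation by `P` on `ℤ_D` as a permutation. -/
def boxPerm (hd : ∀ i, 0 < d i) (P : Fin g → ℤ) : Equiv.Perm (∀ i, Fin (d i)) :=
  Equiv.ofBijective _ (Finite.injective_iff_bijective.1 (boxShift_injective hd P))

lemma sum_range_cast (n : ℕ) : ∑ k ∈ Finset.range n, (k : ℂ) = n * (n - 1) / 2 := by
  induction n with
  | zero => simp
  | succ n ih => rw [Finset.sum_range_succ, ih]; push_cast; ring

lemma card_box (d : Fin g → ℕ) : Fintype.card (∀ i, Fin (d i)) = ∏ i, d i := by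
  simp

/-- The shift by `D⁻¹ P` translates the residue `m`; the integral carry is absorbed by reindexing
the series. The integral vector `Q` only produces a phase, which depends on the translated residue.
-/
lemma thetaTuple_lattice_shift (hd : ∀ i, 0 < d i) (hZ : Z ∈ siegel g) (c₁ c₂ p₁ p₂ : Fin g → ℝ)
    (P Q : Fin g → ℤ) (hp₁ : ∀ i, d i * p₁ i = P i) (hp₂ : ∀ i, p₂ i = Q i)
    (m : ∀ i, Fin (d i)) (v : Fin g → ℂ) :
    thetaTuple d Z (toVec Z (c₁ + p₁) (c₂ + p₂)) m v =
      Complex.exp (Real.pi * Complex.I * ((cvec c₁ ⬝ᵥ cvec p₂) - (cvec p₁ ⬝ᵥ cvec c₂) -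
          (cvec p₁ ⬝ᵥ cvec p₂) +
          2 * ∑ i, ((boxPerm hd P m i : ℕ) : ℂ) * ((Q i : ℂ) / d i))) *
        thetaTuple d Z (toVec Z c₁ c₂) (boxPerm hd P m) v := by
  have hd' : ∀ i, (d i : ℂ) ≠ 0 := fun i => by exact_mod_cast (hd i).ne'
  rw [thetaTuple_eq hZ, thetaTuple_eq hZ]
  have hq : cvec (c₂ + p₂) = cvec c₂ + fun i => (Q i : ℂ) := by
    ext i; simp [cvec, hp₂]
  have ha : (cvec (c₁ + p₁) + fun i => ((m i : ℕ) : ℂ) / (d i : ℂ)) =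
      (cvec c₁ + fun i => ((boxPerm hd P m i : ℕ) : ℂ) / (d i : ℂ)) +
        fun i => (((((m i : ℕ) : ℤ) + P i) / d i : ℤ) : ℂ) := by
    ext i
    have h1 := boxShift_spec hd P m i
    have h2 : ((m i : ℕ) : ℂ) + P i = d i * (((((m i : ℕ) : ℤ) + P i) / d i : ℤ) : ℂ) +
        ((boxShift hd P m i : ℕ) : ℂ) := by exact_mod_cast h1
    have h3 : (d i : ℂ) * p₁ i = P i := by exact_mod_cast hp₁ i
    rw [← h3] at h2
    simp only [Pi.add_apply, cvec, boxPerm, Equiv.ofBijective_apply]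
    push_cast
    have := hd' i
    field_simp
    linear_combination h2
  rw [ha, thetaChar_add_int, hq, thetaChar_add_int_right, ← mul_assoc, ← mul_assoc,
    ← Complex.exp_add, ← Complex.exp_add]
  congr 2
  have e2 : (fun i => (Q i : ℂ)) = cvec p₂ := by ext i; simp [cvec, hp₂]
  have e3 : (fun i => ((boxPerm hd P m i : ℕ) : ℂ) / (d i : ℂ)) ⬝ᵥ cvec p₂ =
      ∑ i, ((boxPerm hd P m i : ℕ) : ℂ) * ((Q i : ℂ) / d i) := by
    rw [← e2, dotProduct]
    exact Finset.sum_congr rfl fun i _ => by ring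
  rw [e2, cvec_add]
  simp only [add_dotProduct, dotProduct_add, e3]
  ring

/-- Changing the characteristic by an element of `Λ(H_Z)` changes the tuple of theta functions by
a monomial matrix independent of `Z`, whose determinant is an eighth root of unity. -/
lemma exists_lattice_shift_matrix (hd : ∀ i, 0 < d i) {c₁ c₂ p₁ p₂ : Fin g → ℝ}
    (hc : IsHalf d c₁ c₂) (hp₁ : ∀ i, ∃ P : ℤ, d i * p₁ i = P) (hp₂ : ∀ i, ∃ Q : ℤ, p₂ i = Q) :
    ∃ S : Matrix (∀ i, Fin (d i)) (∀ i, Fin (d i)) ℂ, S.det ^ 8 = 1 ∧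
      ∀ Z ∈ siegel g, ∀ n v, thetaTuple d Z (toVec Z c₁ c₂) n v =
        ∑ m, S n m * thetaTuple d Z (toVec Z (c₁ + p₁) (c₂ + p₂)) m v := by
  choose P hP using hp₁
  choose Q hQ using hp₂
  have hd' : ∀ i, (d i : ℂ) ≠ 0 := fun i => by exact_mod_cast (hd i).ne'
  set φ : (∀ i, Fin (d i)) → ℂ := fun n =>
    -(Real.pi * Complex.I * ((cvec c₁ ⬝ᵥ cvec p₂) - (cvec p₁ ⬝ᵥ cvec c₂) -
      (cvec p₁ ⬝ᵥ cvec p₂) + 2 * ∑ i, ((n i : ℕ) : ℂ) * ((Q i : ℂ) / d i))) with hφ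
  refine ⟨(diagonal fun n => Complex.exp (φ n)).submatrix id (boxPerm hd P), ?_, ?_⟩
  · choose k hk using fun i => (hc i).1
    choose l hl using fun i => (hc i).2
    rw [det_permute', det_diagonal, ← Complex.exp_sum, mul_pow, ← Complex.exp_nat_mul]
    have hs : (((Equiv.Perm.sign (boxPerm hd P) : ℤˣ) : ℤ) : ℂ) ^ 8 = 1 := by
      rcases Int.units_eq_one_or (Equiv.Perm.sign (boxPerm hd P)) with h | h <;> rw [h] <;> norm_num
    rw [hs, one_mul, hφ, Finset.sum_neg_distrib, ← Finset.mul_sum, Finset.sum_add_distrib,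
      Finset.sum_const, Finset.card_univ, card_box, ← Finset.mul_sum, Finset.sum_comm]
    have h1 : ∀ i, ∑ n : ∀ i, Fin (d i), ((n i : ℕ) : ℂ) * ((Q i : ℂ) / d i) =
        (∏ j ∈ Finset.univ.erase i, (d j : ℂ)) * ((d i - 1) / 2 * Q i) := fun i => by
      rw [← Finset.sum_mul, sum_box_apply d i (fun k => (k : ℂ)), sum_range_cast]
      field_simp [hd' i]
    simp only [h1]
    -- The number of residues clears the denominators `d_i`, and the factor 4 more than clears the
    -- halves coming from `IsHalf`.
    have h2 : ((∏ i, d i : ℕ) : ℂ) * 4 * ((cvec c₁ ⬝ᵥ cvec p₂) - (cvec p₁ ⬝ᵥ cvec c₂) -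
        (cvec p₁ ⬝ᵥ cvec p₂)) =
        ∑ i, (∏ j ∈ Finset.univ.erase i, (d j : ℂ)) *
          (2 * k i * Q i - 2 * P i * l i - 4 * P i * Q i) := by
      simp only [dotProduct, ← Finset.sum_sub_distrib, Finset.mul_sum]
      refine Finset.sum_congr rfl fun i _ => ?_
      rw [← Finset.mul_prod_erase _ _ (Finset.mem_univ i)]
      have a1 : 2 * (d i : ℂ) * c₁ i = k i := by exact_mod_cast hk i
      have a2 : 2 * (c₂ i : ℂ) = l i := by exact_mod_cast hl i
      have a3 : (d i : ℂ) * p₁ i = P i := by exact_mod_cast hP i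
      have a4 : (p₂ i : ℂ) = Q i := by exact_mod_cast hQ i
      push_cast
      rw [← a1, ← a2, ← a3, ← a4]
      ring
    have h3 : ∃ t : ℤ, (t : ℂ) = ((∏ i, d i : ℕ) : ℂ) * 4 * ((cvec c₁ ⬝ᵥ cvec p₂) -
        (cvec p₁ ⬝ᵥ cvec c₂) - (cvec p₁ ⬝ᵥ cvec p₂)) +
        4 * ∑ i, (∏ j ∈ Finset.univ.erase i, (d j : ℂ)) * ((d i - 1) * Q i) := by
      rw [h2]
      refine ⟨∑ i, (∏ j ∈ Finset.univ.erase i, (d j : ℤ)) *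
          (2 * k i * Q i - 2 * P i * l i - 4 * P i * Q i) +
          4 * ∑ i, (∏ j ∈ Finset.univ.erase i, (d j : ℤ)) * ((d i - 1) * Q i), ?_⟩
      push_cast
      ring
    obtain ⟨t, ht⟩ := h3
    refine Eq.trans ?_ (exp_two_pi_mul_int (-t))
    congr 1
    push_cast
    rw [ht]
    push_cast
    have h4 : ∑ i, (∏ j ∈ Finset.univ.erase i, (d j : ℂ)) * (((d i : ℂ) - 1) / 2 * Q i) =
        (1 / 2) * ∑ i, (∏ j ∈ Finset.univ.erase i, (d j : ℂ)) * ((d i - 1) * Q i) := by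
      rw [Finset.mul_sum]
      exact Finset.sum_congr rfl fun i _ => by ring
    rw [h4, nsmul_eq_mul]
    push_cast
    ring
  · intro Z hZ n v
    rw [Finset.sum_eq_single ((boxPerm hd P).symm n)]
    · rw [thetaTuple_lattice_shift hd hZ c₁ c₂ p₁ p₂ P Q hP hQ, submatrix_apply, id,
        Equiv.apply_symm_apply, diagonal_apply_eq, ← mul_assoc, ← Complex.exp_add]
      simp only [hφ]
      rw [neg_add_cancel, Complex.exp_zero, one_mul]
    · intro m _ hm
      rw [submatrix_apply, id, diagonal_apply_ne, zero_mul]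
      rintro rfl
      simp at hm
    · simp

end LatticeShift

/-! ### Generators of `Γ_D` by symplectic row reduction. -/

section Generators

open scoped MatrixGroups

variable {g : ℕ}

/-- The unipotent matrix `(1, b; 0, 1)`. -/
def transU (b : Matrix (Fin g) (Fin g) ℤ) : (Matrix (Fin g ⊕ Fin g) (Fin g ⊕ Fin g) ℤ)ˣ where
  val := fromBlocks 1 b 0 1
  inv := fromBlocks 1 (-b) 0 1
  val_inv := by simp [fromBlocks_multiply]
  inv_val := by simp [fromBlocks_multiply]

/-- The block matrix acting by `A j ∈ SL₂(ℤ)` on the `j`-th hyperbolic plane. -/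
def blockHom : (Fin g → SL(2, ℤ)) →* Matrix (Fin g ⊕ Fin g) (Fin g ⊕ Fin g) ℤ where
  toFun A := fromBlocks (diagonal fun j => A j 0 0) (diagonal fun j => A j 0 1)
    (diagonal fun j => A j 1 0) (diagonal fun j => A j 1 1)
  map_one' := by simp
  map_mul' A B := by
    rw [fromBlocks_multiply]
    simp only [diagonal_mul_diagonal, diagonal_add]
    congr 1 <;> congr 1 <;> ext j <;>
      simp [Matrix.mul_apply, Fin.sum_univ_two]

/-- `blockHom` with values in the units. -/
def blockU : (Fin g → SL(2, ℤ)) →* (Matrix (Fin g ⊕ Fin g) (Fin g ⊕ Fin g) ℤ)ˣ :=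
  blockHom.toHomUnits

lemma coe_blockU (A : Fin g → SL(2, ℤ)) : (blockU A).val = blockHom A := rfl

/-- The partial inversion in the `i`-th hyperbolic plane. -/
def invU (i : Fin g) : (Matrix (Fin g ⊕ Fin g) (Fin g ⊕ Fin g) ℤ)ˣ :=
  blockU (Pi.mulSingle i ModularGroup.S)

/-- The subgroup generated by the unipotent matrices in `Γ_D` and the partial inversions. -/
def genGroup (d : Fin g → ℕ) : Subgroup (Matrix (Fin g ⊕ Fin g) (Fin g ⊕ Fin g) ℤ)ˣ :=
  Subgroup.closure ({R | ∃ b : Matrix (Fin g) (Fin g) ℤ, (∀ i j, b i j * d j = b j i * d i) ∧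
    R = transU b} ∪ Set.range invU)

variable {d : Fin g → ℕ}

lemma transU_mem {b : Matrix (Fin g) (Fin g) ℤ} (hb : ∀ i j, b i j * d j = b j i * d i) :
    transU b ∈ genGroup d :=
  Subgroup.subset_closure (Or.inl ⟨b, hb, rfl⟩)

lemma blockU_mulSingle_T (i : Fin g) :
    blockU (Pi.mulSingle i ModularGroup.T) = transU (Matrix.single i i 1) := by
  apply Units.ext
  change fromBlocks _ _ _ _ = fromBlocks _ _ _ _
  congr 1
  all_goals
    ext j k
    by_cases hj : j = i
    · subst hj
      by_cases hk : j = k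
      · subst hk; simp only [diagonal_apply_eq, Pi.mulSingle_eq_same]; simp [ModularGroup.T]
      · simp [hk]
    · by_cases hk : j = k
      · subst hk; simp [hj, Ne.symm hj]
      · simp [hk, Ne.symm hj]

/-- `SL₂(ℤ)` is generated by `S` and `T`. In the `i`-th plane `S` is a partial inversion, and `T` is
the unipotent with one diagonal entry, for which the symmetry condition is automatic. -/
lemma blockU_mem (A : Fin g → SL(2, ℤ)) : blockU A ∈ genGroup d := by
  change A ∈ (genGroup d).comap blockU
  refine Subgroup.pi_mem_of_mulSingle_mem A fun i => ?_
  change A i ∈ ((genGroup d).comap blockU).comap (MonoidHom.mulSingle (fun _ => SL(2, ℤ)) i)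
  have h : (⊤ : Subgroup SL(2, ℤ)) ≤
      ((genGroup d).comap blockU).comap (MonoidHom.mulSingle (fun _ => SL(2, ℤ)) i) := by
    rw [← SpecialLinearGroup.SL2Z_generators, Subgroup.closure_le]
    rintro _ (rfl | rfl)
    · exact Subgroup.subset_closure (Or.inr ⟨i, rfl⟩)
    · change blockU (Pi.mulSingle i ModularGroup.T) ∈ genGroup d
      rw [blockU_mulSingle_T]
      refine transU_mem fun j k => ?_
      by_cases hj : j = i <;> by_cases hk : k = i <;> simp [hj, hk, Ne.symm]
  exact h (Subgroup.mem_top _)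

/-- The alternating form of type `D` on row vectors. -/
def altForm (d : Fin g → ℕ) (x y : Fin g ⊕ Fin g → ℤ) : ℤ :=
  ∑ j, (d j : ℤ) * (x (Sum.inl j) * y (Sum.inr j) - x (Sum.inr j) * y (Sum.inl j))

/-- The vectors whose coordinates in the planes before `k` vanish. -/
def VanishBelow (k : ℕ) (x : Fin g ⊕ Fin g → ℤ) : Prop :=
  ∀ j : Fin g, (j : ℕ) < k → x (Sum.inl j) = 0 ∧ x (Sum.inr j) = 0

/-- Elements of the generated group that preserve the form and the planes before `k`. -/
structure Admissible (d : Fin g → ℕ) (k : ℕ)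
    (G : (Matrix (Fin g ⊕ Fin g) (Fin g ⊕ Fin g) ℤ)ˣ) : Prop where
  mem : G ∈ genGroup d
  fix_inl : ∀ j : Fin g, (j : ℕ) < k → Pi.single (Sum.inl j) 1 ᵥ* G.val =
    Pi.single (Sum.inl j) 1
  fix_inr : ∀ j : Fin g, (j : ℕ) < k → Pi.single (Sum.inr j) 1 ᵥ* G.val =
    Pi.single (Sum.inr j) 1
  vanish : ∀ x, VanishBelow k x → VanishBelow k (x ᵥ* G.val)
  form : ∀ x y, altForm d (x ᵥ* G.val) (y ᵥ* G.val) = altForm d x y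

lemma Admissible.mul {k : ℕ} {G G' : (Matrix (Fin g ⊕ Fin g) (Fin g ⊕ Fin g) ℤ)ˣ}
    (h : Admissible d k G) (h' : Admissible d k G') : Admissible d k (G * G') where
  mem := mul_mem h.mem h'.mem
  fix_inl j hj := by rw [Units.val_mul, ← vecMul_vecMul, h.fix_inl j hj, h'.fix_inl j hj]
  fix_inr j hj := by rw [Units.val_mul, ← vecMul_vecMul, h.fix_inr j hj, h'.fix_inr j hj]
  vanish x hx := by rw [Units.val_mul, ← vecMul_vecMul]; exact h'.vanish _ (h.vanish _ hx)
  form x y := by rw [Units.val_mul, ← vecMul_vecMul, ← vecMul_vecMul, h'.form, h.form]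

lemma vecMul_blockU_inl (A : Fin g → SL(2, ℤ)) (x : Fin g ⊕ Fin g → ℤ) (j : Fin g) :
    (x ᵥ* (blockU A).val) (Sum.inl j) =
      x (Sum.inl j) * A j 0 0 + x (Sum.inr j) * A j 1 0 := by
  simp [coe_blockU, blockHom, vecMul, dotProduct, Fintype.sum_sum_type, diagonal_apply]

lemma vecMul_blockU_inr (A : Fin g → SL(2, ℤ)) (x : Fin g ⊕ Fin g → ℤ) (j : Fin g) :
    (x ᵥ* (blockU A).val) (Sum.inr j) =
      x (Sum.inl j) * A j 0 1 + x (Sum.inr j) * A j 1 1 := by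
  simp [coe_blockU, blockHom, vecMul, dotProduct, Fintype.sum_sum_type, diagonal_apply]

lemma vecMul_transU_inl (b : Matrix (Fin g) (Fin g) ℤ) (x : Fin g ⊕ Fin g → ℤ) (j : Fin g) :
    (x ᵥ* (transU b).val) (Sum.inl j) = x (Sum.inl j) := by
  simp [transU, vecMul, dotProduct, Fintype.sum_sum_type, Matrix.one_apply]

lemma vecMul_transU_inr (b : Matrix (Fin g) (Fin g) ℤ) (x : Fin g ⊕ Fin g → ℤ) (j : Fin g) :
    (x ᵥ* (transU b).val) (Sum.inr j) =
      ∑ i, x (Sum.inl i) * b i j + x (Sum.inr j) := by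
  simp [transU, vecMul, dotProduct, Fintype.sum_sum_type, Matrix.one_apply]

lemma admissible_blockU {k : ℕ} {A : Fin g → SL(2, ℤ)} (hA : ∀ j : Fin g, (j : ℕ) < k → A j = 1) :
    Admissible d k (blockU A) where
  mem := blockU_mem A
  fix_inl j hj := by
    ext (i | i)
    · rw [vecMul_blockU_inl]
      by_cases h : i = j
      · subst h; simp [hA i hj]
      · simp [h]
    · rw [vecMul_blockU_inr]
      by_cases h : i = j
      · subst h; simp [hA i hj]
      · simp [h]
  fix_inr j hj := by
    ext (i | i)
    · rw [vecMul_blockU_inl]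
      by_cases h : i = j
      · subst h; simp [hA i hj]
      · simp [h]
    · rw [vecMul_blockU_inr]
      by_cases h : i = j
      · subst h; simp [hA i hj]
      · simp [h]
  vanish x hx j hj := by
    rw [vecMul_blockU_inl, vecMul_blockU_inr, (hx j hj).1, (hx j hj).2]; simp
  form x y := by
    unfold altForm
    refine Finset.sum_congr rfl fun j _ => ?_
    have hdet := (A j).det_coe
    rw [Matrix.det_fin_two] at hdet
    rw [vecMul_blockU_inl, vecMul_blockU_inl, vecMul_blockU_inr, vecMul_blockU_inr]
    linear_combination (d j : ℤ) * (x (Sum.inl j) * y (Sum.inr j) - x (Sum.inr j) * y (Sum.inl j)) *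
      hdet

/-- The matrix `b` with `b D` symmetric, supported on the `k`-th row and column, with `k`-th
row `s`. -/
def crossMat (d : Fin g → ℕ) (k : Fin g) (s : Fin g → ℤ) : Matrix (Fin g) (Fin g) ℤ := fun i j =>
  if i = k then s j else if j = k then (d i / d k : ℕ) * s i else 0

/-- The natural-number quotient `d i / d k` is exact for `i ≥ k` by the divisibility chain; for `i <
k` the entry vanishes anyway. -/
lemma crossMat_symm (hd : IsPolarizationType d) (k : Fin g) {s : Fin g → ℤ}
    (hs : ∀ j : Fin g, j < k → s j = 0) (i j : Fin g) :
    crossMat d k s i j * d j = crossMat d k s j i * d i := by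
  have key : ∀ i, ((d i / d k : ℕ) : ℤ) * s i * d k = s i * d i := fun i => by
    rcases lt_or_ge i k with h | h
    · simp [hs i h]
    · have : ((d i / d k : ℕ) : ℤ) * d k = d i := by
        exact_mod_cast Nat.div_mul_cancel (hd.2 k i h)
      rw [← this]; ring
  unfold crossMat
  by_cases hi : i = k <;> by_cases hj : j = k
  · subst hi; subst hj; rfl
  · subst hi; rw [if_pos rfl, if_neg hj, if_pos rfl, key]
  · subst hj; rw [if_neg hi, if_pos rfl, if_pos rfl, key]
  · simp [hi, hj]

lemma admissible_crossMat (hd : IsPolarizationType d) (k : Fin g) {s : Fin g → ℤ}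
    (hs : ∀ j : Fin g, j < k → s j = 0) : Admissible d k (transU (crossMat d k s)) where
  mem := transU_mem (crossMat_symm hd k hs)
  fix_inl j hj := by
    have hjk : j ≠ k := by rintro rfl; exact lt_irrefl _ hj
    have h0 : s j = 0 := hs j hj
    ext (i | i)
    · rw [vecMul_transU_inl]
    · rw [vecMul_transU_inr]
      rw [Finset.sum_eq_single j (fun x _ hx => by simp [hx]) (by simp)]
      simp [crossMat, hjk, h0]
  fix_inr j hj := by
    ext (i | i)
    · rw [vecMul_transU_inl]
    · rw [vecMul_transU_inr]
      simp
  vanish x hx j hj := by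
    have hjk : j ≠ k := by rintro rfl; exact lt_irrefl _ hj
    rw [vecMul_transU_inl, vecMul_transU_inr, (hx j hj).1, (hx j hj).2]
    refine ⟨rfl, ?_⟩
    rw [add_zero]
    refine Finset.sum_eq_zero fun i _ => ?_
    by_cases hi : i = k
    · simp [crossMat, hi, hs j hj]
    · simp [crossMat, hi, hjk]
  form x y := by
    have hb := crossMat_symm hd k hs
    generalize crossMat d k s = b at hb
    unfold altForm
    simp only [vecMul_transU_inl, vecMul_transU_inr]
    have h1 : ∑ j, (d j : ℤ) * (x (Sum.inl j) * ∑ i, y (Sum.inl i) * b i j) =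
        ∑ j, (d j : ℤ) * ((∑ i, x (Sum.inl i) * b i j) * y (Sum.inl j)) := by
      simp only [Finset.mul_sum, Finset.sum_mul]
      rw [Finset.sum_comm]
      refine Finset.sum_congr rfl fun i _ => Finset.sum_congr rfl fun j _ => ?_
      linear_combination (x (Sum.inl j) * y (Sum.inl i)) * hb i j
    rw [← sub_eq_zero, ← Finset.sum_sub_distrib]
    rw [← sub_eq_zero, ← Finset.sum_sub_distrib] at h1
    rw [← h1]
    exact Finset.sum_congr rfl fun j _ => by ring

/-- Bézout coefficients fill the first column and `(-q, p)` divided by the gcd the second. The zero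
pair must give the identity, so that planes already treated are not touched. -/
lemma exists_sl2_row (p q : ℤ) :
    ∃ A : SL(2, ℤ), p * A 0 1 + q * A 1 1 = 0 ∧ (p = 0 → q = 0 → A = 1) := by
  by_cases h : p = 0 ∧ q = 0
  · exact ⟨1, by simp [h.1, h.2], fun _ _ => rfl⟩
  · have hg : (Int.gcd p q : ℤ) ≠ 0 := by
      rw [Ne, Int.natCast_eq_zero, Int.gcd_eq_zero_iff]; exact h
    obtain ⟨p', hp'⟩ := Int.gcd_dvd_left p q
    obtain ⟨q', hq'⟩ := Int.gcd_dvd_right p q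
    have hb := Int.gcd_eq_gcd_ab p q
    refine ⟨⟨!![Int.gcdA p q, -q'; Int.gcdB p q, p'], ?_⟩, ?_, fun h1 h2 => absurd ⟨h1, h2⟩ h⟩
    · rw [Matrix.det_fin_two_of]
      apply mul_left_cancel₀ hg
      linear_combination (-1 : ℤ) * hb - Int.gcdA p q * hp' - Int.gcdB p q * hq'
    · simp only [of_apply, cons_val', cons_val_one, cons_val_zero,
        cons_val_fin_one]
      linear_combination p' * hq' - q' * hp'

lemma altForm_single_inr (x : Fin g ⊕ Fin g → ℤ) (k : Fin g) :
    altForm d x (Pi.single (Sum.inr k) 1) = d k * x (Sum.inl k) := by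
  rw [altForm, Finset.sum_eq_single k (fun j _ hj => by simp [hj]) (by simp)]
  simp

lemma altForm_single_inl (x : Fin g ⊕ Fin g → ℤ) (k : Fin g) :
    altForm d x (Pi.single (Sum.inl k) 1) = -(d k * x (Sum.inr k)) := by
  rw [altForm, Finset.sum_eq_single k (fun j _ hj => by simp [hj]) (by simp)]
  simp

lemma single_inl_altForm (x : Fin g ⊕ Fin g → ℤ) (k : Fin g) :
    altForm d (Pi.single (Sum.inl k) 1) x = d k * x (Sum.inr k) := by
  rw [altForm, Finset.sum_eq_single k (fun j _ hj => by simp [hj]) (by simp)]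
  simp

/-- The simultaneous inversion in the planes from `k` on. -/
def tailInv (k : Fin g) : Fin g → SL(2, ℤ) := fun j => if j < k then 1 else ModularGroup.S

lemma admissible_tailInv (k : Fin g) : Admissible d k (blockU (tailInv k)) :=
  admissible_blockU fun j hj => by simp [tailInv, show j < k from hj]

lemma admissible_tailInv_inv (k : Fin g) : Admissible d k (blockU (tailInv k)⁻¹) :=
  admissible_blockU fun j hj => by simp [tailInv, show j < k from hj]

lemma vecMul_tailInv {k : Fin g} {x : Fin g ⊕ Fin g → ℤ} (hx : VanishBelow k x) (j : Fin g) :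
    (x ᵥ* (blockU (tailInv k)).val) (Sum.inl j) = x (Sum.inr j) ∧
      (x ᵥ* (blockU (tailInv k)).val) (Sum.inr j) = -x (Sum.inl j) := by
  rw [vecMul_blockU_inl, vecMul_blockU_inr]
  by_cases h : j < k
  · simp [(hx j h).1, (hx j h).2]
  · simp [tailInv, h, ModularGroup.S]

lemma vecMul_tailInv_inv {k : Fin g} {x : Fin g ⊕ Fin g → ℤ} (hx : VanishBelow k x) (j : Fin g) :
    (x ᵥ* (blockU (tailInv k)⁻¹).val) (Sum.inl j) = -x (Sum.inr j) ∧
      (x ᵥ* (blockU (tailInv k)⁻¹).val) (Sum.inr j) = x (Sum.inl j) := by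
  rw [vecMul_blockU_inl, vecMul_blockU_inr]
  by_cases h : j < k
  · simp [(hx j h).1, (hx j h).2]
  · rw [Pi.inv_apply, tailInv, if_neg h, SpecialLinearGroup.SL2_inv_expl]
    simp [ModularGroup.S]

lemma exists_admissible_inr_eq_zero {k : Fin g} {x : Fin g ⊕ Fin g → ℤ} (hx : VanishBelow k x) :
    ∃ G, Admissible d k G ∧ ∀ j, (x ᵥ* G.val) (Sum.inr j) = 0 := by
  choose A hA hA1 using fun j => exists_sl2_row (x (Sum.inl j)) (x (Sum.inr j))
  refine ⟨blockU A, admissible_blockU fun j hj => hA1 j (hx j hj).1 (hx j hj).2, fun j => ?_⟩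
  rw [vecMul_blockU_inr, hA]

lemma vecMul_crossMat_inr_self (d : Fin g → ℕ) (k : Fin g) (s : Fin g → ℤ)
    (x : Fin g ⊕ Fin g → ℤ) (hx : ∀ i, x (Sum.inl i) = if i = k then 1 else 0) (j : Fin g) :
    (x ᵥ* (transU (crossMat d k s)).val) (Sum.inr j) = s j + x (Sum.inr j) := by
  rw [vecMul_transU_inr, Finset.sum_eq_single k (fun i _ hi => by simp [hx, hi]) (by simp)]
  simp [hx, crossMat]

/-- A vector that is part of a hyperbolic pair can be moved to `e_k`. -/
lemma exists_admissible_vecMul_eq_single (hd : IsPolarizationType d) {k : Fin g}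
    {x y : Fin g ⊕ Fin g → ℤ} (hx : VanishBelow k x) (hy : VanishBelow k y)
    (hxy : altForm d x y = d k) :
    ∃ G, Admissible d k G ∧ x ᵥ* G.val = Pi.single (Sum.inl k) 1 := by
  have hdk : (d k : ℤ) ≠ 0 := by exact_mod_cast (hd.1 k).ne'
  obtain ⟨G₁, hG₁, h₁⟩ := exists_admissible_inr_eq_zero (d := d) hx
  set x₁ := x ᵥ* G₁.val
  set y₁ := y ᵥ* G₁.val
  have hx₁ : VanishBelow k x₁ := hG₁.vanish _ hx
  have hy₁ : VanishBelow k y₁ := hG₁.vanish _ hy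
  have hxy₁ : altForm d x₁ y₁ = d k := by rw [hG₁.form, hxy]
  -- The `k`-th column of this matrix is `(d_j / d_k) y_j`. Once the second half of `x₁` is zero,
  -- the new `k`-th coordinate is the pairing of `x₁` and `y₁` divided by `d_k`, that is `1`.
  have hG₂ : Admissible d k (transU (crossMat d k fun j => y₁ (Sum.inr j))) :=
    admissible_crossMat hd k fun j hj => (hy₁ j hj).2
  set G₂ := transU (crossMat d k fun j => y₁ (Sum.inr j))
  set x₂ := x₁ ᵥ* G₂.val with hx₂def
  have hx₂ : VanishBelow k x₂ := hG₂.vanish _ hx₁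
  have h₂ : x₂ (Sum.inr k) = 1 := by
    apply mul_left_cancel₀ hdk
    refine Eq.trans ?_ (hxy₁.trans (mul_one _).symm)
    rw [hx₂def, vecMul_transU_inr, h₁, add_zero, Finset.mul_sum, altForm]
    refine Finset.sum_congr rfl fun j _ => ?_
    rw [h₁]
    by_cases hjk : j = k
    · subst hjk; simp [crossMat]
    · rcases lt_or_ge j k with h | h
      · simp [(hx₁ j h).1]
      · have e : ((d j / d k : ℕ) : ℤ) * d k = d j := by
          exact_mod_cast Nat.div_mul_cancel (hd.2 k j h)
        rw [crossMat, if_neg hjk, if_pos rfl, ← e]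
        ring
  -- In the other planes the second coordinate is cleared; in the plane `k` the entry `1` found
  -- above is kept and used to clear the first coordinate.
  choose A hA hA1 using fun j => exists_sl2_row (x₂ (Sum.inl j)) (x₂ (Sum.inr j))
  set B : SL(2, ℤ) := ⟨!![1, 0; -x₂ (Sum.inl k), 1], by simp⟩ with hB
  have hG₃ : Admissible d k (blockU (Function.update A k B)) := admissible_blockU fun j hj => by
    have hjk : j ≠ k := by rintro rfl; exact lt_irrefl _ hj
    rw [Function.update_of_ne hjk, hA1 j (hx₂ j hj).1 (hx₂ j hj).2]
  set G₃ := blockU (Function.update A k B)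
  set x₃ := x₂ ᵥ* G₃.val with hx₃def
  have hx₃ : VanishBelow k x₃ := hG₃.vanish _ hx₂
  have h₃ : ∀ j, x₃ (Sum.inr j) = if j = k then 1 else 0 := fun j => by
    rw [hx₃def, vecMul_blockU_inr]
    by_cases hjk : j = k
    · subst hjk
      rw [Function.update_self, h₂]
      simp [hB]
    · rw [Function.update_of_ne hjk, hA, if_neg hjk]
  set x₄ := x₃ ᵥ* (blockU (tailInv k)).val
  have h₄ : ∀ j, x₄ (Sum.inl j) = x₃ (Sum.inr j) ∧ x₄ (Sum.inr j) = -x₃ (Sum.inl j) :=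
    fun j => vecMul_tailInv hx₃ j
  -- After the tail inversion the first half is `e_k`, so this unipotent adds exactly its `k`-th row
  -- and cancels the second half.
  have hG₅ : Admissible d k (transU (crossMat d k fun j => x₃ (Sum.inl j))) :=
    admissible_crossMat hd k fun j hj => (hx₃ j hj).1
  refine ⟨G₁ * G₂ * G₃ * blockU (tailInv k) * transU (crossMat d k fun j => x₃ (Sum.inl j)),
    (((hG₁.mul hG₂).mul hG₃).mul (admissible_tailInv k)).mul hG₅, ?_⟩
  simp only [Units.val_mul, ← vecMul_vecMul]
  change x₄ ᵥ* _ = _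
  have h₄' : ∀ i, x₄ (Sum.inl i) = if i = k then 1 else 0 := fun i => by
    rw [(h₄ i).1, h₃]
  ext (j | j)
  · rw [vecMul_transU_inl, h₄']
    simp [Pi.single_apply]
  · rw [vecMul_crossMat_inr_self _ _ _ _ h₄', (h₄ j).2]
    simp

lemma exists_admissible_vecMul_eq_pair (hd : IsPolarizationType d) {k : Fin g}
    {x y : Fin g ⊕ Fin g → ℤ} (hx : VanishBelow k x) (hy : VanishBelow k y)
    (hxy : altForm d x y = d k) :
    ∃ G, Admissible d k G ∧ x ᵥ* G.val = Pi.single (Sum.inl k) 1 ∧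
      y ᵥ* G.val = Pi.single (Sum.inr k) 1 := by
  have hdk : (d k : ℤ) ≠ 0 := by exact_mod_cast (hd.1 k).ne'
  obtain ⟨G₁, hG₁, hx₁⟩ := exists_admissible_vecMul_eq_single hd hx hy hxy
  set y₁ := y ᵥ* G₁.val
  have hy₁ : VanishBelow k y₁ := hG₁.vanish _ hy
  -- Pairing with `e_k` reads off this coordinate, and the pairing is preserved.
  have h₁ : y₁ (Sum.inr k) = 1 := by
    have := hG₁.form x y
    rw [hx₁, single_inl_altForm, hxy] at this
    exact mul_left_cancel₀ hdk (by rw [this, mul_one])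
  choose A hA hA1 using fun j => exists_sl2_row (y₁ (Sum.inl j)) (y₁ (Sum.inr j))
  have hG₂ : Admissible d k (blockU (Function.update A k 1)) := admissible_blockU fun j hj => by
    have hjk : j ≠ k := by rintro rfl; exact lt_irrefl _ hj
    rw [Function.update_of_ne hjk, hA1 j (hy₁ j hj).1 (hy₁ j hj).2]
  set G₂ := blockU (Function.update A k 1)
  set y₂ := y₁ ᵥ* G₂.val with hy₂def
  have hy₂ : VanishBelow k y₂ := hG₂.vanish _ hy₁
  have h₂ : ∀ j, y₂ (Sum.inr j) = if j = k then 1 else 0 := fun j => by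
    rw [hy₂def, vecMul_blockU_inr]
    by_cases hjk : j = k
    · subst hjk; simp [h₁]
    · rw [Function.update_of_ne hjk, hA, if_neg hjk]
  have hx₂ : (Pi.single (Sum.inl k) 1 : Fin g ⊕ Fin g → ℤ) ᵥ* G₂.val = Pi.single (Sum.inl k) 1 := by
    ext (j | j)
    · rw [vecMul_blockU_inl]
      by_cases hjk : j = k
      · subst hjk; simp
      · simp [hjk]
    · rw [vecMul_blockU_inr]
      by_cases hjk : j = k
      · subst hjk; simp
      · simp [hjk]
  have hek : VanishBelow k (Pi.single (Sum.inl k) 1 : Fin g ⊕ Fin g → ℤ) := fun j hj => by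
    have hjk : j ≠ k := by rintro rfl; exact lt_irrefl _ hj
    simp [hjk]
  -- Conjugated by the tail inversion, this becomes a lower unipotent. It clears the first half of
  -- `y₂` and fixes `e_k`, because the inversion moves `e_k` to a vector with zero first half.
  have hG₄ : Admissible d k (transU (crossMat d k fun j => y₂ (Sum.inl j))) :=
    admissible_crossMat hd k fun j hj => (hy₂ j hj).1
  set G₄ := transU (crossMat d k fun j => y₂ (Sum.inl j))
  have hT := admissible_tailInv (d := d) k
  refine ⟨G₁ * G₂ * blockU (tailInv k) * G₄ * blockU (tailInv k)⁻¹,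
    (((hG₁.mul hG₂).mul hT).mul hG₄).mul (admissible_tailInv_inv k), ?_, ?_⟩
  · simp only [Units.val_mul, ← vecMul_vecMul]
    rw [hx₁, hx₂]
    have hv := hG₄.vanish _ (hT.vanish _ hek)
    have hz : ∀ i, ((Pi.single (Sum.inl k) 1 : Fin g ⊕ Fin g → ℤ) ᵥ*
        (blockU (tailInv k)).val) (Sum.inl i) = 0 := fun i => by
      rw [(vecMul_tailInv hek i).1]; simp
    ext (j | j)
    · rw [(vecMul_tailInv_inv hv j).1, vecMul_transU_inr, (vecMul_tailInv hek j).2,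
        Finset.sum_eq_zero fun i _ => by rw [hz, zero_mul]]
      simp [Pi.single_apply]
    · rw [(vecMul_tailInv_inv hv j).2, vecMul_transU_inl, hz]
      simp
  · simp only [Units.val_mul, ← vecMul_vecMul]
    change (((y₂ ᵥ* _) ᵥ* _) ᵥ* _) = _
    have hv := hG₄.vanish _ (hT.vanish _ hy₂)
    have hz : ∀ i, (y₂ ᵥ* (blockU (tailInv k)).val) (Sum.inl i) = if i = k then 1 else 0 :=
      fun i => by rw [(vecMul_tailInv hy₂ i).1, h₂]
    ext (j | j)
    · rw [(vecMul_tailInv_inv hv j).1, vecMul_crossMat_inr_self _ _ _ _ hz, (vecMul_tailInv hy₂ j).2]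
      simp
    · rw [(vecMul_tailInv_inv hv j).2, vecMul_transU_inl, hz]
      simp [Pi.single_apply]

lemma Admissible.zero {k : ℕ} {G : (Matrix (Fin g ⊕ Fin g) (Fin g ⊕ Fin g) ℤ)ˣ}
    (h : Admissible d k G) : Admissible d 0 G where
  mem := h.mem
  fix_inl _ hj := absurd hj (Nat.not_lt_zero _)
  fix_inr _ hj := absurd hj (Nat.not_lt_zero _)
  vanish _ _ _ hj := absurd hj (Nat.not_lt_zero _)
  form := h.form

lemma altForm_row (R : Matrix (Fin g ⊕ Fin g) (Fin g ⊕ Fin g) ℤ) (a b : Fin g ⊕ Fin g) :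
    (R * fromBlocks 0 (diagonal fun i => (d i : ℤ)) (-diagonal fun i => (d i : ℤ)) 0 * Rᵀ) a b =
      altForm d (R a) (R b) := by
  simp only [Matrix.mul_apply, transpose_apply, Fintype.sum_sum_type, altForm]
  simp only [fromBlocks_apply₁₁, fromBlocks_apply₁₂, fromBlocks_apply₂₁, fromBlocks_apply₂₂,
    Matrix.zero_apply, mul_zero, Finset.sum_const_zero, zero_add, add_zero, Matrix.neg_apply,
    diagonal_apply, mul_neg, mul_ite, Finset.sum_neg_distrib, Finset.sum_ite_eq', Finset.mem_univ,
    if_true]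
  rw [← Finset.sum_add_distrib]
  exact Finset.sum_congr rfl fun j _ => by ring

/-- `Γ_D` is generated by the unipotent matrices it contains and the partial inversions. -/
theorem exists_mem_genGroup (hd : IsPolarizationType d)
    {R : Matrix (Fin g ⊕ Fin g) (Fin g ⊕ Fin g) ℤ} (hR : R ∈ GammaD d) :
    ∃ G ∈ genGroup d, G.val = R := by
  have hd0 : ∀ k, (d k : ℤ) ≠ 0 := fun k => by exact_mod_cast (hd.1 k).ne'
  have hform : ∀ a b, altForm d (R a) (R b) = fromBlocks 0 (diagonal fun i => (d i : ℤ))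
      (-diagonal fun i => (d i : ℤ)) 0 a b := fun a b => by
    rw [← altForm_row, show _ = _ from hR]
  have key : ∀ k : ℕ, k ≤ g → ∃ G, Admissible d 0 G ∧ ∀ j : Fin g, (j : ℕ) < k →
      R (Sum.inl j) ᵥ* G.val = Pi.single (Sum.inl j) 1 ∧
      R (Sum.inr j) ᵥ* G.val = Pi.single (Sum.inr j) 1 := by
    intro k
    induction k with
    | zero =>
      refine fun _ => ⟨1, ?_, fun j hj => absurd hj (Nat.not_lt_zero _)⟩
      have := admissible_blockU (d := d) (k := 0) (A := 1) fun _ _ => rfl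
      rwa [map_one] at this
    | succ k ih =>
      intro hk
      obtain ⟨G, hG, hGj⟩ := ih (Nat.le_of_succ_le hk)
      set κ : Fin g := ⟨k, hk⟩
      -- A row orthogonal to the pairs already normalised has no component in their planes, as the
      -- reduction preserves the form.
      have hvan : ∀ a, (∀ j : Fin g, (j : ℕ) < k → altForm d (R a) (R (Sum.inl j)) = 0 ∧
          altForm d (R a) (R (Sum.inr j)) = 0) → VanishBelow κ (R a ᵥ* G.val) := by
        intro a ha j hj
        obtain ⟨h1, h2⟩ := ha j hj
        rw [← hG.form, (hGj j hj).1, altForm_single_inl, neg_eq_zero] at h1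
        rw [← hG.form, (hGj j hj).2, altForm_single_inr] at h2
        exact ⟨(mul_eq_zero.1 h2).resolve_left (hd0 j), (mul_eq_zero.1 h1).resolve_left (hd0 j)⟩
      have hne : ∀ j : Fin g, (j : ℕ) < k → κ ≠ j := by
        rintro j hj rfl; exact lt_irrefl _ hj
      obtain ⟨G', hG', h1, h2⟩ := exists_admissible_vecMul_eq_pair hd
        (hvan (Sum.inl κ) fun j hj => by simp [hform, hne j hj])
        (hvan (Sum.inr κ) fun j hj => by simp [hform, hne j hj])
        (by rw [hG.form, hform]; simp)
      refine ⟨G * G', hG.mul hG'.zero, fun j hj => ?_⟩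
      simp only [Units.val_mul, ← vecMul_vecMul]
      rcases Nat.lt_succ_iff_lt_or_eq.1 hj with hj | hj
      · rw [(hGj j hj).1, (hGj j hj).2]
        exact ⟨hG'.fix_inl j hj, hG'.fix_inr j hj⟩
      · have : j = κ := Fin.ext hj
        subst this
        exact ⟨h1, h2⟩
  obtain ⟨G, hG, hGj⟩ := key g le_rfl
  refine ⟨G⁻¹, inv_mem hG.mem, ?_⟩
  have h1 : R * G.val = 1 := by
    ext1 a
    have : (R * G.val) a = R a ᵥ* G.val := rfl
    rw [this]
    rcases a with j | j
    · rw [(hGj j j.2).1]; intro b; simp [Matrix.one_apply, Pi.single_apply, eq_comm]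
    · rw [(hGj j j.2).2]; intro b; simp [Matrix.one_apply, Pi.single_apply, eq_comm]
  calc (G⁻¹).val = R * G.val * (G⁻¹).val := by rw [h1, one_mul]
    _ = R := by rw [mul_assoc, Units.mul_inv, mul_one]

end Generators

/-! ### Semicharacters, and stability of the transformation formula under products. -/

section Good

variable {g : ℕ} {d : Fin g → ℕ}

/-- The matrix of `G_D` that corresponds to a matrix of `Γ_D`. -/
def toRat (d : Fin g → ℕ) (R : Matrix (Fin g ⊕ Fin g) (Fin g ⊕ Fin g) ℤ) :
    Matrix (Fin g ⊕ Fin g) (Fin g ⊕ Fin g) ℚ :=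
  (fromBlocks 1 0 0 (diagonal fun i => (d i : ℚ)))⁻¹ * R.map (Int.cast : ℤ → ℚ) *
    fromBlocks 1 0 0 (diagonal fun i => (d i : ℚ))

lemma toRat_eq (hd : ∀ i, 0 < d i) (R : Matrix (Fin g ⊕ Fin g) (Fin g ⊕ Fin g) ℤ) :
    toRat d R = fromBlocks (of fun i j => (R (Sum.inl i) (Sum.inl j) : ℚ))
      (of fun i j => (R (Sum.inl i) (Sum.inr j) : ℚ) * d j)
      (of fun i j => (d i : ℚ)⁻¹ * R (Sum.inr i) (Sum.inl j))
      (of fun i j => (d i : ℚ)⁻¹ * R (Sum.inr i) (Sum.inr j) * d j) := by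
  have hd' : ∀ i, (d i : ℚ) ≠ 0 := fun i => by exact_mod_cast (hd i).ne'
  have hinv : (fromBlocks 1 0 0 (diagonal fun i => (d i : ℚ)) :
      Matrix (Fin g ⊕ Fin g) (Fin g ⊕ Fin g) ℚ)⁻¹ =
      fromBlocks 1 0 0 (diagonal fun i => (d i : ℚ)⁻¹) := by
    apply Matrix.inv_eq_right_inv
    rw [fromBlocks_multiply]
    simp [diagonal_mul_diagonal, hd']
  rw [toRat, hinv]
  conv_lhs => rw [← fromBlocks_toBlocks R, fromBlocks_map, fromBlocks_multiply, fromBlocks_multiply]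
  congr 1 <;> ext i j <;> simp [toBlocks₁₁, toBlocks₁₂, toBlocks₂₁, toBlocks₂₂]

lemma toRat_mul (hd : ∀ i, 0 < d i) (R R' : Matrix (Fin g ⊕ Fin g) (Fin g ⊕ Fin g) ℤ) :
    toRat d (R * R') = toRat d R * toRat d R' := by
  have hd' : ∀ i, (d i : ℚ) ≠ 0 := fun i => by exact_mod_cast (hd i).ne'
  set F : Matrix (Fin g ⊕ Fin g) (Fin g ⊕ Fin g) ℚ :=
    fromBlocks 1 0 0 (diagonal fun i => (d i : ℚ)) with hF
  have hdet : IsUnit F.det := by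
    rw [hF, det_fromBlocks_zero₂₁, det_one, det_diagonal, one_mul, isUnit_iff_ne_zero,
      Finset.prod_ne_zero_iff]
    exact fun i _ => hd' i
  have hm : (R * R').map (Int.cast : ℤ → ℚ) =
      R.map (Int.cast : ℤ → ℚ) * R'.map (Int.cast : ℤ → ℚ) := by
    ext i j; simp [Matrix.mul_apply]
  rw [toRat, toRat, toRat, hm, ← hF]
  calc _ = F⁻¹ * R.map (Int.cast : ℤ → ℚ) * 1 * R'.map (Int.cast : ℤ → ℚ) * F := by noncomm_ring
    _ = F⁻¹ * R.map (Int.cast : ℤ → ℚ) * (F * F⁻¹) * R'.map (Int.cast : ℤ → ℚ) * F := by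
      rw [mul_nonsing_inv _ hdet]
    _ = _ := by noncomm_ring

/-- The logarithm of the semicharacter of characteristic `(c₁, c₂)` on `Λ_Z`, divided by `π i`,
in the coordinates of the symplectic basis. -/
def charForm (d : Fin g → ℕ) (c₁ c₂ : Fin g → ℝ) (x : Fin g ⊕ Fin g → ℤ) : ℝ :=
  ∑ i, ((d i : ℝ) * x (Sum.inl i) * x (Sum.inr i) +
    2 * (c₁ i * d i * x (Sum.inr i) - c₂ i * x (Sum.inl i)))

/-- The semicharacters of characteristics `c` and `e` correspond to each other under `R`. -/
def Compatible (d : Fin g → ℕ) (R : Matrix (Fin g ⊕ Fin g) (Fin g ⊕ Fin g) ℤ)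
    (c₁ c₂ e₁ e₂ : Fin g → ℝ) : Prop :=
  ∀ x : Fin g ⊕ Fin g → ℤ, ∃ t : ℤ, charForm d c₁ c₂ (x ᵥ* R) = charForm d e₁ e₂ x + 2 * t

lemma Compatible.comp {R R' : Matrix (Fin g ⊕ Fin g) (Fin g ⊕ Fin g) ℤ}
    {c₁ c₂ e₁ e₂ f₁ f₂ : Fin g → ℝ} (h : Compatible d R c₁ c₂ e₁ e₂)
    (h' : Compatible d R' e₁ e₂ f₁ f₂) : Compatible d (R' * R) c₁ c₂ f₁ f₂ := fun x => by
  obtain ⟨t', ht'⟩ := h' x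
  obtain ⟨t, ht⟩ := h (x ᵥ* R')
  refine ⟨t' + t, ?_⟩
  rw [← vecMul_vecMul, ht, ht']
  push_cast; ring

lemma charForm_add (c₁ c₂ l₁ l₂ : Fin g → ℝ) (x : Fin g ⊕ Fin g → ℤ) :
    charForm d (c₁ + l₁) (c₂ + l₂) x = charForm d c₁ c₂ x +
      2 * ∑ i, (l₁ i * d i * x (Sum.inr i) - l₂ i * x (Sum.inl i)) := by
  rw [charForm, charForm, Finset.mul_sum, ← Finset.sum_add_distrib]
  refine Finset.sum_congr rfl fun i _ => ?_
  simp only [Pi.add_apply]; ring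

lemma vecMul_sum_apply (R : Matrix (Fin g ⊕ Fin g) (Fin g ⊕ Fin g) ℤ) (x : Fin g ⊕ Fin g → ℤ)
    (j : Fin g ⊕ Fin g) : (x ᵥ* R) j = ∑ i, (x (Sum.inl i) * R (Sum.inl i) j +
      x (Sum.inr i) * R (Sum.inr i) j) := by
  rw [vecMul, dotProduct, Fintype.sum_sum_type, Finset.sum_add_distrib]

lemma lin₁_toRat (hd : ∀ i, 0 < d i) (R : Matrix (Fin g ⊕ Fin g) (Fin g ⊕ Fin g) ℤ)
    (c₁ c₂ : Fin g → ℝ) (i : Fin g) : lin₁ (toRat d R) c₁ c₂ i * d i =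
      ∑ j, (R (Sum.inr i) (Sum.inr j) * d j * c₁ j - R (Sum.inr i) (Sum.inl j) * c₂ j) := by
  have hd' : (d i : ℝ) ≠ 0 := by exact_mod_cast (hd i).ne'
  rw [lin₁, toRat_eq hd]
  simp only [toBlocks_fromBlocks₂₂, toBlocks_fromBlocks₂₁, Pi.sub_apply, mulVec, dotProduct,
    map_apply, of_apply, ← Finset.sum_sub_distrib, Finset.sum_mul]
  refine Finset.sum_congr rfl fun j _ => ?_
  push_cast
  field_simp

lemma lin₂_toRat (hd : ∀ i, 0 < d i) (R : Matrix (Fin g ⊕ Fin g) (Fin g ⊕ Fin g) ℤ)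
    (c₁ c₂ : Fin g → ℝ) (i : Fin g) : lin₂ (toRat d R) c₁ c₂ i =
      ∑ j, (R (Sum.inl i) (Sum.inl j) * c₂ j - R (Sum.inl i) (Sum.inr j) * d j * c₁ j) := by
  rw [lin₂, toRat_eq hd]
  simp only [toBlocks_fromBlocks₁₁, toBlocks_fromBlocks₁₂, Pi.add_apply, Pi.neg_apply, mulVec,
    dotProduct, map_apply, of_apply, ← Finset.sum_neg_distrib, ← Finset.sum_add_distrib]
  refine Finset.sum_congr rfl fun j _ => ?_
  push_cast
  ring

lemma linearForm_vecMul (hd : ∀ i, 0 < d i) (R : Matrix (Fin g ⊕ Fin g) (Fin g ⊕ Fin g) ℤ)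
    (c₁ c₂ : Fin g → ℝ) (x : Fin g ⊕ Fin g → ℤ) :
    ∑ i, (c₁ i * d i * ((x ᵥ* R) (Sum.inr i) : ℤ) - c₂ i * ((x ᵥ* R) (Sum.inl i) : ℤ)) =
      ∑ i, (lin₁ (toRat d R) c₁ c₂ i * d i * x (Sum.inr i) -
        lin₂ (toRat d R) c₁ c₂ i * x (Sum.inl i)) := by
  simp only [lin₁_toRat hd, lin₂_toRat hd, vecMul_sum_apply]
  push_cast
  simp only [Finset.mul_sum, Finset.sum_mul, ← Finset.sum_sub_distrib]
  rw [Finset.sum_comm]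
  refine Finset.sum_congr rfl fun i _ => Finset.sum_congr rfl fun j _ => ?_
  ring

lemma Compatible.shift (hd : ∀ i, 0 < d i) {R : Matrix (Fin g ⊕ Fin g) (Fin g ⊕ Fin g) ℤ}
    {e₁ e₂ : Fin g → ℝ} (h : Compatible d R 0 0 e₁ e₂) (c₁ c₂ : Fin g → ℝ) :
    Compatible d R c₁ c₂ (e₁ + lin₁ (toRat d R) c₁ c₂) (e₂ + lin₂ (toRat d R) c₁ c₂) := fun x => by
  obtain ⟨t, ht⟩ := h x
  refine ⟨t, ?_⟩
  have := charForm_add (d := d) 0 0 c₁ c₂ (x ᵥ* R)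
  rw [zero_add, zero_add] at this
  rw [this, charForm_add, ht, linearForm_vecMul hd]
  ring

lemma charForm_single_inl (c₁ c₂ : Fin g → ℝ) (i : Fin g) :
    charForm d c₁ c₂ (Pi.single (Sum.inl i) 1) = -(2 * c₂ i) := by
  rw [charForm, Finset.sum_eq_single i (fun j _ hj => by simp [hj]) (by simp)]
  simp

lemma charForm_single_inr (c₁ c₂ : Fin g → ℝ) (i : Fin g) :
    charForm d c₁ c₂ (Pi.single (Sum.inr i) 1) = 2 * d i * c₁ i := by
  rw [charForm, Finset.sum_eq_single i (fun j _ hj => by simp [hj]) (by simp)]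
  simp; ring

lemma IsHalf.charForm_int {c₁ c₂ : Fin g → ℝ} (h : IsHalf d c₁ c₂) (x : Fin g ⊕ Fin g → ℤ) :
    ∃ t : ℤ, charForm d c₁ c₂ x = t := by
  choose k hk using fun i => (h i).1
  choose l hl using fun i => (h i).2
  refine ⟨∑ i, (d i * x (Sum.inl i) * x (Sum.inr i) + (k i * x (Sum.inr i) - l i * x (Sum.inl i))),
    ?_⟩
  rw [charForm]
  push_cast
  refine Finset.sum_congr rfl fun i _ => ?_
  rw [← hk, ← hl]; ring

/-- Half-integrality says that the semicharacter form takes integral values. The basis vectors read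
off the target characteristic, and the correction `2t` is integral. -/
lemma Compatible.isHalf {R : Matrix (Fin g ⊕ Fin g) (Fin g ⊕ Fin g) ℤ} {c₁ c₂ e₁ e₂ : Fin g → ℝ}
    (h : Compatible d R c₁ c₂ e₁ e₂) (hc : IsHalf d c₁ c₂) : IsHalf d e₁ e₂ := fun i => by
  constructor
  · obtain ⟨t, ht⟩ := h (Pi.single (Sum.inr i) 1)
    obtain ⟨k, hk⟩ := hc.charForm_int (Pi.single (Sum.inr i) 1 ᵥ* R)
    rw [charForm_single_inr, hk] at ht
    exact ⟨k - 2 * t, by push_cast; linarith⟩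
  · obtain ⟨t, ht⟩ := h (Pi.single (Sum.inl i) 1)
    obtain ⟨k, hk⟩ := hc.charForm_int (Pi.single (Sum.inl i) 1 ᵥ* R)
    rw [charForm_single_inl, hk] at ht
    exact ⟨2 * t - k, by push_cast; linarith⟩

/-- The values on the basis are known modulo 2 and equal twice the coordinates, up to sign and
`d_i`. A compatible target is therefore determined modulo `Λ(H_Z)`. -/
lemma Compatible.sub_mem {R : Matrix (Fin g ⊕ Fin g) (Fin g ⊕ Fin g) ℤ}
    {c₁ c₂ e₁ e₂ f₁ f₂ : Fin g → ℝ} (h : Compatible d R c₁ c₂ e₁ e₂)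
    (h' : Compatible d R c₁ c₂ f₁ f₂) :
    (∀ i, ∃ P : ℤ, d i * (f₁ - e₁) i = P) ∧ ∀ i, ∃ Q : ℤ, (f₂ - e₂) i = Q := by
  constructor <;> intro i
  · obtain ⟨t, ht⟩ := h (Pi.single (Sum.inr i) 1)
    obtain ⟨t', ht'⟩ := h' (Pi.single (Sum.inr i) 1)
    rw [charForm_single_inr] at ht ht'
    exact ⟨t - t', by simp only [Pi.sub_apply]; push_cast; linarith⟩
  · obtain ⟨t, ht⟩ := h (Pi.single (Sum.inl i) 1)
    obtain ⟨t', ht'⟩ := h' (Pi.single (Sum.inl i) 1)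
    rw [charForm_single_inl] at ht ht'
    exact ⟨t' - t, by simp only [Pi.sub_apply]; push_cast; linarith⟩

lemma IsHalf.sub {c₁ c₂ e₁ e₂ : Fin g → ℝ} (h : IsHalf d (e₁ + c₁) (e₂ + c₂))
    (h' : IsHalf d e₁ e₂) : IsHalf d c₁ c₂ := fun i => by
  obtain ⟨⟨k, hk⟩, l, hl⟩ := h i
  obtain ⟨⟨k', hk'⟩, l', hl'⟩ := h' i
  simp only [Pi.add_apply] at hk hl
  exact ⟨⟨k - k', by push_cast; linarith⟩, l - l', by push_cast; linarith⟩

/-- A scalar enters the determinant with exponent `∏ d_i`, which clears the denominators `d_i` of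
the pairing. The two half-integral characteristics leave at most a denominator 4, and `8πi/4 = 2πi`.
-/
lemma exp_pairing_pow_card {l₁ l₂ e₁ e₂ : Fin g → ℝ} (hl : IsHalf d l₁ l₂)
    (he : IsHalf d e₁ e₂) :
    (Complex.exp (-(Real.pi * Complex.I * ((l₁ ⬝ᵥ e₂ - l₂ ⬝ᵥ e₁ : ℝ) : ℂ))) ^
      Fintype.card (∀ i, Fin (d i))) ^ 8 = 1 := by
  choose k hk using fun i => (hl i).1
  choose l hl' using fun i => (hl i).2
  choose k' hk' using fun i => (he i).1
  choose l' hl'' using fun i => (he i).2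
  rw [← pow_mul, ← Complex.exp_nat_mul, card_box]
  have h : ((∏ i, d i : ℕ) : ℝ) * 4 * (l₁ ⬝ᵥ e₂ - l₂ ⬝ᵥ e₁) =
      ((∑ i, (∏ j ∈ Finset.univ.erase i, (d j : ℤ)) * (k i * l' i - l i * k' i) : ℤ) : ℝ) := by
    simp only [dotProduct, ← Finset.sum_sub_distrib, Finset.mul_sum]
    push_cast
    refine Finset.sum_congr rfl fun i _ => ?_
    rw [← Finset.mul_prod_erase _ _ (Finset.mem_univ i), ← hk, ← hl', ← hk', ← hl'']
    ring
  set t : ℤ := ∑ i, (∏ j ∈ Finset.univ.erase i, (d j : ℤ)) * (k i * l' i - l i * k' i)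
  have h' : ((∏ i, d i : ℕ) : ℂ) * 4 * ((l₁ ⬝ᵥ e₂ - l₂ ⬝ᵥ e₁ : ℝ) : ℂ) = t := by exact_mod_cast h
  refine Eq.trans ?_ (exp_two_pi_mul_int (-t))
  congr 1
  rw [Int.cast_neg, ← h']
  push_cast
  ring

/-- The transformation formula holds for `R`, at the characteristic `0`, with a constant matrix
whose determinant is an `E`-th root of unity. -/
structure HasTransformation (d : Fin g → ℕ) (E : ℕ)
    (R : Matrix (Fin g ⊕ Fin g) (Fin g ⊕ Fin g) ℤ) : Prop where
  symplectic : toRat d R ∈ symplecticGroup (Fin g) ℚ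
  exists_transition : ∃ s, IsSqrtDetBranch (toRat d R) s ∧ ∃ e₁ e₂, Compatible d R 0 0 e₁ e₂ ∧
    ∃ CM : Matrix (∀ i, Fin (d i)) (∀ i, Fin (d i)) ℂ, CM.det ^ E = 1 ∧
      ∀ Z ∈ siegel g, Transition d (toRat d R) Z 0 0 e₁ e₂ ((s Z)⁻¹ • CM)

lemma isHalf_zero : IsHalf d 0 0 := fun _ => ⟨⟨0, by simp⟩, 0, by simp⟩

lemma pow_eq_one_of_eight_dvd {E : ℕ} (hE : 8 ∣ E) {x : ℂ} (hx : x ^ 8 = 1) : x ^ E = 1 := by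
  obtain ⟨k, rfl⟩ := hE
  rw [pow_mul, hx, one_pow]

/-- The transformation formula at every half-integral characteristic. -/
lemma HasTransformation.exists_at {E : ℕ} (hE : 8 ∣ E) (hd : ∀ i, 0 < d i)
    {R : Matrix (Fin g ⊕ Fin g) (Fin g ⊕ Fin g) ℤ} (h : HasTransformation d E R) :
    ∃ s, IsSqrtDetBranch (toRat d R) s ∧ ∀ c₁ c₂, IsHalf d c₁ c₂ → ∃ e₁ e₂,
      Compatible d R c₁ c₂ e₁ e₂ ∧ ∃ CM : Matrix (∀ i, Fin (d i)) (∀ i, Fin (d i)) ℂ,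
        CM.det ^ E = 1 ∧
        ∀ Z ∈ siegel g, Transition d (toRat d R) Z c₁ c₂ e₁ e₂ ((s Z)⁻¹ • CM) := by
  obtain ⟨s, hs, e₁, e₂, he, CM, hdet, hT⟩ := h.exists_transition
  refine ⟨s, hs, fun c₁ c₂ hc => ⟨_, _, he.shift hd c₁ c₂, Complex.exp (-(Real.pi * Complex.I *
    ((lin₁ (toRat d R) c₁ c₂ ⬝ᵥ e₂ - lin₂ (toRat d R) c₁ c₂ ⬝ᵥ e₁ : ℝ) : ℂ))) • CM, ?_,
    fun Z hZ => ?_⟩⟩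
  · have he' := he.isHalf isHalf_zero
    have hl := ((he.shift hd c₁ c₂).isHalf hc).sub he'
    rw [det_smul, mul_pow, hdet, mul_one]
    exact pow_eq_one_of_eight_dvd hE (exp_pairing_pow_card hl he')
  · have := (hT Z hZ).shift h.symplectic hZ c₁ c₂
    rwa [smul_comm] at this

/-- The first factor may end at a nonzero characteristic, so the second one is used there through
`exists_at`. The product of the two branches is a branch by the cocycle relation. -/
lemma HasTransformation.mul {E : ℕ} (hE : 8 ∣ E) (hd : ∀ i, 0 < d i)
    {R R' : Matrix (Fin g ⊕ Fin g) (Fin g ⊕ Fin g) ℤ} (h' : HasTransformation d E R')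
    (h : HasTransformation d E R) : HasTransformation d E (R' * R) := by
  refine ⟨by rw [toRat_mul hd]; exact mul_mem h'.symplectic h.symplectic, ?_⟩
  obtain ⟨s, hs, e₁, e₂, he, CM, hdet, hT⟩ := h.exists_transition
  obtain ⟨s', hs', hT'⟩ := h'.exists_at hE hd
  obtain ⟨f₁, f₂, hf, CM', hdet', hT'⟩ := hT' e₁ e₂ (he.isHalf isHalf_zero)
  have hM := h.symplectic
  refine ⟨fun Z => s' (act (toRat d R) Z) * s Z, ⟨?_, fun Z hZ => ?_⟩, f₁, f₂, he.comp hf, CM * CM',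
    by rw [det_mul, mul_pow, hdet, hdet', mul_one], fun Z hZ => ?_⟩
  · exact (hs'.1.comp (continuousOn_act hM) fun Z hZ => act_mem_siegel hM hZ).mul hs.1
  · rw [toRat_mul hd, denom_mul hM hZ, det_mul, mul_pow, hs.2 Z hZ,
      hs'.2 _ (act_mem_siegel hM hZ)]
  · have := (hT Z hZ).comp hM hZ (hT' _ (act_mem_siegel hM hZ))
    rw [← toRat_mul hd, smul_mul_smul_comm, ← mul_inv, mul_comm (s Z)] at this
    exact this

end Good

/-! ### Integral quadratic forms modulo 2. -/

section Parity

/-- Modulo two, a symmetric integral quadratic form is linear. -/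
lemma exists_quadratic_eq_linear_add_two_mul {ι : Type*} [Fintype ι] [DecidableEq ι]
    (S : ι → ι → ℤ) (hS : ∀ i j, S i j = S j i) (n : ι → ℤ) :
    ∃ t : ℤ, ∑ i, ∑ j, n i * S i j * n j = ∑ i, S i i * n i + 2 * t := by
  have h : (((∑ i, ∑ j, n i * S i j * n j) - ∑ i, S i i * n i : ℤ) : ZMod 2) = 0 := by
    push_cast
    have hsq : ∀ a : ZMod 2, a * a = a := by decide
    have h2 : ∀ a : ZMod 2, a + a = 0 := by decide
    rw [← Finset.sum_product', Finset.univ_product_univ,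
      ← Finset.sum_filter_add_sum_filter_not _ (fun p : ι × ι => p.1 = p.2)]
    -- Off the diagonal the entries cancel in pairs under the swap, by symmetry and characteristic
    -- two.
    have hoff : ∑ p : ι × ι with ¬p.1 = p.2, (n p.1 : ZMod 2) * S p.1 p.2 * n p.2 = 0 := by
      refine Finset.sum_involution (fun p _ => p.swap) ?_ ?_ ?_ ?_
      · intro p _
        simp only [Prod.fst_swap, Prod.snd_swap]
        rw [hS p.2 p.1, ← h2 ((n p.1 : ZMod 2) * S p.1 p.2 * n p.2)]
        ring
      · intro p hp _ heq
        simp only [Finset.mem_filter, Finset.mem_univ, true_and] at hp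
        exact hp (congrArg Prod.snd heq)
      · intro p hp
        simp only [Finset.mem_filter, Finset.mem_univ, true_and, Prod.fst_swap, Prod.snd_swap] at hp ⊢
        exact fun h => hp h.symm
      · intro p _; exact Prod.swap_swap p
    have hdiag : ∑ p : ι × ι with p.1 = p.2, (n p.1 : ZMod 2) * S p.1 p.2 * n p.2 =
        ∑ i, (S i i : ZMod 2) * n i := by
      rw [Finset.sum_filter, ← Finset.univ_product_univ, Finset.sum_product]
      refine Finset.sum_congr rfl fun i _ => ?_
      rw [Finset.sum_ite_eq, if_pos (Finset.mem_univ _)]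
      dsimp only
      rw [mul_comm (n i : ZMod 2), mul_assoc, hsq]
    rw [hoff, hdiag, add_zero, sub_self]
  rw [ZMod.intCast_zmod_eq_zero_iff_dvd] at h
  obtain ⟨t, ht⟩ := h
  exact ⟨t, by push_cast at ht; linarith⟩

end Parity

/-! ### Unipotent generators: diagonal transition matrices. -/

section Translation

variable {g : ℕ} {d : Fin g → ℕ}

lemma sum_range_sq_cast (n : ℕ) :
    ∑ k ∈ Finset.range n, (k : ℂ) * k = n * (n - 1) * (2 * n - 1) / 6 := by
  induction n with
  | zero => simp
  | succ n ih => rw [Finset.sum_range_succ, ih]; push_cast; ring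

/-- The exponent condition under which the determinants of the diagonal transition matrices of
translations are `E`-th roots of unity. -/
def GoodExponent (d : Fin g → ℕ) (E : ℕ) : Prop :=
  8 ∣ E ∧ ∀ i, ∃ t : ℤ, (E : ℤ) * ((∏ j ∈ Finset.univ.erase i, (d j : ℤ)) *
    ((d i - 1) * (2 * d i - 1))) = 12 * t

lemma transU_val (b : Matrix (Fin g) (Fin g) ℤ) : (transU b).val = fromBlocks 1 b 0 1 := rfl

lemma toRat_transU (hd : ∀ i, 0 < d i) (b : Matrix (Fin g) (Fin g) ℤ) :
    toRat d (transU b).val = fromBlocks 1 (of fun i j => (b i j : ℚ) * d j) 0 1 := by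
  have hd' : ∀ i, (d i : ℚ) ≠ 0 := fun i => by exact_mod_cast (hd i).ne'
  rw [toRat_eq hd, transU_val]
  congr 1
  · ext i j; rcases eq_or_ne i j with rfl | h <;> simp [*]
  · ext i j; simp
  · ext i j
    by_cases h : i = j
    · subst h; simp [hd' i]
    · simp [h]

lemma transU_mul_diagonal_sum (b : Matrix (Fin g) (Fin g) ℤ) (hd : ∀ i, 0 < d i) (i j : Fin g)
    (h : i ≠ j) : ∃ t : ℤ, (4 : ℂ) *
      ∑ n : ∀ i, Fin (d i), ((n i : ℕ) : ℂ) * ((b i j : ℂ) / d i) * ((n j : ℕ) : ℂ) = t := by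
  have hd' : (d i : ℂ) ≠ 0 := by exact_mod_cast (hd i).ne'
  refine ⟨b i j * (∏ k ∈ (Finset.univ.erase i).erase j, (d k : ℤ)) *
    ((d i - 1) * (d j * (d j - 1))), ?_⟩
  have e : ∀ n : ∀ i, Fin (d i), ((n i : ℕ) : ℂ) * ((b i j : ℂ) / d i) * ((n j : ℕ) : ℂ) =
      ((b i j : ℂ) / d i) * (((n i : ℕ) : ℂ) * ((n j : ℕ) : ℂ)) := fun n => by ring
  simp only [e]
  rw [← Finset.mul_sum, sum_box_apply_mul d h (fun k => (k : ℂ)) (fun k => (k : ℂ)),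
    sum_range_cast, sum_range_cast]
  push_cast
  field_simp
  ring

lemma sum_box_sq (b : Matrix (Fin g) (Fin g) ℤ) (hd : ∀ i, 0 < d i) (i : Fin g) :
    ∑ n : ∀ i, Fin (d i), ((n i : ℕ) : ℂ) * ((b i i : ℂ) / d i) * ((n i : ℕ) : ℂ) =
      b i i * (∏ j ∈ Finset.univ.erase i, (d j : ℂ)) * ((d i - 1) * (2 * d i - 1)) / 6 := by
  have hd' : (d i : ℂ) ≠ 0 := by exact_mod_cast (hd i).ne'
  have e : ∀ n : ∀ i, Fin (d i), ((n i : ℕ) : ℂ) * ((b i i : ℂ) / d i) * ((n i : ℕ) : ℂ) =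
      ((b i i : ℂ) / d i) * (((n i : ℕ) : ℂ) * ((n i : ℕ) : ℂ)) := fun n => by ring
  simp only [e]
  rw [← Finset.mul_sum, sum_box_apply d i (fun k => (k : ℂ) * k), sum_range_sq_cast]
  field_simp

/-- The sum over `ℤ_D` of the quadratic form `D⁻¹ b`, which controls the determinant of the
transition matrix of a translation. -/
lemma exists_half_exponent_mul_sum {E : ℕ} (hE : GoodExponent d E) (hd : ∀ i, 0 < d i)
    (b : Matrix (Fin g) (Fin g) ℤ) :
    ∃ t : ℤ, (E : ℂ) * ∑ n : ∀ i, Fin (d i),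
      ∑ i, ∑ j, ((n i : ℕ) : ℂ) * ((b i j : ℂ) / d i) * ((n j : ℕ) : ℂ) = 2 * t := by
  obtain ⟨⟨k, rfl⟩, hE⟩ := hE
  choose t ht using hE
  have h : ∀ i j, ∃ u : ℤ, ((8 * k : ℕ) : ℂ) *
      ∑ n : ∀ i, Fin (d i), ((n i : ℕ) : ℂ) * ((b i j : ℂ) / d i) * ((n j : ℕ) : ℂ) = 2 * u := by
    intro i j
    by_cases hij : i = j
    · subst hij
      refine ⟨b i i * t i, ?_⟩
      have := ht i
      have ht' : ((8 * k : ℕ) : ℂ) * ((∏ j ∈ Finset.univ.erase i, (d j : ℂ)) *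
          ((d i - 1) * (2 * d i - 1))) = 12 * t i := by exact_mod_cast this
      rw [sum_box_sq b hd i]
      push_cast at ht' ⊢
      linear_combination (b i i : ℂ) / 6 * ht'
    · obtain ⟨u, hu⟩ := transU_mul_diagonal_sum b hd i j hij
      refine ⟨k * u, ?_⟩
      push_cast
      rw [← hu]; ring
  choose u hu using h
  refine ⟨∑ i, ∑ j, u i j, ?_⟩
  rw [Finset.sum_comm]
  have e : ∀ i, ∑ n : ∀ i, Fin (d i), ∑ j, ((n i : ℕ) : ℂ) * ((b i j : ℂ) / d i) * ((n j : ℕ) : ℂ) =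
      ∑ j, ∑ n : ∀ i, Fin (d i), ((n i : ℕ) : ℂ) * ((b i j : ℂ) / d i) * ((n j : ℕ) : ℂ) :=
    fun i => Finset.sum_comm
  simp only [e, Finset.mul_sum (Finset.univ : Finset (Fin g)), hu]
  push_cast
  simp only [Finset.mul_sum]

lemma denom_transU (hd : ∀ i, 0 < d i) (b : Matrix (Fin g) (Fin g) ℤ)
    (Z : Matrix (Fin g) (Fin g) ℂ) : denom (toRat d (transU b).val) Z = 1 := by
  rw [denom, toRat_transU hd, toBlocks_fromBlocks₂₁, toBlocks_fromBlocks₂₂]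
  ext i j
  rcases eq_or_ne i j with rfl | h <;> simp [*]

lemma act_transU (hd : ∀ i, 0 < d i) (b : Matrix (Fin g) (Fin g) ℤ)
    (Z : Matrix (Fin g) (Fin g) ℂ) :
    act (toRat d (transU b).val) Z = Z + of fun i j => (b i j : ℂ) * d j := by
  rw [act, denom_transU hd, inv_one, mul_one, toRat_transU hd, toBlocks_fromBlocks₁₁,
    toBlocks_fromBlocks₁₂]
  congr 1
  · have : ((1 : Matrix (Fin g) (Fin g) ℚ).map (Rat.cast : ℚ → ℂ)) = 1 := by
      ext i j; rcases eq_or_ne i j with rfl | h <;> simp [*]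
    rw [this, one_mul]
  · ext i j; simp

/-- The translations satisfy the transformation formula. -/
theorem hasTransformation_transU {E : ℕ} (hE : GoodExponent d E) (hd : ∀ i, 0 < d i)
    {b : Matrix (Fin g) (Fin g) ℤ} (hb : ∀ i j, b i j * d j = b j i * d i) :
    HasTransformation d E (transU b).val := by
  have hd' : ∀ i, (d i : ℂ) ≠ 0 := fun i => by exact_mod_cast (hd i).ne'
  have hsymp : toRat d (transU b).val ∈ symplecticGroup (Fin g) ℚ := by
    rw [toRat_transU hd, SymplecticGroup.fromBlocks_mem_iff]
    refine ⟨by simp, ?_, by simp⟩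
    ext i j
    have : (b j i : ℚ) * d i = b i j * d j := by exact_mod_cast hb j i
    simp [this]
  -- The denominator is the identity, so the constant `1` is a branch. The half diagonal of `b D` is
  -- the characteristic that absorbs the linear form left by the parity lemma.
  refine ⟨hsymp, fun _ => 1, ⟨continuousOn_const, fun Z _ => by rw [denom_transU hd]; simp⟩,
    0, fun i => -(1 / 2 * (b i i * d i)), ?_, ?_⟩
  · intro x
    obtain ⟨t, ht⟩ := exists_quadratic_eq_linear_add_two_mul (fun i j => b i j * d j)
      (fun i j => hb i j) (fun i => x (Sum.inl i))
    refine ⟨t, ?_⟩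
    have h1 : charForm d 0 0 (x ᵥ* (transU b).val) =
        ((∑ i, ∑ j, x (Sum.inl i) * (b i j * d j) * x (Sum.inl j) : ℤ) : ℝ) +
        ∑ i, (d i : ℝ) * x (Sum.inl i) * x (Sum.inr i) := by
      rw [charForm, Finset.sum_comm]
      push_cast
      rw [← Finset.sum_add_distrib]
      refine Finset.sum_congr rfl fun i _ => ?_
      rw [vecMul_transU_inl, vecMul_transU_inr]
      push_cast
      simp only [Pi.zero_apply, zero_mul, sub_zero, mul_zero, add_zero, mul_add, Finset.mul_sum]
      rw [Finset.sum_const_zero, add_zero]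
      congr 1
      exact Finset.sum_congr rfl fun j _ => by ring
    rw [h1, ht, charForm]
    push_cast
    rw [add_right_comm, ← Finset.sum_add_distrib]
    congr 1
    refine Finset.sum_congr rfl fun i _ => ?_
    simp only [Pi.zero_apply]
    ring
  · set φ : (∀ i, Fin (d i)) → ℂ := fun m => Complex.exp (Real.pi * Complex.I *
      (∑ i, ((m i : ℕ) : ℂ) * b i i -
        ∑ i, ∑ j, ((m i : ℕ) : ℂ) * ((b i j : ℂ) / d i) * ((m j : ℕ) : ℂ))) with hφ
    refine ⟨diagonal φ, ?_, fun Z hZ => ?_⟩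
    · rw [det_diagonal, hφ, ← Complex.exp_sum, ← Complex.exp_nat_mul, ← Finset.mul_sum,
        Finset.sum_sub_distrib]
      obtain ⟨t, ht⟩ := exists_half_exponent_mul_sum hE hd b
      obtain ⟨⟨k, hk⟩, -⟩ := hE
      refine Eq.trans ?_ (exp_two_pi_mul_int
        (4 * k * ∑ m : ∀ i, Fin (d i), ∑ i, ((m i : ℕ) : ℤ) * b i i - t))
      congr 1
      rw [mul_left_comm, mul_sub, ht, hk]
      push_cast
      ring
    · intro m v
      rw [inv_one, one_smul, Finset.sum_eq_single m (fun n _ hn => by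
        rw [diagonal_apply_ne _ hn.symm, zero_mul]) (by simp), diagonal_apply_eq,
        thetaTuple_eq hZ, thetaTuple_eq (act_mem_siegel hsymp hZ), act_transU hd]
      have hA : psiA (toRat d (transU b).val) Z v = v := by
        rw [psiA, denom_transU hd, transpose_one, one_mulVec]
      have hB : formB (Z + of fun i j => (b i j : ℂ) * d j) v v = formB Z v v := by
        have : (Z + of fun i j => (b i j : ℂ) * d j).map Complex.im = Z.map Complex.im := by
          ext i j; simp
        rw [formB, this, formB]
      have hz : cvec (0 : Fin g → ℝ) = 0 := by ext; simp
      rw [hA, hB, hz, zero_dotProduct, zero_dotProduct, mul_left_comm, zero_add]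
      congr 1
      rw [thetaChar, thetaChar, ← tsum_mul_left]
      refine tsum_congr fun n => ?_
      rw [hφ, ← Complex.exp_add]
      obtain ⟨t, ht⟩ := exists_quadratic_eq_linear_add_two_mul (fun i j => b i j * d j)
        (fun i j => hb i j) n
      set N : Fin g → ℂ := fun i => (n i : ℂ) with hN
      set a : Fin g → ℂ := fun i => ((m i : ℕ) : ℂ) / (d i : ℂ) with ha
      set W : Matrix (Fin g) (Fin g) ℂ := of fun i j => (b i j : ℂ) * d j with hW
      have hWt : Wᵀ = W := by
        ext i j
        have : (b j i : ℂ) * d i = b i j * d j := by exact_mod_cast hb j i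
        simpa [hW] using this
      have q1 : N ⬝ᵥ W *ᵥ N = ∑ i, (b i i : ℂ) * d i * n i + 2 * t := by
        have ht' : ∑ i, ∑ j, (n i : ℂ) * (b i j * d j) * n j = ∑ i, (b i i : ℂ) * d i * n i + 2 * t := by
          exact_mod_cast ht
        rw [← ht']
        simp only [dotProduct, mulVec, hW, of_apply, hN, Finset.mul_sum, mul_assoc]
      have q2 : N ⬝ᵥ W *ᵥ a = ((∑ i, ∑ j, n i * b i j * ((m j : ℕ) : ℤ) : ℤ) : ℂ) := by
        simp only [dotProduct, mulVec, hW, of_apply, hN, ha, Finset.mul_sum]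
        push_cast
        refine Finset.sum_congr rfl fun i _ => Finset.sum_congr rfl fun j _ => ?_
        have := hd' j
        field_simp
      have q3 : a ⬝ᵥ W *ᵥ a =
          ∑ i, ∑ j, ((m i : ℕ) : ℂ) * ((b i j : ℂ) / d i) * ((m j : ℕ) : ℂ) := by
        simp only [dotProduct, mulVec, hW, of_apply, ha, Finset.mul_sum]
        refine Finset.sum_congr rfl fun i _ => Finset.sum_congr rfl fun j _ => ?_
        have := hd' j
        have := hd' i
        field_simp
      have q4 : (N + a) ⬝ᵥ cvec (fun i => -(1 / 2 * ((b i i : ℝ) * d i))) =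
          -(1 / 2) * (∑ i, (b i i : ℂ) * d i * n i + ∑ i, ((m i : ℕ) : ℂ) * b i i) := by
        rw [dotProduct, ← Finset.sum_add_distrib, Finset.mul_sum]
        refine Finset.sum_congr rfl fun i _ => ?_
        simp only [Pi.add_apply, hN, ha, cvec]
        push_cast
        have := hd' i
        field_simp
      -- The two sides differ by even multiples of `πi`: the defect `2t` from parity, and twice the
      -- cross term of `n` with `D⁻¹ m`, which is integral because `W` carries the factor `D`.
      rw [add_zero, ← mul_one (Complex.exp _), ← exp_two_pi_mul_int
        (t + ∑ i, ∑ j, n i * b i j * ((m j : ℕ) : ℤ)), ← Complex.exp_add]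
      congr 1
      rw [Int.cast_add, ← q2, dotProduct_add _ v, q4, add_mulVec, dotProduct_add _ (Z *ᵥ _),
        ← q3]
      have q5 : (N + a) ⬝ᵥ W *ᵥ (N + a) = N ⬝ᵥ W *ᵥ N + 2 * (N ⬝ᵥ W *ᵥ a) + a ⬝ᵥ W *ᵥ a := by
        simp only [add_dotProduct, mulVec_add, dotProduct_add, dotProduct_mulVec_comm hWt a N]
        ring
      rw [q5, q1]
      ring

end Translation

/-! ### Poisson summation in one variable. -/

section Poisson

open Complex

/-- Poisson summation for a Gaussian with characteristic, from the functional equation of the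
two-variable Jacobi theta function. -/
lemma tsum_gaussian_eq (τ a w : ℂ) (hτ : τ ≠ 0) :
    ∑' n : ℤ, exp (Real.pi * I * (τ * (n + a) ^ 2 + 2 * ((n + a) * w))) =
      1 / (-I * τ) ^ (1 / 2 : ℂ) *
        ∑' k : ℤ, exp (Real.pi * I * (2 * (k * a) - (w - k) ^ 2 / τ)) := by
  have h1 : ∀ n : ℤ, exp (Real.pi * I * (τ * (n + a) ^ 2 + 2 * ((n + a) * w))) =
      exp (Real.pi * I * (τ * a ^ 2 + 2 * (a * w))) * jacobiTheta₂_term n (w + τ * a) τ := by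
    intro n
    rw [jacobiTheta₂_term, ← exp_add]
    congr 1; ring
  have h2 : ∀ k : ℤ, exp (Real.pi * I * (2 * (k * a) - (w - k) ^ 2 / τ)) =
      exp (-(Real.pi * I * (w ^ 2 / τ))) * jacobiTheta₂_term k ((w + τ * a) / τ) (-1 / τ) := by
    intro k
    rw [jacobiTheta₂_term, ← exp_add]
    congr 1; field_simp; ring
  simp only [h1, h2, tsum_mul_left]
  change _ * jacobiTheta₂ _ _ = _ * (_ * jacobiTheta₂ _ _)
  have h3 : exp (Real.pi * I * (τ * a ^ 2 + 2 * (a * w))) *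
      exp (-Real.pi * I * (w + τ * a) ^ 2 / τ) = exp (-(Real.pi * I * (w ^ 2 / τ))) := by
    rw [← exp_add]
    congr 1; field_simp; ring
  rw [jacobiTheta₂_functional_equation, ← h3]
  ring

/-- The dual terms are Jacobi theta terms at `-1/τ`, which again lies in the upper half plane. -/
lemma summable_gaussian_dual {τ : ℂ} (hτ : 0 < τ.im) (a w : ℂ) :
    Summable fun k : ℤ => exp (Real.pi * I * (2 * (k * a) - (w - k) ^ 2 / τ)) := by
  have h0 : τ ≠ 0 := fun h => by simp [h] at hτ
  have h2 : ∀ k : ℤ, exp (Real.pi * I * (2 * (k * a) - (w - k) ^ 2 / τ)) =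
      exp (-(Real.pi * I * (w ^ 2 / τ))) * jacobiTheta₂_term k ((w + τ * a) / τ) (-1 / τ) := by
    intro k
    rw [jacobiTheta₂_term, ← exp_add]
    congr 1; field_simp; ring
  simp only [h2]
  refine Summable.mul_left _ ((summable_jacobiTheta₂_term_iff _ _).mpr ?_)
  rw [neg_div, neg_im, one_div, inv_im, neg_div, neg_neg]
  exact div_pos hτ (normSq_pos.mpr h0)

/-- The sum over `ℤ` is the sum over the residue classes of the sums over each class. -/
lemma tsum_int_eq_sum_residue {N : ℕ} (hN : 0 < N) {f : ℤ → ℂ} (hf : Summable f) :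
    ∑' k, f k = ∑ r : Fin N, ∑' q : ℤ, f (q * N + (r : ℕ)) := by
  have : NeZero N := ⟨hN.ne'⟩
  rw [← (Int.divModEquiv N).symm.tsum_eq]
  have h : Summable fun p : ℤ × Fin N => f ((Int.divModEquiv N).symm p) :=
    (Int.divModEquiv N).symm.summable_iff.mpr hf
  rw [← (Equiv.prodComm (Fin N) ℤ).tsum_eq]
  have h' := (Equiv.prodComm (Fin N) ℤ).summable_iff.mpr h
  refine (Summable.tsum_prod h').trans ?_
  rw [tsum_fintype]
  rfl

/-- Summing first over the `i`-th coordinate. -/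
lemma sum_tsum_eq_tsum_sum_tsum {g : ℕ} {κ : Type*} [Fintype κ] (i : Fin g)
    {F : κ → (Fin g → ℤ) → ℂ} (hF : ∀ k, Summable (F k)) :
    ∑ k, ∑' n, F k n = ∑' r : {j // j ≠ i} → ℤ, ∑ k, ∑' t : ℤ,
      F k ((Equiv.funSplitAt i ℤ).symm (t, r)) := by
  set e := (Equiv.prodComm _ _).trans (Equiv.funSplitAt i ℤ).symm with he
  have hs : ∀ k, Summable fun p => F k (e p) := fun k => e.summable_iff.mpr (hF k)
  have h : ∀ k, ∑' n, F k n = ∑' r : {j // j ≠ i} → ℤ, ∑' t : ℤ,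
      F k ((Equiv.funSplitAt i ℤ).symm (t, r)) := fun k => by
    rw [← e.tsum_eq, Summable.tsum_prod (hs k)]
    rfl
  simp only [h]
  exact (Summable.tsum_finsetSum fun k _ => (hs k).prod).symm

end Poisson

/-! ### The finite Fourier transform in one coordinate and its determinant. -/

section FourierMatrix

variable {g : ℕ} {d : Fin g → ℕ}

/-- The finite Fourier transform in the `i`-th coordinate, with frequency sign `ε`. -/
def fourierMatrix (d : Fin g → ℕ) (i : Fin g) (ε : ℤ) :
    Matrix (∀ i, Fin (d i)) (∀ i, Fin (d i)) ℂ :=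
  of fun m n => if Function.update m i (n i) = n then
    Complex.exp (2 * Real.pi * Complex.I * (ε * (m i : ℕ) * (n i : ℕ) / d i)) else 0

lemma sum_fourierMatrix_mul (i : Fin g) (ε : ℤ) (m : ∀ i, Fin (d i)) (f : (∀ i, Fin (d i)) → ℂ) :
    ∑ n, fourierMatrix d i ε m n * f n = ∑ t : Fin (d i),
      Complex.exp (2 * Real.pi * Complex.I * (ε * (m i : ℕ) * (t : ℕ) / d i)) *
        f (Function.update m i t) := by
  simp only [fourierMatrix, of_apply, ite_mul, zero_mul]
  rw [← Finset.sum_filter]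
  refine Finset.sum_nbij' (fun n => n i) (fun t => Function.update m i t) ?_ ?_ ?_ ?_ ?_
  · simp
  · simp
  · intro n hn
    simpa using hn
  · simp
  · intro n hn
    simp only [Finset.mem_filter, Finset.mem_univ, true_and] at hn
    rw [hn]

lemma sum_exp_mul_eq_zero {N : ℕ} {a b : Fin N} (h : a ≠ b) :
    ∑ t : Fin N, Complex.exp (2 * Real.pi * Complex.I * (((a : ℕ) - (b : ℕ)) * (t : ℕ) / N)) = 0 := by
  have hN : (N : ℂ) ≠ 0 := by exact_mod_cast (Fin.pos a).ne'
  set z := Complex.exp (2 * Real.pi * Complex.I * (((a : ℕ) - (b : ℕ)) / N)) with hz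
  have e : ∀ t : ℕ, Complex.exp (2 * Real.pi * Complex.I * (((a : ℕ) - (b : ℕ)) * t / N)) = z ^ t := by
    intro t
    rw [hz, ← Complex.exp_nat_mul]
    congr 1; ring
  simp only [e]
  rw [Fin.sum_univ_eq_sum_range (fun t => z ^ t)]
  have hzN : z ^ N = 1 := by
    rw [hz, ← Complex.exp_nat_mul, ← exp_two_pi_mul_int ((a : ℕ) - (b : ℕ))]
    congr 1; push_cast; field_simp
  have hz1 : z ≠ 1 := by
    intro h1
    obtain ⟨n, hn⟩ := Complex.exp_eq_one_iff.mp h1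
    apply h
    apply fin_eq_of_dvd
    refine ⟨n, ?_⟩
    have : ((a : ℕ) - (b : ℕ) : ℂ) / N = n := by
      have h2 : (2 * Real.pi * Complex.I : ℂ) ≠ 0 := Complex.two_pi_I_ne_zero
      apply mul_left_cancel₀ h2
      rw [hn]; ring
    rw [div_eq_iff hN, mul_comm] at this
    exact_mod_cast this
  rw [geom_sum_eq hz1, hzN, sub_self, zero_div]

/-- Orthogonality of the characters of `ℤ/d_i`; the other coordinates are carried along unchanged.
-/
lemma fourierMatrix_mul_neg (i : Fin g) :
    fourierMatrix d i 1 * fourierMatrix d i (-1) = (d i : ℂ) • 1 := by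
  ext m k
  rw [Matrix.mul_apply, sum_fourierMatrix_mul, Matrix.smul_apply, smul_eq_mul]
  simp only [fourierMatrix, of_apply, Function.update_self, Function.update_idem]
  by_cases h : Function.update m i (k i) = k
  · simp only [h, if_true, ← Complex.exp_add]
    by_cases hm : m = k
    · subst hm
      rw [one_apply_eq, mul_one]
      rw [Finset.sum_congr rfl (g := fun _ => (1 : ℂ)) fun t _ => by
        rw [Complex.exp_eq_one_iff]; exact ⟨0, by push_cast; ring⟩]
      simp
    · rw [one_apply_ne hm, mul_zero]
      have hne : m i ≠ k i := fun h' => hm (by rw [← h, ← h', Function.update_eq_self])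
      rw [← sum_exp_mul_eq_zero hne]
      refine Finset.sum_congr rfl fun t _ => ?_
      congr 1; push_cast; ring
  · have hm : m ≠ k := fun h' => h (by rw [h', Function.update_eq_self])
    rw [one_apply_ne hm]
    simp [h]

/-- Reversing the frequency sign amounts to replacing the row index `m_i` by `-m_i`, a permutation
of the rows. -/
lemma fourierMatrix_neg (hd : ∀ i, 0 < d i) (i : Fin g) :
    ∃ σ : Equiv.Perm (∀ i, Fin (d i)),
      fourierMatrix d i (-1) = (fourierMatrix d i 1).submatrix σ id := by
  have : NeZero (d i) := ⟨(hd i).ne'⟩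
  have hinv : Function.Involutive fun m : ∀ i, Fin (d i) => Function.update m i (-(m i)) := by
    intro m
    simp
  refine ⟨hinv.toPerm, ?_⟩
  ext m n
  have hd' : (d i : ℂ) ≠ 0 := by exact_mod_cast (hd i).ne'
  simp only [fourierMatrix, of_apply, submatrix_apply, Function.Involutive.coe_toPerm, id,
    Function.update_self, Function.update_idem]
  congr 1
  have h : ∃ t : ℤ, (((-(m i) : Fin (d i)) : ℕ) : ℤ) = -((m i : ℕ) : ℤ) + d i * t := by
    rw [Fin.val_neg']
    rcases Nat.eq_zero_or_pos (m i : ℕ) with h0 | h0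
    · exact ⟨0, by simp [h0]⟩
    · refine ⟨1, ?_⟩
      rw [Nat.mod_eq_of_lt (by omega), Nat.cast_sub (m i).isLt.le]
      ring
  obtain ⟨t, ht⟩ := h
  have ht' : (((-(m i) : Fin (d i)) : ℕ) : ℂ) = -((m i : ℕ) : ℂ) + d i * t := by exact_mod_cast ht
  rw [ht', ← mul_one (Complex.exp _), ← exp_two_pi_mul_int (t * (n i : ℕ)), ← Complex.exp_add]
  congr 1
  push_cast
  field_simp

/-- A multiple of the normalized Fourier matrix by an eighth root of unity has determinant an
eighth root of unity. -/
lemma det_smul_fourierMatrix_pow (hd : ∀ i, 0 < d i) (i : Fin g) {κ ρ : ℂ} (hκ : κ ^ 8 = 1)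
    (hρ : ρ ^ 2 = d i) : ((κ / ρ) • fourierMatrix d i 1).det ^ 8 = 1 := by
  have hd' : (d i : ℂ) ≠ 0 := by exact_mod_cast (hd i).ne'
  obtain ⟨σ, hσ⟩ := fourierMatrix_neg hd i
  have h := congrArg Matrix.det (fourierMatrix_mul_neg (d := d) i)
  rw [det_mul, hσ, det_permute, det_smul, det_one, mul_one] at h
  set N := Fintype.card (∀ i, Fin (d i))
  -- The square of the determinant is known up to the sign of a permutation, which the fourth power
  -- removes.
  have h1 : (fourierMatrix d i 1).det ^ 8 = ((d i : ℂ) ^ N) ^ 4 := by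
    rw [← h]
    rcases Int.units_eq_one_or (Equiv.Perm.sign σ) with hs | hs <;> rw [hs] <;> push_cast <;> ring
  rw [det_smul, mul_pow, h1, ← hρ, div_pow, div_pow, ← pow_mul κ, mul_comm _ 8, pow_mul κ, hκ,
    one_pow]
  have hρ0 : ρ ≠ 0 := fun h0 => hd' (by rw [← hρ, h0]; ring)
  field_simp
  ring

end FourierMatrix

/-! ### Partial inversions: Poisson summation gives a Fourier matrix. -/

section Inversion

variable {g : ℕ} {d : Fin g → ℕ} {Z : Matrix (Fin g) (Fin g) ℂ}

lemma toRat_invU (hd : ∀ i, 0 < d i) (i : Fin g) :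
    toRat d (invU i).val = fromBlocks (diagonal fun j => if j = i then 0 else 1)
      (diagonal fun j => if j = i then -(d i : ℚ) else 0)
      (diagonal fun j => if j = i then (d i : ℚ)⁻¹ else 0)
      (diagonal fun j => if j = i then 0 else 1) := by
  have hd' : ∀ i, (d i : ℚ) ≠ 0 := fun i => by exact_mod_cast (hd i).ne'
  have hS : ∀ j : Fin g, (Pi.mulSingle j ModularGroup.S : Fin g → SpecialLinearGroup (Fin 2) ℤ) j =
    ModularGroup.S := fun j => Pi.mulSingle_eq_same j _
  rw [toRat_eq hd, invU, coe_blockU]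
  congr 1
  all_goals
    ext j k
    rcases eq_or_ne j k with rfl | hjk
    · rcases eq_or_ne j i with rfl | hj
      · simp only [blockHom, MonoidHom.coe_mk, OneHom.coe_mk, fromBlocks_apply₁₁,
          fromBlocks_apply₁₂, fromBlocks_apply₂₁, fromBlocks_apply₂₂, of_apply,
          diagonal_apply_eq, hS]
        simp [ModularGroup.S]
      · simp [blockHom, hj, hd']
    · simp [blockHom, hjk]

lemma toRat_invU_mem (hd : ∀ i, 0 < d i) (i : Fin g) :
    toRat d (invU i).val ∈ symplecticGroup (Fin g) ℚ := by
  have hd' : ∀ i, (d i : ℚ) ≠ 0 := fun i => by exact_mod_cast (hd i).ne'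
  rw [toRat_invU hd, SymplecticGroup.fromBlocks_mem_iff]
  refine ⟨?_, ?_, ?_⟩
  all_goals
    ext j k
    rcases eq_or_ne j k with rfl | hjk
    · rcases eq_or_ne j i with rfl | hj <;> simp [*]
    · simp [hjk]

/-- The vector `z / d_i - e_i`, where `z` is the `i`-th row of `Z`. -/
def invVec (d : Fin g → ℕ) (Z : Matrix (Fin g) (Fin g) ℂ) (i : Fin g) : Fin g → ℂ :=
  fun k => Z i k / d i - (Pi.single i 1 : Fin g → ℂ) k

lemma dotProduct_invVec (i : Fin g) (x : Fin g → ℂ) :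
    x ⬝ᵥ invVec d Z i = (x ⬝ᵥ Z i) / d i - x i := by
  have h : invVec d Z i = (d i : ℂ)⁻¹ • Z i - Pi.single i 1 := by
    ext k
    simp [invVec, div_eq_inv_mul]
  rw [h, dotProduct_sub, dotProduct_smul, dotProduct_single_one, smul_eq_mul, div_eq_inv_mul]

lemma denom_invU (hd : ∀ i, 0 < d i) (i : Fin g) :
    denom (toRat d (invU i).val) Z = 1 + vecMulVec (Pi.single i 1) (invVec d Z i) := by
  rw [denom, toRat_invU hd, toBlocks_fromBlocks₂₁, toBlocks_fromBlocks₂₂]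
  ext j k
  rw [Matrix.add_apply, diagonal_map (by simp), diagonal_mul, diagonal_map (by simp),
    Matrix.add_apply, vecMulVec_apply, invVec]
  rcases eq_or_ne j i with rfl | hj
  · rcases eq_or_ne k j with rfl | hk
    · simp; ring
    · simp [hk, hk.symm]; ring
  · simp [hj, diagonal_apply, one_apply]

/-- The denominator is a rank-one perturbation of the identity, so its determinant is `1` plus the
`i`-th coordinate of `invVec`. -/
lemma det_denom_invU (hd : ∀ i, 0 < d i) (i : Fin g) :
    (denom (toRat d (invU i).val) Z).det = Z i i / d i := by
  rw [denom_invU hd, vecMulVec_eq Unit, det_one_add_replicateCol_mul_replicateRow]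
  simp [invVec]

lemma im_diag_pos (hZ : Z ∈ siegel g) (i : Fin g) : 0 < (Z i i).im := by
  simpa using hZ.2.diag_pos (i := i)

lemma diag_ne_zero (hZ : Z ∈ siegel g) (i : Fin g) : Z i i ≠ 0 := fun h => by
  simpa [h] using im_diag_pos hZ i

/-- The image of `Z` under the partial inversion. -/
lemma act_invU (hd : ∀ i, 0 < d i) (hZ : Z ∈ siegel g) (i : Fin g) :
    act (toRat d (invU i).val) Z = Z - ((d i : ℂ) ^ 2 / Z i i) •
      vecMulVec (invVec d Z i) (invVec d Z i) -
      (2 * (d i : ℂ)) • vecMulVec (Pi.single i 1) (Pi.single i 1) := by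
  have hd' : (d i : ℂ) ≠ 0 := by exact_mod_cast (hd i).ne'
  have h0 := diag_ne_zero hZ i
  have hsymm : ∀ j, Z j i = Z i j := fun j => congrFun (congrFun hZ.1 i) j
  rw [← (denom_isUnit (toRat_invU_mem hd i) hZ).mul_left_inj,
    act_mul_denom (toRat_invU_mem hd i) hZ, denom_invU hd, mul_add, mul_one, mul_vecMulVec,
    numer, toRat_invU hd, toBlocks_fromBlocks₁₁, toBlocks_fromBlocks₁₂, diagonal_map (by simp),
    diagonal_map (by simp)]
  ext j k
  simp only [Matrix.add_apply, Matrix.sub_apply, Matrix.smul_apply, smul_eq_mul, vecMulVec_apply,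
    diagonal_mul, mulVec_single_one, col_apply, invVec, hsymm]
  rcases eq_or_ne j i with rfl | hj
  · rcases eq_or_ne k j with rfl | hk
    · simp; field_simp; ring
    · simp [hk, hk.symm]; field_simp; ring
  · rcases eq_or_ne k i with rfl | hk
    · simp [hj, hsymm]; field_simp; ring
    · simp [hj, hk, diagonal_apply]; field_simp; ring

lemma psiA_invU (hd : ∀ i, 0 < d i) (i : Fin g) (v : Fin g → ℂ) :
    psiA (toRat d (invU i).val) Z v = v + v i • invVec d Z i := by
  rw [psiA, denom_invU hd, transpose_add, transpose_one, transpose_vecMulVec, add_mulVec,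
    one_mulVec, vecMulVec_mulVec]
  simp

/-- The part of the exponents that does not involve the `i`-th summation variable. -/
def invConst (d : Fin g → ℕ) (Z : Matrix (Fin g) (Fin g) ℂ) (i : Fin g) (v p : Fin g → ℂ) : ℂ :=
  p ⬝ᵥ Z *ᵥ p + 2 * (p ⬝ᵥ v) + 2 * (v i / d i) * (p ⬝ᵥ Z i)

/-- This isolates the `i`-th summation variable `t` in the form that `tsum_gaussian_eq` expects,
with `p · Z_i + Z_ii v_i / d_i` as linear coefficient. -/
lemma exponent_psiA_invU (hd : ∀ i, 0 < d i) (hZ : Z ∈ siegel g) (i : Fin g) (v : Fin g → ℂ)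
    {p : Fin g → ℂ} (hp : p i = 0) (t : ℂ) :
    (p + Pi.single i t) ⬝ᵥ Z *ᵥ (p + Pi.single i t) +
        2 * ((p + Pi.single i t) ⬝ᵥ psiA (toRat d (invU i).val) Z v) =
      invConst d Z i v p +
        (Z i i * t ^ 2 + 2 * (t * (p ⬝ᵥ Z i + Z i i * (v i / d i)))) := by
  have hsymm : ∀ j, Z j i = Z i j := fun j => congrFun (congrFun hZ.1 i) j
  have h2 : Z.col i = Z i := funext hsymm
  rw [psiA_invU hd, invConst]
  simp only [mulVec_add, dotProduct_add, add_dotProduct, dotProduct_smul, dotProduct_invVec, single_dotProduct,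
    mulVec_single, smul_eq_mul, h2]
  have h3 : (Z *ᵥ p) i = p ⬝ᵥ Z i := by rw [mulVec, dotProduct_comm]
  simp [h3, hp, invVec]
  ring

/-- With the same linear coefficient and the same constant, the exponent at the image point is the
completed square of the Poisson dual, with dual variable `d_i t`. -/
lemma exponent_act_invU (hd : ∀ i, 0 < d i) (hZ : Z ∈ siegel g) (i : Fin g) (v : Fin g → ℂ)
    {p : Fin g → ℂ} (hp : p i = 0) (t : ℂ) :
    (p + Pi.single i t) ⬝ᵥ act (toRat d (invU i).val) Z *ᵥ (p + Pi.single i t) +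
        2 * ((p + Pi.single i t) ⬝ᵥ v) =
      invConst d Z i v p + Z i i * (v i / d i) ^ 2 -
        (p ⬝ᵥ Z i + Z i i * (v i / d i) - d i * t) ^ 2 / Z i i := by
  have hd' : (d i : ℂ) ≠ 0 := by exact_mod_cast (hd i).ne'
  have h0 := diag_ne_zero hZ i
  have hsymm : ∀ j, Z j i = Z i j := fun j => congrFun (congrFun hZ.1 i) j
  have h2 : Z.col i = Z i := funext hsymm
  have h3 : (Z *ᵥ p) i = p ⬝ᵥ Z i := by rw [mulVec, dotProduct_comm]
  rw [act_invU hd hZ, invConst]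
  simp only [sub_mulVec, smul_mulVec, vecMulVec_mulVec, dotProduct_sub, dotProduct_smul, dotProduct_invVec,
    dotProduct_comm (invVec d Z i), mulVec_add, dotProduct_add, add_dotProduct]
  simp [h3, h2, hp]
  field_simp
  ring

/-- Splitting off the `i`-th coordinate of a summation variable with characteristic. -/
lemma funSplitAt_symm_add (i : Fin g) (t : ℤ) (r : {j // j ≠ i} → ℤ) (a : Fin g → ℂ) :
    (fun j => (((Equiv.funSplitAt i ℤ).symm (t, r) j : ℤ) : ℂ)) + a =
      (fun j => if h : j = i then 0 else (r ⟨j, h⟩ : ℂ) + a j) + Pi.single i ((t : ℂ) + a i) := by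
  ext j
  rcases eq_or_ne j i with rfl | h
  · simp
  · simp [h]

/-- The transformation of theta functions with characteristic under a partial inversion. -/
lemma thetaChar_psiA_invU (hd : ∀ i, 0 < d i) (hZ : Z ∈ siegel g) (i : Fin g)
    (m : ∀ i, Fin (d i)) (v : Fin g → ℂ) :
    thetaChar Z (fun j => ((m j : ℕ) : ℂ) / d j) 0 (psiA (toRat d (invU i).val) Z v) =
      1 / (-Complex.I * Z i i) ^ (1 / 2 : ℂ) *
        Complex.exp (-(Real.pi * Complex.I * (Z i i * (v i / d i) ^ 2))) *
        ∑ k : Fin (d i), Complex.exp (2 * Real.pi * Complex.I * ((m i : ℕ) * (k : ℕ) / d i)) *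
          thetaChar (act (toRat d (invU i).val) Z)
            (fun j => ((Function.update m i k j : ℕ) : ℂ) / d j) 0 v := by
  have hd' : (d i : ℂ) ≠ 0 := by exact_mod_cast (hd i).ne'
  have hZ' := act_mem_siegel (toRat_invU_mem hd i) hZ
  set w := act (toRat d (invU i).val) Z with hw
  have hL := sum_tsum_eq_tsum_sum_tsum (κ := Unit) i
    (F := fun _ n => Complex.exp (Real.pi * Complex.I *
      (((fun j => (n j : ℂ)) + fun j => ((m j : ℕ) : ℂ) / d j) ⬝ᵥ
        Z *ᵥ ((fun j => (n j : ℂ)) + fun j => ((m j : ℕ) : ℂ) / d j) +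
      2 * (((fun j => (n j : ℂ)) + fun j => ((m j : ℕ) : ℂ) / d j) ⬝ᵥ
        (psiA (toRat d (invU i).val) Z v + 0)))))
    fun _ => summable_thetaChar hZ _ _
  have hR := sum_tsum_eq_tsum_sum_tsum (κ := Fin (d i)) i
    (F := fun k n => Complex.exp (2 * Real.pi * Complex.I * ((m i : ℕ) * (k : ℕ) / d i)) *
      Complex.exp (Real.pi * Complex.I *
      (((fun j => (n j : ℂ)) + fun j => ((Function.update m i k j : ℕ) : ℂ) / d j) ⬝ᵥ
        w *ᵥ ((fun j => (n j : ℂ)) + fun j => ((Function.update m i k j : ℕ) : ℂ) / d j) +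
      2 * (((fun j => (n j : ℂ)) + fun j => ((Function.update m i k j : ℕ) : ℂ) / d j) ⬝ᵥ
        (v + 0)))))
    fun k => (summable_thetaChar hZ' _ _).mul_left _
  simp only [Finset.univ_unique, Finset.sum_singleton, tsum_mul_left] at hL hR
  simp only [thetaChar]
  rw [hL, hR, ← tsum_mul_left]
  refine tsum_congr fun r => ?_
  set p : Fin g → ℂ := fun j => if h : j = i then 0 else (r ⟨j, h⟩ : ℂ) + ((m j : ℕ) : ℂ) / d j
    with hp
  have hpi : p i = 0 := by simp [hp]
  have hp' : ∀ k : Fin (d i), (fun j => if h : j = i then (0 : ℂ) else (r ⟨j, h⟩ : ℂ) +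
      ((Function.update m i k j : ℕ) : ℂ) / d j) = p := by
    intro k
    ext j
    rcases eq_or_ne j i with rfl | h
    · simp [hp]
    · simp [hp, h]
  simp only [funSplitAt_symm_add, hp', add_zero, exponent_psiA_invU hd hZ i v hpi, hw,
    exponent_act_invU hd hZ i v hpi, Function.update_self, ← hp]
  set c := invConst d Z i v p
  set u := p ⬝ᵥ Z i + Z i i * (v i / d i) with hu
  have hsplit : ∀ t : ℤ, Complex.exp (Real.pi * Complex.I * (c + (Z i i *
      ((t : ℂ) + ((m i : ℕ) : ℂ) / d i) ^ 2 + 2 * (((t : ℂ) + ((m i : ℕ) : ℂ) / d i) * u)))) =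
      Complex.exp (Real.pi * Complex.I * c) * Complex.exp (Real.pi * Complex.I * (Z i i *
      ((t : ℂ) + ((m i : ℕ) : ℂ) / d i) ^ 2 + 2 * (((t : ℂ) + ((m i : ℕ) : ℂ) / d i) * u))) := by
    intro t
    rw [← Complex.exp_add, mul_add]
  simp only [hsplit, tsum_mul_left]
  -- The dual variable is written as `q d_i + k`: the residue `k` becomes the index of the target
  -- theta function and `q` its summation variable.
  rw [tsum_gaussian_eq _ _ _ (diag_ne_zero hZ i), mul_left_comm, mul_assoc (1 / _),
    tsum_int_eq_sum_residue (hd i) (summable_gaussian_dual (im_diag_pos hZ i) _ _)]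
  congr 1
  rw [Finset.mul_sum, Finset.mul_sum]
  refine Finset.sum_congr rfl fun k _ => ?_
  rw [← tsum_mul_left, ← tsum_mul_left, ← tsum_mul_left]
  refine tsum_congr fun q => ?_
  -- The phase of `(q d_i + k) m_i / d_i` has the integral part `q m_i`, which is invisible; the
  -- rest is the Fourier kernel.
  rw [← Complex.exp_add, ← Complex.exp_add, ← Complex.exp_add, ← mul_one (Complex.exp (_ + (_ + _))),
    ← exp_two_pi_mul_int (q * (m i : ℕ)), ← Complex.exp_add]
  congr 1
  have e1 : (d i : ℂ) * ((q : ℂ) + ((k : ℕ) : ℂ) / d i) = q * d i + (k : ℕ) := by field_simp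
  have e2 : ((q * (d i : ℤ) + ((k : ℕ) : ℤ) : ℤ) : ℂ) * (((m i : ℕ) : ℂ) / d i) =
      q * (m i : ℕ) + (m i : ℕ) * (k : ℕ) / d i := by
    push_cast
    field_simp
  rw [e1, e2]
  push_cast
  ring

/-- The defect of `B` computed in `formB_psiA` is here `Z_ii (v_i / d_i)²`, which cancels the
Gaussian factor of `thetaChar_psiA_invU`. -/
lemma thetaTuple_psiA_invU (hd : ∀ i, 0 < d i) (hZ : Z ∈ siegel g) (i : Fin g)
    (m : ∀ i, Fin (d i)) (v : Fin g → ℂ) :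
    thetaTuple d Z (toVec Z 0 0) m (psiA (toRat d (invU i).val) Z v) =
      1 / (-Complex.I * Z i i) ^ (1 / 2 : ℂ) * ∑ n, fourierMatrix d i 1 m n *
        thetaTuple d (act (toRat d (invU i).val) Z)
          (toVec (act (toRat d (invU i).val) Z) 0 0) n v := by
  have hd' : (d i : ℂ) ≠ 0 := by exact_mod_cast (hd i).ne'
  have hM := toRat_invU_mem hd i
  have hz : cvec (0 : Fin g → ℝ) = 0 := by ext; simp
  have hq : v ⬝ᵥ (denom (toRat d (invU i).val) Z *
      ((toRat d (invU i).val).toBlocks₂₁.map (Rat.cast : ℚ → ℂ))ᵀ) *ᵥ v =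
      Z i i * (v i / d i) ^ 2 := by
    have h1 : ((toRat d (invU i).val).toBlocks₂₁.map (Rat.cast : ℚ → ℂ))ᵀ *ᵥ v =
        Pi.single i (v i / d i) := by
      rw [toRat_invU hd, toBlocks_fromBlocks₂₁, diagonal_map (by simp), diagonal_transpose]
      ext j
      rw [mulVec_diagonal]
      rcases eq_or_ne j i with rfl | h
      · simp [div_eq_inv_mul]
      · simp [h]
    rw [← mulVec_mulVec, h1, denom_invU hd, add_mulVec, one_mulVec, vecMulVec_mulVec]
    simp [invVec]
    field_simp
    ring
  rw [sum_fourierMatrix_mul, thetaTuple_eq hZ, formB_psiA hM hZ, hq, hz, zero_dotProduct, zero_add,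
    thetaChar_psiA_invU hd hZ, mul_assoc (1 / _), mul_left_comm (Complex.exp _)]
  simp only [thetaTuple_eq (act_mem_siegel hM hZ), hz, zero_dotProduct, zero_add]
  congr 1
  rw [← mul_assoc, ← Complex.exp_add, Finset.mul_sum]
  refine Finset.sum_congr rfl fun k _ => ?_
  rw [mul_left_comm]
  congr 2
  · congr 1; push_cast; ring
  · congr 1; ring

/-- The partial inversions satisfy the transformation formula. -/
theorem hasTransformation_invU {E : ℕ} (hE : 8 ∣ E) (hd : ∀ i, 0 < d i) (i : Fin g) :
    HasTransformation d E (invU i).val := by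
  set κ : ℂ := Complex.exp (Real.pi * Complex.I / 4) with hκ
  set ρ : ℂ := (Real.sqrt (d i) : ℂ) with hρ
  have hκ2 : κ ^ 2 = Complex.I := by
    rw [hκ, ← Complex.exp_nat_mul]
    refine Eq.trans ?_ Complex.exp_pi_div_two_mul_I
    congr 1; push_cast; ring
  have hκ8 : κ ^ 8 = 1 := by
    rw [show 8 = 2 * 4 from rfl, pow_mul, hκ2, Complex.I_pow_four]
  have hρ2 : ρ ^ 2 = d i := by
    rw [hρ]
    exact_mod_cast Real.sq_sqrt (Nat.cast_nonneg (d i))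
  have hd' : (d i : ℂ) ≠ 0 := by exact_mod_cast (hd i).ne'
  have hρ0 : ρ ≠ 0 := fun h => hd' (by rw [← hρ2, h]; ring)
  have hκ0 : κ ≠ 0 := Complex.exp_ne_zero _
  -- The square is `(i / d_i)(-i Z_ii) = Z_ii / d_i`. The principal root is continuous because `-i
  -- Z_ii` has positive real part; the constant `κ / ρ` then reappears in the matrix as the
  -- normalization of the Fourier transform.
  refine ⟨toRat_invU_mem hd i, fun Z => κ / ρ * (-Complex.I * Z i i) ^ (1 / 2 : ℂ),
    ⟨?_, fun Z hZ => ?_⟩, 0, 0, ?_, (κ / ρ) • fourierMatrix d i 1,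
    pow_eq_one_of_eight_dvd hE (det_smul_fourierMatrix_pow hd i hκ8 hρ2), fun Z hZ m v => ?_⟩
  · refine continuousOn_const.mul (ContinuousOn.cpow (by fun_prop) continuousOn_const ?_)
    intro Z hZ
    left
    simpa using im_diag_pos hZ i
  · rw [det_denom_invU hd, mul_pow, ← Complex.cpow_nat_mul, div_pow, hκ2, hρ2]
    norm_num
    rw [div_mul_eq_mul_div, ← mul_assoc, Complex.I_mul_I]
    ring
  · intro x
    -- `S` sends `(x, y)` to `(y, -x)`, so the term `d_i x y` changes sign.
    refine ⟨-(d i * x (Sum.inl i) * x (Sum.inr i)), ?_⟩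
    rw [charForm, charForm, ← sub_eq_iff_eq_add', ← Finset.sum_sub_distrib,
      Finset.sum_eq_single i]
    · rw [invU, vecMul_blockU_inl, vecMul_blockU_inr, Pi.mulSingle_eq_same]
      simp [ModularGroup.S]
      ring
    · intro j _ hj
      rw [invU, vecMul_blockU_inl, vecMul_blockU_inr, Pi.mulSingle_eq_of_ne hj]
      simp
    · simp
  · rw [thetaTuple_psiA_invU hd hZ, Finset.mul_sum]
    refine Finset.sum_congr rfl fun n _ => ?_
    rw [Matrix.smul_apply, Matrix.smul_apply, smul_eq_mul, smul_eq_mul]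
    have : (-Complex.I * Z i i) ^ (1 / 2 : ℂ) ≠ 0 := by
      rw [Ne, Complex.cpow_eq_zero_iff]
      simp [diag_ne_zero hZ i]
    field_simp

end Inversion

/-! ### The affine action on characteristics. -/

section Characteristic

variable {g : ℕ} {d : Fin g → ℕ}

/-- The quadratic form `x ↦ Σ d_l x_l x_{g+l}` pulled back along `R`, as a matrix. -/
def pairMatrix (d : Fin g → ℕ) (R : Matrix (Fin g ⊕ Fin g) (Fin g ⊕ Fin g) ℤ)
    (a b : Fin g ⊕ Fin g) : ℤ :=
  ∑ l, d l * (R a (Sum.inl l) * R b (Sum.inr l))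

lemma charForm_zero_vecMul (R : Matrix (Fin g ⊕ Fin g) (Fin g ⊕ Fin g) ℤ)
    (x : Fin g ⊕ Fin g → ℤ) :
    charForm d 0 0 (x ᵥ* R) = ((∑ a, ∑ b, x a * pairMatrix d R a b * x b : ℤ) : ℝ) := by
  have h : ∑ a, ∑ b, x a * pairMatrix d R a b * x b =
      ∑ l, (d l : ℤ) * (x ᵥ* R) (Sum.inl l) * (x ᵥ* R) (Sum.inr l) := by
    simp only [pairMatrix, Finset.mul_sum, Finset.sum_mul]
    rw [Finset.sum_congr rfl fun a _ => Finset.sum_comm, Finset.sum_comm]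
    refine Finset.sum_congr rfl fun l _ => ?_
    rw [vecMul, vecMul, mul_assoc, dotProduct, dotProduct, Finset.sum_mul_sum, Finset.mul_sum]
    refine Finset.sum_congr rfl fun a _ => ?_
    rw [Finset.mul_sum]
    exact Finset.sum_congr rfl fun b _ => by ring
  rw [h, charForm]
  push_cast
  simp

/-- The antisymmetrization is the alternating form on the rows of `R`, which membership in `Γ_D`
prescribes. -/
lemma pairMatrix_sub {R : Matrix (Fin g ⊕ Fin g) (Fin g ⊕ Fin g) ℤ} (hR : R ∈ GammaD d)
    (a b : Fin g ⊕ Fin g) : pairMatrix d R a b - pairMatrix d R b a =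
      fromBlocks 0 (diagonal fun i => (d i : ℤ)) (-diagonal fun i => (d i : ℤ)) 0 a b := by
  have h : altForm d (R a) (R b) = fromBlocks 0 (diagonal fun i => (d i : ℤ))
      (-diagonal fun i => (d i : ℤ)) 0 a b := by
    rw [← altForm_row, show _ = _ from hR]
  rw [← h, pairMatrix, pairMatrix, altForm, ← Finset.sum_sub_distrib]
  exact Finset.sum_congr rfl fun l _ => by ring

/-- The affine transformation `c ↦ M[c]` of characteristics is compatible with the
semicharacters. -/
theorem compatible_char (hd : ∀ i, 0 < d i) {R : Matrix (Fin g ⊕ Fin g) (Fin g ⊕ Fin g) ℤ}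
    (hR : R ∈ GammaD d) (c₁ c₂ : Fin g → ℝ) :
    Compatible d R c₁ c₂ (char₁ d (toRat d R) c₁ c₂) (char₂ (toRat d R) c₁ c₂) := by
  have hd' : ∀ i, (d i : ℝ) ≠ 0 := fun i => by exact_mod_cast (hd i).ne'
  set k₁ : Fin g → ℝ := fun i =>
    1 / 2 * (((diagonal fun i => (d i : ℚ)) * (toRat d R).toBlocks₂₁ *
      (toRat d R).toBlocks₂₂ᵀ) i i : ℝ) with hk₁
  set k₂ : Fin g → ℝ := fun i =>
    1 / 2 * (((toRat d R).toBlocks₁₁ * (toRat d R).toBlocks₁₂ᵀ) i i : ℝ) with hk₂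
  have e₁ : char₁ d (toRat d R) c₁ c₂ = k₁ + lin₁ (toRat d R) c₁ c₂ := add_comm _ _
  have e₂ : char₂ (toRat d R) c₁ c₂ = k₂ + lin₂ (toRat d R) c₁ c₂ := add_comm _ _
  rw [e₁, e₂]
  refine Compatible.shift hd (fun x => ?_) c₁ c₂
  have hs₁ : ∀ i, 2 * (k₁ i * d i) = pairMatrix d R (Sum.inr i) (Sum.inr i) := by
    intro i
    simp only [hk₁, toRat_eq hd, toBlocks_fromBlocks₂₁, toBlocks_fromBlocks₂₂, Matrix.mul_assoc,
      diagonal_mul]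
    simp only [Matrix.mul_apply, transpose_apply, of_apply, pairMatrix]
    push_cast
    simp only [Finset.mul_sum, Finset.sum_mul]
    refine Finset.sum_congr rfl fun j _ => ?_
    have := hd' i
    field_simp
  have hs₂ : ∀ i, 2 * k₂ i = pairMatrix d R (Sum.inl i) (Sum.inl i) := by
    intro i
    simp only [hk₂, toRat_eq hd, toBlocks_fromBlocks₁₁, toBlocks_fromBlocks₁₂,
      Matrix.mul_apply, transpose_apply, of_apply, pairMatrix]
    push_cast
    rw [Finset.mul_sum, Finset.mul_sum]
    refine Finset.sum_congr rfl fun j _ => ?_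
    ring
  -- `U` has the same antisymmetrization as `pairMatrix` and zero diagonal. The difference is
  -- symmetric, so modulo 2 it reduces to its diagonal, which contains the vectors `(D γ ᵗδ)_0` and
  -- `(α ᵗβ)_0` up to the weights `d_i`.
  set U : Matrix (Fin g ⊕ Fin g) (Fin g ⊕ Fin g) ℤ :=
    fromBlocks 0 (diagonal fun i => (d i : ℤ)) 0 0 with hU
  obtain ⟨t, ht⟩ := exists_quadratic_eq_linear_add_two_mul
    (fun a b => pairMatrix d R a b - U a b) (fun a b => by
      have h := pairMatrix_sub hR a b
      rcases a with i | i <;> rcases b with j | j <;>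
        simp only [hU, fromBlocks_apply₁₁, fromBlocks_apply₁₂, fromBlocks_apply₂₁,
          fromBlocks_apply₂₂, Matrix.zero_apply, Matrix.neg_apply] at h ⊢
      · linarith
      · linarith
      · rw [diagonal_apply] at h ⊢
        rcases eq_or_ne i j with rfl | hij
        · simp at h ⊢; linarith
        · simp [hij, hij.symm] at h ⊢; linarith
      · linarith) x
  have hUsum : ∑ a, ∑ b, x a * U a b * x b = ∑ i, (d i : ℤ) * x (Sum.inl i) * x (Sum.inr i) := by
    simp only [Fintype.sum_sum_type, hU, fromBlocks_apply₁₁, fromBlocks_apply₁₂,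
      fromBlocks_apply₂₁, fromBlocks_apply₂₂, Matrix.zero_apply, mul_zero, zero_mul,
      Finset.sum_const_zero, zero_add, add_zero, diagonal_apply, mul_ite, ite_mul,
      Finset.sum_ite_eq, Finset.mem_univ, if_true]
    exact Finset.sum_congr rfl fun i _ => by ring
  have hdiag : ∑ a, (pairMatrix d R a a - U a a) * x a =
      ∑ i, (pairMatrix d R (Sum.inl i) (Sum.inl i) * x (Sum.inl i) +
        pairMatrix d R (Sum.inr i) (Sum.inr i) * x (Sum.inr i)) := by
    rw [Fintype.sum_sum_type, ← Finset.sum_add_distrib]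
    simp [hU]
  have hmain : ∑ a, ∑ b, x a * pairMatrix d R a b * x b =
      ∑ i, ((d i : ℤ) * x (Sum.inl i) * x (Sum.inr i) +
        (pairMatrix d R (Sum.inr i) (Sum.inr i) * x (Sum.inr i) -
          pairMatrix d R (Sum.inl i) (Sum.inl i) * x (Sum.inl i))) +
      2 * (t + ∑ i, pairMatrix d R (Sum.inl i) (Sum.inl i) * x (Sum.inl i)) := by
    have h : ∑ a, ∑ b, x a * pairMatrix d R a b * x b =
        ∑ a, ∑ b, x a * (pairMatrix d R a b - U a b) * x b + ∑ a, ∑ b, x a * U a b * x b := by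
      simp only [← Finset.sum_add_distrib]
      exact Finset.sum_congr rfl fun a _ => Finset.sum_congr rfl fun b _ => by ring
    rw [h, ht, hUsum, hdiag]
    simp only [Finset.sum_add_distrib, Finset.sum_sub_distrib]
    ring
  -- The second characteristic enters `charForm` with a minus sign; reversing the sign of its
  -- diagonal term costs an even integer.
  refine ⟨t + ∑ i, pairMatrix d R (Sum.inl i) (Sum.inl i) * x (Sum.inl i), ?_⟩
  rw [charForm_zero_vecMul, hmain, charForm]
  push_cast
  congr 1
  refine Finset.sum_congr rfl fun i _ => ?_
  rw [← hs₁, ← hs₂]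
  ring

end Characteristic

/-! ### The exponents 8 and 24. -/

section Exponent

variable {g : ℕ} {d : Fin g → ℕ}

lemma goodExponent_twentyFour (d : Fin g → ℕ) : GoodExponent d 24 :=
  ⟨⟨3, rfl⟩, fun i => ⟨2 * ((∏ j ∈ Finset.univ.erase i, (d j : ℤ)) *
    ((d i - 1) * (2 * d i - 1))), by push_cast; ring⟩⟩

/-- Only a factor 3 is missing. If `3 ∤ d_i`, it divides `d_i - 1` or `2 d_i - 1`. If `3 ∣ d_i`,
then it divides `d_g`, and as the type is not exceptional also `d_{g-1}`, so some other `d_j`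
supplies it. -/
lemma goodExponent_eight (hd : IsPolarizationType d) (h : ¬ IsExceptional d) :
    GoodExponent d 8 := by
  refine ⟨dvd_rfl, fun i => ?_⟩
  suffices h3 : (3 : ℤ) ∣ (∏ j ∈ Finset.univ.erase i, (d j : ℤ)) * ((d i - 1) * (2 * d i - 1)) by
    obtain ⟨t, ht⟩ := h3
    exact ⟨2 * t, by rw [ht]; push_cast; ring⟩
  by_cases hi : 3 ∣ d i
  · refine dvd_mul_of_dvd_left ?_ _
    suffices ∃ j, j ≠ i ∧ 3 ∣ d j by
      obtain ⟨j, hji, hj⟩ := this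
      exact dvd_trans (by exact_mod_cast hj)
        (Finset.dvd_prod_of_mem (fun j => (d j : ℤ)) (Finset.mem_erase.2 ⟨hji, Finset.mem_univ j⟩))
    have hlast : ∀ j : Fin g, (j : ℕ) + 1 = g → 3 ∣ d j := fun j hj =>
      hi.trans (hd.2 i j (Fin.le_def.2 (by have := i.isLt; omega)))
    obtain ⟨j, hj, hj3⟩ : ∃ j : Fin g, (j : ℕ) + 2 = g ∧ Nat.gcd 3 (d j) ≠ 1 := by
      by_contra hne
      push Not at hne
      exact h ⟨hlast, hne⟩
    have hj3' : 3 ∣ d j := by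
      by_contra hn
      exact hj3 ((Nat.Prime.coprime_iff_not_dvd Nat.prime_three).2 hn)
    rcases eq_or_ne j i with rfl | hji
    · refine ⟨⟨(j : ℕ) + 1, by omega⟩, ?_, hlast _ (by dsimp only; omega)⟩
      intro he
      have := congrArg Fin.val he
      simp at this
    · exact ⟨j, hji, hj3'⟩
  · refine dvd_mul_of_dvd_right ?_ _
    have : d i % 3 = 1 ∨ d i % 3 = 2 := by omega
    rcases this with h1 | h1
    · exact dvd_mul_of_dvd_left (by omega) _
    · exact dvd_mul_of_dvd_right (by omega) _

end Exponent

/-! ### Assembly of the transformation formula. -/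

section Main

variable {g : ℕ} {d : Fin g → ℕ}

lemma hasTransformation_of_mem_genGroup {E : ℕ} (hE : GoodExponent d E) (hd : ∀ i, 0 < d i)
    {G : (Matrix (Fin g ⊕ Fin g) (Fin g ⊕ Fin g) ℤ)ˣ} (hG : G ∈ genGroup d) :
    HasTransformation d E G.val := by
  -- Inverses are handled by proving both statements together. The inverse of a unipotent has `-b`,
  -- and the inverse of a partial inversion is its cube since `S⁴ = 1`.
  suffices h : HasTransformation d E G.val ∧ HasTransformation d E (G⁻¹).val from h.1
  induction hG using Subgroup.closure_induction with
  | mem G hG =>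
    rcases hG with ⟨b, hb, rfl⟩ | ⟨i, rfl⟩
    · exact ⟨hasTransformation_transU hE hd hb,
        hasTransformation_transU (b := -b) hE hd fun i j => by
          simp only [Matrix.neg_apply, neg_mul, hb i j]⟩
    · have h := hasTransformation_invU (E := E) hE.1 hd i
      refine ⟨h, ?_⟩
      have hinv : (invU i)⁻¹ = invU i * (invU i * invU i) := by
        have hS : ModularGroup.S⁻¹ = ModularGroup.S * (ModularGroup.S * ModularGroup.S) := by
          decide
        rw [invU, ← map_inv, ← Pi.mulSingle_inv, hS, Pi.mulSingle_mul, Pi.mulSingle_mul, map_mul,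
          map_mul]
      rw [hinv, Units.val_mul, Units.val_mul]
      exact h.mul hE.1 hd (h.mul hE.1 hd h)
  | one =>
    have h : HasTransformation d E (transU (0 : Matrix (Fin g) (Fin g) ℤ)).val :=
      hasTransformation_transU hE hd fun i j => by simp
    rw [transU_val, fromBlocks_one] at h
    rw [inv_one]
    exact ⟨h, h⟩
  | mul G G' _ _ h h' =>
    rw [_root_.mul_inv_rev]
    exact ⟨h.1.mul hE.1 hd h'.1, h'.2.mul hE.1 hd h.2⟩
  | inv G _ h => exact ⟨h.2, by rw [inv_inv]; exact h.1⟩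

/-- A point of order two modulo `Λ(H_Z)`, in coordinates. -/
lemma isHalf_of_mem_latticeH {Z : Matrix (Fin g) (Fin g) ℂ} (hZ : Z ∈ siegel g)
    {c₁ c₂ : Fin g → ℝ} (hc : (2 : ℂ) • toVec Z c₁ c₂ ∈ latticeH d Z) : IsHalf d c₁ c₂ := by
  have h2 : (2 : ℂ) • toVec Z c₁ c₂ = toVec Z (2 • c₁) (2 • c₂) := by
    rw [two_smul, two_smul, two_smul, toVec_add]
  rw [h2] at hc
  intro i
  constructor
  -- Testing against `D e_i` gives the first coordinate; testing against `Z e_i` below gives the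
  -- second.
  · obtain ⟨k, hk⟩ := hc _ ⟨0, Pi.single i 1, rfl⟩
    rw [formE_toVec hZ] at hk
    refine ⟨k, ?_⟩
    rw [← hk]
    simp [dotProduct, Pi.single_apply]
    ring
  · obtain ⟨k, hk⟩ := hc _ ⟨Pi.single i 1, 0, rfl⟩
    rw [formE_toVec hZ] at hk
    refine ⟨-k, ?_⟩
    push_cast
    rw [← hk]
    simp [dotProduct, Pi.single_apply]

/-- Two branches of the square root of `det (γ Z + δ)` agree up to a sign. -/
lemma IsSqrtDetBranch.eq_or_eq_neg {M : Matrix (Fin g ⊕ Fin g) (Fin g ⊕ Fin g) ℚ}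
    (hM : M ∈ symplecticGroup (Fin g) ℚ) {s s₀ : Matrix (Fin g) (Fin g) ℂ → ℂ}
    (h : IsSqrtDetBranch M s) (h₀ : IsSqrtDetBranch M s₀) :
    ∃ ε : ℂ, ε ^ 2 = 1 ∧ ∀ Z ∈ siegel g, (s Z)⁻¹ = ε * (s₀ Z)⁻¹ := by
  have hne : ∀ {Z}, Z ∈ siegel g → s₀ Z ≠ 0 := fun {Z} hZ h0 => by
    have := h₀.2 Z hZ
    rw [h0, zero_pow two_ne_zero] at this
    exact (denom_isUnit_det hM hZ).ne_zero this.symm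
  rcases siegel_isPreconnected.eq_or_eq_neg_of_sq_eq h.1 h₀.1
    (fun Z hZ => by simp [h.2 Z hZ, h₀.2 Z hZ]) hne with he | he
  · exact ⟨1, by norm_num, fun Z hZ => by rw [he hZ, one_mul]⟩
  · exact ⟨-1, by norm_num, fun Z hZ => by rw [he hZ]; simp [inv_neg]⟩

/-- The theta transformation formula, with an exponent adapted to the type. -/
theorem exists_isTransition_iff {E : ℕ} (hE : GoodExponent d E) (hd : IsPolarizationType d)
    {M : Matrix (Fin g ⊕ Fin g) (Fin g ⊕ Fin g) ℚ} (hM : M ∈ GD d) {c₁ c₂ : Fin g → ℝ}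
    (hc : IsHalf d c₁ c₂) :
    (∃ s, IsSqrtDetBranch M s) ∧ ∀ s, IsSqrtDetBranch M s →
      ∃ CM : Matrix (∀ i, Fin (d i)) (∀ i, Fin (d i)) ℂ, CM.det ^ E = 1 ∧
        ∀ Z ∈ siegel g, ∀ C : Matrix (∀ i, Fin (d i)) (∀ i, Fin (d i)) ℂ,
          IsTransition d M c₁ c₂ Z C ↔ C = (s Z)⁻¹ • CM := by
  obtain ⟨hsymp, R, hR, rfl⟩ := hM
  change toRat d R ∈ _ at hsymp
  change (∃ s, IsSqrtDetBranch (toRat d R) s) ∧ ∀ s, IsSqrtDetBranch (toRat d R) s → ∃ CM :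
    Matrix (∀ i, Fin (d i)) (∀ i, Fin (d i)) ℂ, CM.det ^ E = 1 ∧ ∀ Z ∈ siegel g, ∀ C,
      IsTransition d (toRat d R) c₁ c₂ Z C ↔ C = (s Z)⁻¹ • CM
  obtain ⟨G, hG, rfl⟩ := exists_mem_genGroup hd hR
  obtain ⟨s₀, hs₀, h⟩ := (hasTransformation_of_mem_genGroup hE hd.1 hG).exists_at hE.1 hd.1
  refine ⟨⟨s₀, hs₀⟩, fun s hs => ?_⟩
  obtain ⟨e₁, e₂, he, C₀, hdet, hT⟩ := h c₁ c₂ hc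
  -- The composed characteristic and `M[c]` have the same semicharacter, so they differ by a vector
  -- of `Λ(H_Z)`; the matrix `S` makes the correction.
  have hchar := compatible_char hd.1 hR c₁ c₂
  obtain ⟨hp₁, hp₂⟩ := he.sub_mem hchar
  obtain ⟨S, hS, hshift⟩ := exists_lattice_shift_matrix hd.1 (he.isHalf hc) hp₁ hp₂
  obtain ⟨ε, hε, hsε⟩ := hs.eq_or_eq_neg hsymp hs₀
  have hex : ∀ Z ∈ siegel g, Transition d (toRat d G.val) Z c₁ c₂
      (char₁ d (toRat d G.val) c₁ c₂) (char₂ (toRat d G.val) c₁ c₂)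
      ((s Z)⁻¹ • (ε • (C₀ * S))) := by
    intro Z hZ m v
    rw [hT Z hZ m v]
    simp only [hshift _ (act_mem_siegel hsymp hZ), add_sub_cancel, Finset.mul_sum]
    rw [Finset.sum_comm]
    refine Finset.sum_congr rfl fun n _ => ?_
    -- The sign occurs once in the branch and once in the constant matrix, and `ε² = 1`.
    rw [hsε Z hZ, smul_smul, mul_right_comm, ← sq, hε, one_mul, Matrix.smul_apply,
      Matrix.mul_apply, smul_eq_mul, Finset.mul_sum, Finset.sum_mul]
    refine Finset.sum_congr rfl fun k _ => ?_
    rw [Matrix.smul_apply, smul_eq_mul]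
    ring
  refine ⟨ε • (C₀ * S), ?_, fun Z hZ C => ⟨fun hC => ?_, ?_⟩⟩
  · rw [det_smul, det_mul, mul_pow, mul_pow, hdet, pow_eq_one_of_eight_dvd hE.1 hS, one_mul,
      mul_one]
    apply pow_eq_one_of_eight_dvd hE.1
    rw [← pow_mul, mul_comm, pow_mul, show 8 = 2 * 4 from rfl, pow_mul, hε, one_pow, one_pow]
  · exact Transition.unique hd.1 hsymp hZ hC (hex Z hZ)
  · rintro rfl
    exact hex Z hZ

end Main

end
end HigherTheta

theorem proposition1p1 (g : ℕ) (hg : 1 ≤ g) (d : Fin g → ℕ) (hd : IsPolarizationType d)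
    (M : Matrix (Fin g ⊕ Fin g) (Fin g ⊕ Fin g) ℚ) (hM : M ∈ GD d)
    (c₁ c₂ : Fin g → ℝ) (Z₀ : Matrix (Fin g) (Fin g) ℂ) (hZ₀ : Z₀ ∈ siegel g)
    (hc : (2 : ℂ) • toVec Z₀ c₁ c₂ ∈ latticeH d Z₀) :
    (∃ s, IsSqrtDetBranch M s) ∧
    ∀ s, IsSqrtDetBranch M s →
      ∃ CM : Matrix (∀ i, Fin (d i)) (∀ i, Fin (d i)) ℂ,
        (¬ IsExceptional d → CM.det ^ 8 = 1) ∧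
        (IsExceptional d → CM.det ^ 24 = 1) ∧
        ∀ Z ∈ siegel g, ∀ C : Matrix (∀ i, Fin (d i)) (∀ i, Fin (d i)) ℂ,
          IsTransition d M c₁ c₂ Z C ↔ C = (s Z)⁻¹ • CM := by
  have hhalf := isHalf_of_mem_latticeH hZ₀ hc
  by_cases h : IsExceptional d
  · obtain ⟨hs, hT⟩ := exists_isTransition_iff (goodExponent_twentyFour d) hd hM hhalf
    refine ⟨hs, fun s hb => ?_⟩
    obtain ⟨CM, hdet, hC⟩ := hT s hb
    exact ⟨CM, fun hn => absurd h hn, fun _ => hdet, hC⟩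
  · obtain ⟨hs, hT⟩ := exists_isTransition_iff (goodExponent_eight hd h) hd hM hhalf
    refine ⟨hs, fun s hb => ?_⟩
    obtain ⟨CM, hdet, hC⟩ := hT s hb
    exact ⟨CM, fun _ => hdet, fun he => absurd he h, hC⟩
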